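/- **Setting.** Let $d\in\mathbb N$, let $\hat k\in L^1(\mathbb R^d)$ satisfy $0\le\hat k\le1$ almost everywhere, let $\mathcal F f(\lambda)=\hat f(\lambda)=(2\pi)^{-d/2}\int_{\mathbb R^d} e^{-ix\cdot\lambda}f(x)\,dx$ denote the Fourier transform, extended to $L^2(\mathbb R^d\to\mathbb C)$ and to tempered distributions, and put $k=\mathcal F^{-1}\hat k$ and $\varkappa(x)=(2\pi)^{-d/2}k(x)$. Scalar products and the pairings extending them are antilinear in the first argument. $S(\mathbb R^d)$ is the space of real-valued Schwartz functions and $S_{\mathbb C}(\mathbb R^d)$ its complexification. Let $H=L^2(\mathbb R^d)$ and let $\mathcal F_{\mathrm a}(H\oplus H)=\bigoplus_{n\ge0}(H_{\mathbb C}\oplus H_{\mathbb C})^{\wedge n}$ be the antisymmetric Fock space, where $h_1\wedge\dots\wedge h_n$ is the orthogonal projection of $h_1\otimes\dots\otimes h_n$ to the antisymmetric tensors. Let $\Omega=(1,0,0,\dots)$ be the vacuum, and let $\mathcal F_{\mathrm a,fin}(H\oplus H)$ be the space of finite particle vectors with the topology of the direct sum (convergence is uniform finiteness together with coordinatewise convergence).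 The annihilation and creation operators are given by $$a(f)\,h_1\wedge\dots\wedge h_n=\tfrac1{\sqrt n}\sum_{i=1}^n(-1)^{i+1}(f,h_i)\,h_1\wedge\dots\check h_i\dots\wedge h_n,\qquad a^*(f)\,h_1\wedge\dots\wedge h_n=\sqrt{n+1}\,f\wedge h_1\wedge\dots\wedge h_n,$$ and $a_1(f)=a(f,0)$, $a_2(f)=a(0,f)$, and likewise for $a_i^*$. Put $\varkappa_1=(2\pi)^{-d/2}\mathcal F^{-1}\hat k^{1/2}\in L^2$ and $\varkappa_2=(2\pi)^{-d/2}\mathcal F^{-1}(1-\hat k)^{1/2}\in S_{\mathbb C}'$, let $\varkappa_{i,x}$ be the translate with $\langle\varkappa_{i,x},g\rangle=\langle\varkappa_i,g(x+\cdot)\rangle$, and set, for $x\in\mathbb R^d$, $$\psi(x)=a_2(\varkappa_{2,x})+a_1^*(\overline{\varkappa}_{1,x}),$$ which acts on wedge products $G=\varphi_1\wedge\dots\wedge\varphi_n$ of test vectors $\varphi_i\in S_{\mathbb C}(\mathbb R^d)\oplus S_{\mathbb C}(\mathbb R^d)$; let $\psi^*(x)$ be the adjoint of $\psi(x)$ in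 the sense of the pairing and $\rho_{\mathrm a}(x)=\psi^*(x)\psi(x)$. For $f\in S(\mathbb R^d)$ the smeared particle density $\rho_{\mathrm a}(f)=\int f(x)\rho_{\mathrm a}(x)\,dx$ is the continuous linear operator on $\mathcal F_{\mathrm a,fin}(H\oplus H)$ with $$(\rho_{\mathrm a}(f)G_1,G_2)=\int_{\mathbb R^d}f(x)\,(\psi(x)G_1,\psi(x)G_2)\,dx$$ for all wedge products $G_1,G_2$ of test vectors, the integrand being integrable. The normal products are defined by $:\!\rho_{\mathrm a}(x)\!:\;=\rho_{\mathrm a}(x)$ and $$:\!\rho_{\mathrm a}(x_{n+1})\cdots\rho_{\mathrm a}(x_1)\!:\;=\Big(\rho_{\mathrm a}(x_{n+1}):\!\rho_{\mathrm a}(x_1)\cdots\rho_{\mathrm a}(x_n)\!:-\sum_{i=1}^n\delta(x_{n+1}-x_i):\!\rho_{\mathrm a}(x_1)\cdots\rho_{\mathrm a}(x_n)\!:\Big)^{\sim},$$ where $(\cdot)^\sim$ is symmetrization in $x_1,\dots,x_{n+1}$, the recursion being understood after integration with test functions: with $N_n(f_1,\dots,f_n)=\int f_1(x_1)\cdots f_n(x_n):\!\rho_{\mathrm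 a}(x_1)\cdots\rho_{\mathrm a}(x_n)\!:dx_1\cdots dx_n$ it says that $N_{n+1}(f_1,\dots,f_{n+1})$ is the average over all permutations of $f_1,\dots,f_{n+1}$ of $$\rho_{\mathrm a}(f_{n+1})N_n(f_1,\dots,f_n)-\sum_{i=1}^nN_n(f_1,\dots,f_if_{n+1},\dots,f_n).$$ **Proposition 3.2.** For each $f\in S(\mathbb R^d)$ the operator $\rho_{\mathrm a}(f)$ is well defined, that is, there is exactly one operator as described. For all $n\in\mathbb N$ and $f_1,\dots,f_n\in S(\mathbb R^d)$, $$\Big(\int_{(\mathbb R^d)^n}dx_1\cdots dx_n\,f_1(x_1)\cdots f_n(x_n):\!\rho_{\mathrm a}(x_1)\cdots\rho_{\mathrm a}(x_n)\!:\,\Omega,\ \Omega\Big)=\int_{(\mathbb R^d)^n}(f_1\hat\otimes\cdots\hat\otimes f_n)(x_1,\dots,x_n)\,\det\big(\varkappa(x_i-x_j)\big)_{i,j=1}^n\,dx_1\cdots dx_n,$$ where $\hat\otimes$ is the symmetric tensor product, $(f_1\hat\otimes\cdots\hat\otimes f_n)(x_1,\dots,x_n)=\frac1{n!}\sum_{\sigma}\prod_if_{\sigma(i)}(x_i)$,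 and the integrand on the right-hand side is integrable. -/

import Mathlib

open MeasureTheory SchwartzMap FourierTransform

noncomputable section

namespace FermiGas

section Fock

/-! ### The antisymmetric Fock space over `L²(X, ν; ℂ)`

The `n`-fold Hilbert tensor power of `L²(X, ν)` is `L²(Xⁿ, νⁿ)`. -/

variable {X : Type*} [MeasurableSpace X] (ν : Measure X) [SigmaFinite ν]

/-- The Hilbert tensor power `L²(X, ν)^{⊗ n} = L²(Xⁿ, νⁿ)`. -/
abbrev TensorPower (n : ℕ) : Type _ := Lp ℂ 2 (Measure.pi fun _ : Fin n => ν)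

variable {ν}

theorem memLp_tensor {n : ℕ} (h : Fin n → Lp ℂ 2 ν) :
    MemLp (fun x : Fin n → X => ∏ i, h i (x i)) 2 (Measure.pi fun _ : Fin n => ν) := by
  have hm : AEStronglyMeasurable (fun x : Fin n → X => ∏ i, h i (x i))
      (Measure.pi fun _ : Fin n => ν) := by
    refine (Finset.measurable_prod _ fun i _ => ?_).aestronglyMeasurable
    exact (Lp.stronglyMeasurable (h i)).measurable.comp (measurable_pi_apply i)
  rw [memLp_two_iff_integrable_sq_norm hm]
  simp only [norm_prod, ← Finset.prod_pow]
  exact Integrable.fintype_prod (f := fun (i : Fin n) (y : X) => ‖h i y‖ ^ 2)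
    fun i => (memLp_two_iff_integrable_sq_norm (Lp.aestronglyMeasurable (h i))).1 (Lp.memLp (h i))

/-- The elementary tensor `h₁ ⊗ ⋯ ⊗ hₙ`, i.e. `(x₁, …, xₙ) ↦ h₁(x₁) ⋯ hₙ(xₙ)`. -/
def tensor {n : ℕ} (h : Fin n → Lp ℂ 2 ν) : TensorPower ν n := (memLp_tensor h).toLp

/-- `h₁ ∧ ⋯ ∧ hₙ`, the orthogonal projection of `h₁ ⊗ ⋯ ⊗ hₙ` to the antisymmetric tensors. -/
def antisymTensor {n : ℕ} (h : Fin n → Lp ℂ 2 ν) : TensorPower ν n :=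
  (n.factorial : ℂ)⁻¹ • ∑ σ : Equiv.Perm (Fin n), ((Equiv.Perm.sign σ : ℤ) : ℂ) • tensor (h ∘ σ)

variable (ν)

/-- The `n`-particle space `L²(X, ν)^{∧ n}`: the closed linear span of all `h₁ ∧ ⋯ ∧ hₙ`. -/
def AntisymPower (n : ℕ) : Submodule ℂ (TensorPower ν n) :=
  (Submodule.span ℂ (Set.range (antisymTensor (ν := ν) (n := n)))).topologicalClosure

/-- The antisymmetric Fock space, the Hilbert space direct sum of the `n`-particle spaces. -/
abbrev Fock : Type _ := lp (fun n : ℕ => AntisymPower ν n) 2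

/-- The finite particle vectors of the Fock space. -/
def FockFin : Submodule ℂ (Fock ν) where
  carrier := {g | ∃ N, ∀ n, N ≤ n → g n = 0}
  zero_mem' := ⟨0, fun _ _ => rfl⟩
  add_mem' := by
    rintro a b ⟨N, hN⟩ ⟨M, hM⟩
    refine ⟨max N M, fun n hn => ?_⟩
    rw [lp.coeFn_add, Pi.add_apply, hN n (le_trans (le_max_left _ _) hn),
      hM n (le_trans (le_max_right _ _) hn), add_zero]
  smul_mem' := by
    rintro c a ⟨N, hN⟩
    refine ⟨N, fun n hn => ?_⟩
    rw [lp.coeFn_smul, Pi.smul_apply, hN n hn, smul_zero]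

variable {ν}

/-- `h₁ ∧ ⋯ ∧ hₙ` as a finite particle vector. -/
def wedge {n : ℕ} (h : Fin n → Lp ℂ 2 ν) : FockFin ν :=
  ⟨lp.single 2 n ⟨antisymTensor h, Submodule.le_topologicalClosure _
      (Submodule.subset_span ⟨h, rfl⟩)⟩,
    n + 1, fun m hm => lp.single_apply_ne 2 n _ (by omega)⟩

/-- The vacuum `Ω = (1, 0, 0, …)` (the empty wedge product is the function `1` on `X⁰`). -/
def vacuum : FockFin ν := wedge (Fin.elim0 : Fin 0 → Lp ℂ 2 ν)

/-- The annihilation operator on `h₁ ∧ ⋯ ∧ hₙ`,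
`a(f) h₁ ∧ ⋯ ∧ hₙ = n^{-1/2} ∑ᵢ (-1)^{i+1} (f, hᵢ) h₁ ∧ ⋯ ȟᵢ ⋯ ∧ hₙ`, where `c i = (f, hᵢ)` are the
values of the pairing with `f` (the index `i` of the code starts at `0`). -/
def annihilate : {n : ℕ} → (c : Fin n → ℂ) → (h : Fin n → Lp ℂ 2 ν) → FockFin ν
  | 0, _, _ => 0
  | n + 1, c, h => ((Real.sqrt (n + 1 : ℝ) : ℂ)⁻¹) •
      ∑ i : Fin (n + 1), ((-1 : ℂ) ^ (i : ℕ) * c i) • wedge (fun j => h (i.succAbove j))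

/-- The creation operator on `h₁ ∧ ⋯ ∧ hₙ`,
`a*(f) h₁ ∧ ⋯ ∧ hₙ = (n + 1)^{1/2} f ∧ h₁ ∧ ⋯ ∧ hₙ`. -/
def create {n : ℕ} (f : Lp ℂ 2 ν) (h : Fin n → Lp ℂ 2 ν) : FockFin ν :=
  (Real.sqrt (n + 1 : ℝ) : ℂ) • wedge (Fin.cons f h : Fin (n + 1) → Lp ℂ 2 ν)

/-- Convergence of sequences of finite particle vectors in the topology of the direct sum:
uniform finiteness and coordinatewise convergence. -/
def FinTendsto (G : ℕ → FockFin ν) (G₀ : FockFin ν) : Prop :=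
  (∃ N, ∀ j n, N ≤ n → (G j : Fock ν) n = 0) ∧
    ∀ n, Filter.Tendsto (fun j => (G j : Fock ν) n) Filter.atTop (nhds ((G₀ : Fock ν) n))

/-- Continuity of a linear operator on the finite particle vectors (for linear operators on this
direct sum of Banach spaces, sequential continuity is continuity). -/
def FinContinuous (T : Module.End ℂ (FockFin ν)) : Prop :=
  ∀ (G : ℕ → FockFin ν) (G₀ : FockFin ν), FinTendsto G G₀ → FinTendsto (fun j => T (G j)) (T G₀)

end Fock

/-! ### The free Fermi gas on `ℝᵈ` -/

/-- The space `ℝᵈ`. -/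
abbrev Space (d : ℕ) : Type := EuclideanSpace ℝ (Fin d)

/-- The unitary normalization of the Fourier transform,
`(2π)^{-d/2} ∫ e^{-i x·λ} f(x) dx`. -/
def fourierTr {d : ℕ} (f : Space d → ℂ) (l : Space d) : ℂ :=
  (((2 * Real.pi) ^ (-(d : ℝ) / 2) : ℝ) : ℂ) *
    ∫ x : Space d, Complex.exp (-(Complex.I * (inner ℝ x l : ℝ))) * f x

/-- The inverse Fourier transform `(2π)^{-d/2} ∫ e^{i λ·x} f(λ) dλ`. -/
def fourierInvTr {d : ℕ} (f : Space d → ℂ) (x : Space d) : ℂ :=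
  (((2 * Real.pi) ^ (-(d : ℝ) / 2) : ℝ) : ℂ) *
    ∫ l : Space d, Complex.exp (Complex.I * (inner ℝ l x : ℝ)) * f l

/-- The density distribution `k̂` in momentum space: `0 ≤ k̂ ≤ 1` almost everywhere and
`k̂ ∈ L¹(ℝᵈ)`. -/
structure MomentumDensity (d : ℕ) where
  toFun : Space d → ℝ
  nonneg : ∀ᵐ l, 0 ≤ toFun l
  le_one : ∀ᵐ l, toFun l ≤ 1
  integrable : Integrable toFun

/-- The measure of `{0, 1} × ℝᵈ`, for which `L²({0, 1} × ℝᵈ) = L²(ℝᵈ) ⊕ L²(ℝᵈ)`. -/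
abbrev twoCopies (d : ℕ) : Measure (Fin 2 × Space d) :=
  (Measure.count : Measure (Fin 2)).prod volume

theorem memLp_pair {d : ℕ} (f g : Lp ℂ 2 (volume : Measure (Space d))) :
    MemLp (fun p : Fin 2 × Space d => if p.1 = 0 then f p.2 else g p.2) 2 (twoCopies d) := by
  have hf : Measurable (f : Space d → ℂ) := (Lp.stronglyMeasurable f).measurable
  have hg : Measurable (g : Space d → ℂ) := (Lp.stronglyMeasurable g).measurable
  have hm : AEStronglyMeasurable
      (fun p : Fin 2 × Space d => if p.1 = 0 then f p.2 else g p.2) (twoCopies d) := by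
    refine Measurable.aestronglyMeasurable (Measurable.ite ?_ (hf.comp measurable_snd)
      (hg.comp measurable_snd))
    exact measurable_fst (measurableSet_singleton (0 : Fin 2))
  rw [memLp_two_iff_integrable_sq_norm hm, integrable_prod_iff (by fun_prop)]
  refine ⟨Filter.Eventually.of_forall fun i => ?_, Integrable.of_finite⟩
  by_cases hi : i = 0
  · simpa [hi] using
      (memLp_two_iff_integrable_sq_norm (Lp.aestronglyMeasurable f)).1 (Lp.memLp f)
  · simpa [hi] using
      (memLp_two_iff_integrable_sq_norm (Lp.aestronglyMeasurable g)).1 (Lp.memLp g)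

/-- The vector `(f, g)` of `L²(ℝᵈ) ⊕ L²(ℝᵈ)`. -/
def pair {d : ℕ} (f g : Lp ℂ 2 (volume : Measure (Space d))) : Lp ℂ 2 (twoCopies d) :=
  (memLp_pair f g).toLp

/-- The Fock space `𝓕ₐ,fin(H ⊕ H)` for `H = L²(ℝᵈ)`. -/
abbrev FermiFockFin (d : ℕ) : Type := FockFin (twoCopies d)

/-- The test vectors `Φ = S_ℂ(ℝᵈ) ⊕ S_ℂ(ℝᵈ)`. -/
abbrev TestVector (d : ℕ) : Type := 𝓢(Space d, ℂ) × 𝓢(Space d, ℂ)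

/-- The inclusion of `Φ` in `L²(ℝᵈ) ⊕ L²(ℝᵈ)`. -/
def TestVector.toL2 {d : ℕ} (φ : TestVector d) : Lp ℂ 2 (twoCopies d) :=
  pair (φ.1.toLp 2) (φ.2.toLp 2)

namespace MomentumDensity

variable {d : ℕ} (k : MomentumDensity d)

theorem memLp_sqrt : MemLp (fun ξ : Space d => ((Real.sqrt (k.toFun ((2 * Real.pi) • ξ)) : ℝ) : ℂ))
    2 volume := by
  have h2 : (2 * Real.pi) ≠ 0 := by positivity
  have hi : Integrable (fun ξ : Space d => k.toFun ((2 * Real.pi) • ξ)) :=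
    k.integrable.comp_smul h2
  have hm : AEStronglyMeasurable
      (fun ξ : Space d => ((Real.sqrt (k.toFun ((2 * Real.pi) • ξ)) : ℝ) : ℂ)) volume :=
    (Complex.continuous_ofReal.comp Real.continuous_sqrt).comp_aestronglyMeasurable
      hi.aestronglyMeasurable
  rw [memLp_two_iff_integrable_sq_norm hm]
  refine hi.abs.mono (hm.norm.pow 2) (Filter.Eventually.of_forall fun ξ => ?_)
  simp only [Complex.norm_real, Real.norm_eq_abs, abs_abs, abs_pow,
    abs_of_nonneg (Real.sqrt_nonneg _)]
  rcases le_total 0 (k.toFun ((2 * Real.pi) • ξ)) with h | h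
  · rw [Real.sq_sqrt h]; exact le_abs_self _
  · rw [Real.sqrt_eq_zero_of_nonpos h]; simp

/-- `ϰ₁ = (2π)^{-d/2} 𝓕⁻¹(k̂^{1/2}) ∈ L²(ℝᵈ)` in the unitary normalization of `𝓕`, that is,
`ϰ₁(x) = (2π)^{-d} ∫ e^{iλ·x} k̂(λ)^{1/2} dλ` in the sense of `L²`. The substitution `λ = 2πξ` turns
this into `∫ e^{2πiξ·x} k̂(2πξ)^{1/2} dξ`, which is the inverse Fourier-Plancherel transform of
Mathlib. -/
def kappa₁ : Lp ℂ 2 (volume : Measure (Space d)) := 𝓕⁻ k.memLp_sqrt.toLp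

/-- The complex conjugate of `ϰ_{1,x}`, where `ϰ_{1,x}(y) = ϰ₁(y - x)`. -/
def conjKappa₁ (x : Space d) : Lp ℂ 2 (volume : Measure (Space d)) :=
  star (Lp.compMeasurePreserving (fun y => y - x) (measurePreserving_sub_right volume x) k.kappa₁)

/-- The pairing `⟨ϰ_{2,x}, g⟩ = ⟨ϰ₂, g(x + ·)⟩ = (K₂ g)(x)` of a test function `g` with the tempered
distribution `ϰ_{2,x}`, where `ϰ₂ = (2π)^{-d/2} 𝓕⁻¹(1 - k̂)^{1/2}` and
`K₂ = 𝓕⁻¹ (1 - k̂)^{1/2} 𝓕`. The pairing is the one that extends the scalar product of `L²`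
(antilinear in the first place), so that it equals
`(2π)^{-d/2} ∫ e^{iλ·x} (1 - k̂(λ))^{1/2} ĝ(λ) dλ`. -/
def kappa₂Pairing (x : Space d) (g : 𝓢(Space d, ℂ)) : ℂ :=
  fourierInvTr (fun l => (Real.sqrt (1 - k.toFun l) : ℂ) * fourierTr g l) x

/-- The field operator `ψ(x) = a₂(ϰ_{2,x}) + a₁*(ϰ̄_{1,x})` applied to `φ₁ ∧ ⋯ ∧ φₙ` with
`φᵢ ∈ Φ`. -/
def psi (x : Space d) {n : ℕ} (φ : Fin n → TestVector d) : FermiFockFin d :=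
  annihilate (fun i => k.kappa₂Pairing x (φ i).2) (fun i => (φ i).toL2) +
    create (pair (k.conjKappa₁ x) 0) (fun i => (φ i).toL2)

/-- `T` is the smeared particle density operator `ρₐ(f) = ∫ f(x) ψ*(x) ψ(x) dx`: a continuous
operator on the finite particle vectors such that
`⟨T G₁, G₂⟩ = ∫ f(x) ⟨ψ*(x) ψ(x) G₁, G₂⟩ dx = ∫ f(x) ⟨ψ(x) G₁, ψ(x) G₂⟩ dx`
for all products `G₁ = φ₁ ∧ ⋯ ∧ φₘ`, `G₂ = χ₁ ∧ ⋯ ∧ χₙ` of test vectors (here `ψ*(x)`, which maps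
finite particle vectors to distributions, is the adjoint of `ψ(x)`). These products are total in the
space `𝓕ₐ,fin(Φ)` of all test functions, so that `T` is determined by them. -/
def IsParticleDensity (f : 𝓢(Space d, ℝ)) (T : Module.End ℂ (FermiFockFin d)) : Prop :=
  FinContinuous T ∧
    ∀ (m n : ℕ) (φ : Fin m → TestVector d) (χ : Fin n → TestVector d),
      Integrable (fun x : Space d => (f x : ℂ) * inner ℂ (k.psi x φ) (k.psi x χ)) ∧
      inner ℂ (T (wedge fun i => (φ i).toL2)) (wedge fun i => (χ i).toL2) =
        ∫ x : Space d, (f x : ℂ) * inner ℂ (k.psi x φ) (k.psi x χ)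

/-- The smeared particle density operator `ρₐ(f)`, the unique operator with the property
`IsParticleDensity`. -/
def rho (f : 𝓢(Space d, ℝ)) : Module.End ℂ (FermiFockFin d) :=
  Classical.epsilon (k.IsParticleDensity f)

/-- The function `ϰ(x) = (2π)^{-d/2} k(x)`, where `k` is the inverse Fourier transform of `k̂`. -/
def kappa (x : Space d) : ℂ :=
  (((2 * Real.pi) ^ (-(d : ℝ) / 2) : ℝ) : ℂ) * fourierInvTr (fun l => (k.toFun l : ℂ)) x

end MomentumDensity

/-- The pointwise product of two real test functions. -/
def mulTest {d : ℕ} (f g : 𝓢(Space d, ℝ)) : 𝓢(Space d, ℝ) :=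
  pairing (ContinuousLinearMap.mul ℝ ℝ) f g

/-- The smeared normal products
`N_n(f₁, …, fₙ) = ∫ f₁(x₁) ⋯ fₙ(xₙ) :ρ(x₁) ⋯ ρ(xₙ): dx₁ ⋯ dxₙ` of an operator valued distribution
`ρ`. They come from the recursion `:ρ(x): = ρ(x)` and
`:ρ(x_{n+1}) ⋯ ρ(x₁): = (ρ(x_{n+1}) :ρ(x₁) ⋯ ρ(xₙ): - ∑ᵢ δ(x_{n+1} - xᵢ) :ρ(x₁) ⋯ ρ(xₙ):)^~`,
where `^~` is the symmetrization in `x₁, …, x_{n+1}`; smearing the `i`-th delta function multiplies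
the test function of `xᵢ` by that of `x_{n+1}`. The recursion starts here one step earlier, with the
identity for `n = 0`. -/
def normalProduct {d : ℕ} {V : Type*} [AddCommGroup V] [Module ℂ V]
    (ρ : 𝓢(Space d, ℝ) → Module.End ℂ V) :
    (n : ℕ) → (Fin n → 𝓢(Space d, ℝ)) → Module.End ℂ V
  | 0, _ => 1
  | n + 1, f => ((n + 1).factorial : ℂ)⁻¹ • ∑ σ : Equiv.Perm (Fin (n + 1)),
      (ρ (f (σ (Fin.last n))) * normalProduct ρ n (fun j => f (σ j.castSucc)) -
        ∑ i : Fin n, normalProduct ρ n (Function.update (fun j => f (σ j.castSucc)) i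
          (mulTest (f (σ i.castSucc)) (f (σ (Fin.last n))))))

/-- The symmetric tensor product `f₁ ⊗̂ ⋯ ⊗̂ fₙ` as a function on `(ℝᵈ)ⁿ`. -/
def symTensor {d n : ℕ} (f : Fin n → 𝓢(Space d, ℝ)) (x : Fin n → Space d) : ℝ :=
  (n.factorial : ℝ)⁻¹ * ∑ σ : Equiv.Perm (Fin n), ∏ i, f (σ i) (x i)

end FermiGas

end

/-!
The field `ψ(x)` is too singular for `ψ*(x) ψ(x)` to be an operator, but the smeared field
`Ψ(u) = ∫ \bar{u(x)} ψ(x) dx`, for `u ∈ L²(ℝᵈ)`, is bounded: it is `a(J u) + a*(C u)` with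
`J u = (0, K₂ u)` and `C u = (\bar{K₁ u}, 0)`, where `K₁` and `K₂` are the Fourier multipliers
`k̂^{1/2}` and `(1 - k̂)^{1/2}`. As `K₁² + K₂² = 1`, these operators satisfy the canonical
anticommutation relations. All that is used of them is collected in `FieldData`.

Fix a positive integrable weight `p` for which `f / p` is still bounded by a multiple of `p` for each
test function `f`, and an orthonormal basis `eᵢ` of `L²(ℝᵈ)`. Since `ϰ_{1,x}` has a norm independent
of `x`, the maps `u ↦ C (p u)` and `u ↦ C ((f / p) u)` are Hilbert-Schmidt, while the annihilation
parts are controlled by the number operator. Hence `ρ(f) = ∑ᵢ Ψ*(p eᵢ) Ψ((f / p) eᵢ)` converges on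
the finite particle vectors (`FieldData.exists_hasSum_fieldAdj_mul_field`). On wedge products of test
vectors the summands are the coefficients along `eᵢ` of the square integrable functions `p ψ(·) G'`
and `(f / p) ψ(·) G`, so that Parseval's identity for vector valued functions
(`hasSum_inner_vecCoeff`) identifies this sum with `∫ f(x) (ψ(x) G, ψ(x) G') dx`
(`MomentumDensity.exists_isParticleDensity`). The operator is unique because wedge products of test
vectors are total.

In the same way `∫ f(x) ψ*(x) T ψ(x) dx` is defined for other operators `T`
(`FieldData.IsSmearing`). The commutator of the field with such an operator consists of a contraction
and of the smeared commutator with `T`. By induction, the step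
`ρ(f_{n+1}) N_n(f₁, …, fₙ) - ∑ᵢ N_n(f₁, …, fᵢ f_{n+1}, …, fₙ)` of the recursion is therefore
`∫ f_{n+1}(x) ψ*(x) N_n(f₁, …, fₙ) ψ(x) dx`. Smearings with two test functions commute, two signs
from the exchange of fields cancelling. So this step is symmetric already, the symmetrization does
not change it, and
`N_n(f₁, …, fₙ) = ∫ f₁(x₁) ⋯ fₙ(xₙ) ψ*(x₁) ⋯ ψ*(xₙ) ψ(xₙ) ⋯ ψ(x₁) dx₁ ⋯ dxₙ` in the iterated sense
(`FieldData.isSmearing_normalProduct`).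

On vectors without particles of the second kind `a₂` vanishes, and `ψ(x)` acts as `a₁*(ϰ̄_{1,x})`,
which preserves these vectors. Starting from the vacuum, the expectation is thus the integral of
`f₁(x₁) ⋯ fₙ(xₙ) ‖a₁*(ϰ̄_{1,xₙ}) ⋯ a₁*(ϰ̄_{1,x₁}) Ω‖²`. The squared norm is the Gram determinant of
the vectors `ϰ̄_{1,xᵢ}`, and `(ϰ̄_{1,x}, ϰ̄_{1,y}) = ϰ(y - x)` as `(k̂^{1/2})² = k̂`
(`MomentumDensity.inner_creators_vacuum`). The symmetric tensor product comes in because all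
permutations of the test functions give the same expectation.
-/

noncomputable section

namespace FermiGas

/-! ### Tensor powers -/

section Tensor

variable {X : Type*} [MeasurableSpace X] {ν : Measure X} [SigmaFinite ν]

theorem coeFn_tensor {n : ℕ} (h : Fin n → Lp ℂ 2 ν) :
    tensor h =ᵐ[Measure.pi fun _ : Fin n => ν] fun x => ∏ i, h i (x i) :=
  (memLp_tensor h).coeFn_toLp

theorem inner_tensor {n : ℕ} (h g : Fin n → Lp ℂ 2 ν) :
    inner ℂ (tensor h) (tensor g) = ∏ i, inner ℂ (h i) (g i) := by
  simp only [L2.inner_def]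
  rw [← integral_fintype_prod_eq_prod (𝕜 := ℂ) (fun i (y : X) => inner ℂ (h i y) (g i y))]
  refine integral_congr_ae ?_
  filter_upwards [coeFn_tensor h, coeFn_tensor g] with x hx gx
  rw [hx, gx]
  simp only [RCLike.inner_apply, map_prod, Finset.prod_mul_distrib]

theorem inner_tensor_antisymTensor {n : ℕ} (h g : Fin n → Lp ℂ 2 ν) :
    inner ℂ (tensor h) (antisymTensor g) =
      (n.factorial : ℂ)⁻¹ * (Matrix.of fun i j => inner ℂ (h i) (g j)).det := by
  rw [antisymTensor, inner_smul_right, inner_sum, ← Matrix.det_transpose, Matrix.det_apply']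
  congr 1
  refine Finset.sum_congr rfl fun σ _ => ?_
  rw [inner_smul_right, inner_tensor]
  rfl

theorem inner_antisymTensor {n : ℕ} (h g : Fin n → Lp ℂ 2 ν) :
    inner ℂ (antisymTensor h) (antisymTensor g) =
      (n.factorial : ℂ)⁻¹ * (Matrix.of fun i j => inner ℂ (h i) (g j)).det := by
  have hn : (n.factorial : ℂ) ≠ 0 := by exact_mod_cast n.factorial_ne_zero
  have key : ∀ σ : Equiv.Perm (Fin n), inner ℂ (((Equiv.Perm.sign σ : ℤ) : ℂ) • tensor (h ∘ σ))
      (antisymTensor g) = (n.factorial : ℂ)⁻¹ * (Matrix.of fun i j => inner ℂ (h i) (g j)).det := by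
    intro σ
    rw [inner_smul_left, inner_tensor_antisymTensor]
    have := Matrix.det_permute σ (Matrix.of fun i j => inner ℂ (h i) (g j))
    rw [show (Matrix.of fun i j => inner ℂ ((h ∘ σ) i) (g j)) =
      (Matrix.of fun i j => inner ℂ (h i) (g j)).submatrix σ id from rfl, this]
    rcases Int.units_eq_one_or (Equiv.Perm.sign σ) with hs | hs <;> simp [hs]
  rw [antisymTensor, inner_smul_left, sum_inner, Finset.sum_congr rfl fun σ _ => key σ,
    Finset.sum_const, Finset.card_univ, Fintype.card_perm, Fintype.card_fin]
  simp only [map_inv₀, map_natCast, nsmul_eq_mul]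
  field_simp

/-- The measure preserving splitting `Xⁿ⁺¹ ≃ X × Xⁿ` off the first variable. -/
theorem measurePreserving_head_tail (ν : Measure X) [SigmaFinite ν] (n : ℕ) :
    MeasurePreserving (fun x : Fin (n + 1) → X => (x 0, fun i : Fin n => x i.succ))
      (Measure.pi fun _ : Fin (n + 1) => ν) (ν.prod (Measure.pi fun _ : Fin n => ν)) := by
  simpa using! measurePreserving_piFinSuccAbove (fun _ : Fin (n + 1) => ν) 0

theorem quasiMeasurePreserving_head (ν : Measure X) [SigmaFinite ν] (n : ℕ) :
    Measure.QuasiMeasurePreserving (fun x : Fin (n + 1) → X => x 0)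
      (Measure.pi fun _ : Fin (n + 1) => ν) ν :=
  Measure.quasiMeasurePreserving_fst.comp (measurePreserving_head_tail ν n).quasiMeasurePreserving

theorem quasiMeasurePreserving_tail (ν : Measure X) [SigmaFinite ν] (n : ℕ) :
    Measure.QuasiMeasurePreserving (fun (x : Fin (n + 1) → X) (i : Fin n) => x i.succ)
      (Measure.pi fun _ : Fin (n + 1) => ν) (Measure.pi fun _ : Fin n => ν) :=
  Measure.quasiMeasurePreserving_snd.comp (measurePreserving_head_tail ν n).quasiMeasurePreserving

theorem integral_head_tail {n : ℕ} (F : X → (Fin n → X) → ℂ) :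
    ∫ x : Fin (n + 1) → X, F (x 0) (fun i => x i.succ) ∂(Measure.pi fun _ => ν) =
      ∫ p, F p.1 p.2 ∂(ν.prod (Measure.pi fun _ : Fin n => ν)) :=
  MeasurePreserving.integral_comp'
    (f := MeasurableEquiv.piFinSuccAbove (fun _ : Fin (n + 1) => X) 0)
    (measurePreserving_piFinSuccAbove (fun _ : Fin (n + 1) => ν) 0) (fun p => F p.1 p.2)

theorem memLp_prodMul {n : ℕ} (w : Lp ℂ 2 ν) (v : TensorPower ν n) :
    MemLp (fun x : Fin (n + 1) → X => w (x 0) * v (fun i => x i.succ)) 2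
      (Measure.pi fun _ => ν) := by
  have h : MemLp (fun p : X × (Fin n → X) => w p.1 * v p.2) 2
      (ν.prod (Measure.pi fun _ : Fin n => ν)) := by
    have hm : AEStronglyMeasurable (fun p : X × (Fin n → X) => w p.1 * v p.2)
        (ν.prod (Measure.pi fun _ : Fin n => ν)) :=
      (Lp.aestronglyMeasurable w).comp_fst.mul (Lp.aestronglyMeasurable v).comp_snd
    rw [memLp_two_iff_integrable_sq_norm hm]
    simp only [norm_mul, mul_pow]
    exact ((memLp_two_iff_integrable_sq_norm (Lp.aestronglyMeasurable w)).1 (Lp.memLp w)).mul_prod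
      ((memLp_two_iff_integrable_sq_norm (Lp.aestronglyMeasurable v)).1 (Lp.memLp v))
  exact h.comp_measurePreserving (measurePreserving_head_tail ν n)

/-- The function `w ⊗ v` of `n + 1` variables, for `w` of one and `v` of `n` variables. -/
def tmulFun {n : ℕ} (w : Lp ℂ 2 ν) (v : TensorPower ν n) : TensorPower ν (n + 1) :=
  (memLp_prodMul w v).toLp

theorem inner_tmulFun {n : ℕ} (w w' : Lp ℂ 2 ν) (v v' : TensorPower ν n) :
    inner ℂ (tmulFun w v) (tmulFun w' v') = inner ℂ w w' * inner ℂ v v' := by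
  simp only [L2.inner_def]
  rw [← integral_prod_mul, ← integral_head_tail
    (fun a b => inner ℂ (w a) (w' a) * inner ℂ (v b) (v' b))]
  refine integral_congr_ae ?_
  filter_upwards [(memLp_prodMul w v).coeFn_toLp, (memLp_prodMul w' v').coeFn_toLp] with x hx hx'
  rw [tmulFun, tmulFun, hx, hx']
  simp only [RCLike.inner_apply, map_mul]
  ring

theorem norm_tmulFun {n : ℕ} (w : Lp ℂ 2 ν) (v : TensorPower ν n) :
    ‖tmulFun w v‖ = ‖w‖ * ‖v‖ := by
  have h : ((‖tmulFun w v‖ ^ 2 : ℝ) : ℂ) = (((‖w‖ * ‖v‖) ^ 2 : ℝ) : ℂ) := by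
    have := inner_tmulFun w w v v
    simp only [inner_self_eq_norm_sq_to_K] at this
    push_cast
    rw [mul_pow]
    exact this
  exact (pow_left_inj₀ (norm_nonneg _) (by positivity) two_ne_zero).1 (Complex.ofReal_injective h)

/-- The tensor product `L²(X) × L²(Xⁿ) → L²(Xⁿ⁺¹)` as a bounded bilinear map. -/
def tmul (n : ℕ) : Lp ℂ 2 ν →L[ℂ] TensorPower ν n →L[ℂ] TensorPower ν (n + 1) :=
  LinearMap.mkContinuous₂ (LinearMap.mk₂ ℂ tmulFun
    (fun w w' v => by
      have h1 := (quasiMeasurePreserving_head ν n).ae (Lp.coeFn_add w w')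
      refine Lp.ext ?_
      filter_upwards [(memLp_prodMul (w + w') v).coeFn_toLp, (memLp_prodMul w v).coeFn_toLp,
        (memLp_prodMul w' v).coeFn_toLp, Lp.coeFn_add (tmulFun w v) (tmulFun w' v), h1]
        with x a b c d e
      rw [d, Pi.add_apply, tmulFun, tmulFun, tmulFun, a, b, c]
      simp only [Pi.add_apply] at e
      rw [e, add_mul])
    (fun r w v => by
      have h1 := (quasiMeasurePreserving_head ν n).ae (Lp.coeFn_smul r w)
      refine Lp.ext ?_
      filter_upwards [(memLp_prodMul (r • w) v).coeFn_toLp, (memLp_prodMul w v).coeFn_toLp,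
        Lp.coeFn_smul r (tmulFun w v), h1] with x a b c d
      rw [c, Pi.smul_apply, tmulFun, tmulFun, a, b]
      simp only [Pi.smul_apply] at d
      rw [d, smul_mul_assoc])
    (fun w v v' => by
      have h1 := (quasiMeasurePreserving_tail ν n).ae (Lp.coeFn_add v v')
      refine Lp.ext ?_
      filter_upwards [(memLp_prodMul w (v + v')).coeFn_toLp, (memLp_prodMul w v).coeFn_toLp,
        (memLp_prodMul w v').coeFn_toLp, Lp.coeFn_add (tmulFun w v) (tmulFun w v'), h1]
        with x a b c d e
      rw [d, Pi.add_apply, tmulFun, tmulFun, tmulFun, a, b, c]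
      simp only [Pi.add_apply] at e
      rw [e, mul_add])
    (fun r w v => by
      have h1 := (quasiMeasurePreserving_tail ν n).ae (Lp.coeFn_smul r v)
      refine Lp.ext ?_
      filter_upwards [(memLp_prodMul w (r • v)).coeFn_toLp, (memLp_prodMul w v).coeFn_toLp,
        Lp.coeFn_smul r (tmulFun w v), h1] with x a b c d
      rw [c, Pi.smul_apply, tmulFun, tmulFun, a, b]
      simp only [Pi.smul_apply] at d
      rw [d, mul_smul_comm])) 1
    (fun w v => by simp [norm_tmulFun])

theorem inner_tmul {n : ℕ} (w w' : Lp ℂ 2 ν) (v v' : TensorPower ν n) :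
    inner ℂ (tmul n w v) (tmul n w' v') = inner ℂ w w' * inner ℂ v v' :=
  inner_tmulFun w w' v v'

theorem norm_tmul {n : ℕ} (w : Lp ℂ 2 ν) (v : TensorPower ν n) :
    ‖tmul n w v‖ = ‖w‖ * ‖v‖ :=
  norm_tmulFun w v

theorem tmul_tensor {n : ℕ} (w : Lp ℂ 2 ν) (h : Fin n → Lp ℂ 2 ν) :
    tmul n w (tensor h) = tensor (Fin.cons w h : Fin (n + 1) → Lp ℂ 2 ν) := by
  have h1 := (quasiMeasurePreserving_tail ν n).ae (coeFn_tensor h)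
  refine Lp.ext ?_
  filter_upwards [(memLp_prodMul w (tensor h)).coeFn_toLp,
    coeFn_tensor (Fin.cons w h : Fin (n + 1) → Lp ℂ 2 ν), h1] with x a b c
  rw [b, Fin.prod_univ_succ]
  refine a.trans ?_
  rw [c]
  simp

/-- The operator `T ⊗ 1` is bounded by the norm of `T`, here on `∑ᵢ eᵢ ⊗ vᵢ` with `eᵢ`
orthonormal. -/
theorem norm_sum_tmul_le {K : Type*} [NormedAddCommGroup K] [InnerProductSpace ℂ K]
    {n : ℕ} {ι : Type*} {e : ι → K} (he : Orthonormal ℂ e) (T : K →L[ℂ] Lp ℂ 2 ν) (t : Finset ι)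
    (v : ι → TensorPower ν n) :
    ‖∑ i ∈ t, tmul n (T (e i)) (v i)‖ ^ 2 ≤ ‖T‖ ^ 2 * ∑ i ∈ t, ‖v i‖ ^ 2 := by
  classical
  -- expand the `v i` in an orthonormal basis of their (finite dimensional) span
  let V : Submodule ℂ (TensorPower ν n) := Submodule.span ℂ (v '' t)
  have : FiniteDimensional ℂ V := FiniteDimensional.span_of_finite ℂ (t.finite_toSet.image v)
  let b := stdOrthonormalBasis ℂ V
  have hv : ∀ i ∈ t, v i ∈ V := fun i hi => Submodule.subset_span ⟨i, hi, rfl⟩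
  let c : ι → Fin (Module.finrank ℂ V) → ℂ := fun i m => inner ℂ (b m : TensorPower ν n) (v i)
  have hexp : ∀ i ∈ t, v i = ∑ m, c i m • (b m : TensorPower ν n) := by
    intro i hi
    have := congrArg (V.subtype) (b.sum_repr' ⟨v i, hv i hi⟩)
    rw [map_sum] at this
    exact this.symm
  have hbo : Orthonormal ℂ (fun m => (b m : TensorPower ν n)) :=
    b.orthonormal.comp_linearIsometry V.subtypeₗᵢ
  have hsum : ∑ i ∈ t, tmul n (T (e i)) (v i) =
      ∑ m, tmul n (T (∑ i ∈ t, c i m • e i)) (b m : TensorPower ν n) := by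
    simp only [map_sum, map_smul, sum_apply, smul_apply]
    rw [Finset.sum_comm]
    refine Finset.sum_congr rfl fun i hi => ?_
    conv_lhs => rw [hexp i hi]
    simp [map_sum]
  have hvn : ∀ i ∈ t, ‖v i‖ ^ 2 = ∑ m, ‖c i m‖ ^ 2 := fun i hi =>
    (b.sum_sq_norm_inner_right ⟨v i, hv i hi⟩).symm
  have horth : Pairwise fun m m' => inner ℂ
      (tmul n (T (∑ i ∈ t, c i m • e i)) (b m : TensorPower ν n))
      (tmul n (T (∑ i ∈ t, c i m' • e i)) (b m' : TensorPower ν n)) = 0 := by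
    intro m m' hm
    rw [inner_tmul, hbo.2 hm, mul_zero]
  have hnorm : ‖∑ m, tmul n (T (∑ i ∈ t, c i m • e i)) (b m : TensorPower ν n)‖ ^ 2 =
      ∑ m, ‖tmul n (T (∑ i ∈ t, c i m • e i)) (b m : TensorPower ν n)‖ ^ 2 := by
    have h2 : ((‖∑ m, tmul n (T (∑ i ∈ t, c i m • e i)) (b m : TensorPower ν n)‖ ^ 2 : ℝ) : ℂ) =
        ((∑ m, ‖tmul n (T (∑ i ∈ t, c i m • e i)) (b m : TensorPower ν n)‖ ^ 2 : ℝ) : ℂ) := by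
      push_cast
      rw [← Complex.coe_algebraMap, ← inner_self_eq_norm_sq_to_K (𝕜 := ℂ), sum_inner]
      refine Finset.sum_congr rfl fun m _ => ?_
      rw [inner_sum, Finset.sum_eq_single m (fun m' _ h => horth h.symm) (by simp),
        inner_self_eq_norm_sq_to_K]
    exact Complex.ofReal_injective h2
  rw [hsum, hnorm, Finset.sum_congr rfl hvn, Finset.sum_comm, Finset.mul_sum]
  refine Finset.sum_le_sum fun m _ => ?_
  rw [norm_tmul, hbo.1, mul_one]
  have hs : ‖∑ i ∈ t, c i m • e i‖ ^ 2 = ∑ i ∈ t, ‖c i m‖ ^ 2 := by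
    have h2 : ((‖∑ i ∈ t, c i m • e i‖ ^ 2 : ℝ) : ℂ) = ((∑ i ∈ t, ‖c i m‖ ^ 2 : ℝ) : ℂ) := by
      push_cast
      rw [← Complex.coe_algebraMap, ← inner_self_eq_norm_sq_to_K (𝕜 := ℂ), he.inner_sum]
      exact Finset.sum_congr rfl fun i _ => Complex.conj_mul' _
    exact Complex.ofReal_injective h2
  rw [← hs, ← mul_pow]
  gcongr
  exact T.le_opNorm _

theorem continuous_tensor (n : ℕ) :
    Continuous (tensor : (Fin n → Lp ℂ 2 ν) → TensorPower ν n) := by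
  induction n with
  | zero => exact continuous_of_const fun h g => by rw [Subsingleton.elim h g]
  | succ n ih =>
    have : (tensor : (Fin (n + 1) → Lp ℂ 2 ν) → TensorPower ν (n + 1)) =
        fun h => tmul n (h 0) (tensor (Fin.tail h)) := by
      funext h
      rw [tmul_tensor, Fin.cons_self_tail]
    rw [this]
    have h2 : Continuous fun h : Fin (n + 1) → Lp ℂ 2 ν => Fin.tail h :=
      continuous_pi fun i => continuous_apply i.succ
    exact ((tmul n).continuous.comp (continuous_apply 0)).clm_apply (ih.comp h2)

theorem continuous_antisymTensor (n : ℕ) :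
    Continuous (antisymTensor : (Fin n → Lp ℂ 2 ν) → TensorPower ν n) := by
  have h : ∀ σ : Equiv.Perm (Fin n), Continuous fun h : Fin n → Lp ℂ 2 ν =>
      ((Equiv.Perm.sign σ : ℤ) : ℂ) • tensor (h ∘ σ) := fun σ =>
    Continuous.fun_const_smul ((continuous_tensor n).comp (g := tensor)
      (f := fun h : Fin n → Lp ℂ 2 ν => h ∘ σ) (continuous_pi fun i => continuous_apply (σ i))) _
  exact (continuous_finsetSum _ fun σ _ => h σ).fun_const_smul _

end Tensor

local notation "⟪" x ", " y "⟫" => @inner ℂ _ InnerProductSpace.toInner x y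

/-! ### The sectors of the creation operator -/

section FockOperators

variable {X : Type*} [MeasurableSpace X] {ν : Measure X} [SigmaFinite ν]

instance (n : ℕ) : CompleteSpace (AntisymPower ν n) :=
  (Submodule.isClosed_topologicalClosure _).completeSpace_coe

theorem antisymTensor_mem {n : ℕ} (h : Fin n → Lp ℂ 2 ν) : antisymTensor h ∈ AntisymPower ν n :=
  Submodule.le_topologicalClosure _ (Submodule.subset_span ⟨h, rfl⟩)

theorem antisymTensor_comp_perm {n : ℕ} (h : Fin n → Lp ℂ 2 ν) (σ : Equiv.Perm (Fin n)) :
    antisymTensor (h ∘ σ) = ((Equiv.Perm.sign σ : ℤ) : ℂ) • antisymTensor h := by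
  rw [antisymTensor, antisymTensor, smul_comm]
  congr 1
  rw [Finset.smul_sum, ← Equiv.sum_comp (Equiv.mulLeft σ) fun τ : Equiv.Perm (Fin n) =>
      ((Equiv.Perm.sign σ : ℤ) : ℂ) • ((Equiv.Perm.sign τ : ℤ) : ℂ) • tensor (h ∘ τ)]
  refine Finset.sum_congr rfl fun τ _ => ?_
  rw [smul_smul, Equiv.coe_mulLeft, Equiv.Perm.sign_mul, Equiv.Perm.coe_mul, Function.comp_assoc]
  rcases Int.units_eq_one_or (Equiv.Perm.sign σ) with hs | hs <;> simp [hs]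

/-- A vector of the antisymmetric power orthogonal to all wedge products vanishes. -/
theorem AntisymPower.eq_zero_of_inner {n : ℕ} {v : TensorPower ν n} (hv : v ∈ AntisymPower ν n)
    (h : ∀ g : Fin n → Lp ℂ 2 ν, ⟪antisymTensor g, v⟫ = 0) : v = 0 := by
  have h1 : v ∈ (Submodule.span ℂ (Set.range (antisymTensor (ν := ν) (n := n))))ᗮ := by
    rw [Submodule.mem_orthogonal]
    intro u hu
    induction hu using Submodule.span_induction with
    | mem x hx => obtain ⟨g, rfl⟩ := hx; exact h g
    | zero => simp
    | add x y _ _ hx hy => rw [inner_add_left, hx, hy, add_zero]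
    | smul c x _ hx => rw [inner_smul_left, hx, mul_zero]
  rw [← Submodule.orthogonal_closure] at h1
  exact inner_self_eq_zero.1 (Submodule.inner_right_of_mem_orthogonal hv h1)

/-- The `n`-particle part `√(n+1) P (w ⊗ ·)` of the creation operator of `w`, where `P` is the
orthogonal projection to the antisymmetric tensors. -/
def createSector (n : ℕ) (w : Lp ℂ 2 ν) : AntisymPower ν n →L[ℂ] AntisymPower ν (n + 1) :=
  (Real.sqrt (n + 1 : ℝ) : ℂ) • ((AntisymPower ν (n + 1)).orthogonalProjectionOnto ∘L
    (tmul n w ∘L (AntisymPower ν n).subtypeL))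

theorem createSector_apply {n : ℕ} (w : Lp ℂ 2 ν) (v : AntisymPower ν n) :
    createSector n w v = (Real.sqrt (n + 1 : ℝ) : ℂ) •
      (AntisymPower ν (n + 1)).orthogonalProjectionOnto (tmul n w v) := rfl

theorem createSector_add {n : ℕ} (w w' : Lp ℂ 2 ν) (v : AntisymPower ν n) :
    createSector n (w + w') v = createSector n w v + createSector n w' v := by
  simp only [createSector_apply, map_add, add_apply, smul_add]

theorem createSector_smul {n : ℕ} (c : ℂ) (w : Lp ℂ 2 ν) (v : AntisymPower ν n) :
    createSector n (c • w) v = c • createSector n w v := by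
  simp only [createSector_apply, map_smul, smul_apply]
  rw [smul_comm]

/-- Only the first factor of `w ⊗ (h₁ ∧ ⋯ ∧ hₙ)` remains to be antisymmetrized: the projection of
`w ⊗ h_{σ(1)} ⊗ ⋯ ⊗ h_{σ(n)}` to the antisymmetric tensors is `sign σ` times that of
`w ⊗ h₁ ⊗ ⋯ ⊗ hₙ`. -/
theorem orthogonalProjectionOnto_tmul {n : ℕ} (w : Lp ℂ 2 ν) (h : Fin n → Lp ℂ 2 ν) :
    (AntisymPower ν (n + 1)).orthogonalProjectionOnto (tmul n w (antisymTensor h)) =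
      ⟨antisymTensor (Fin.cons w h : Fin (n + 1) → Lp ℂ 2 ν), antisymTensor_mem _⟩ := by
  have hn : (n.factorial : ℂ) ≠ 0 := by exact_mod_cast n.factorial_ne_zero
  rw [← sub_eq_zero, ← Submodule.coe_eq_zero, Submodule.coe_sub]
  refine AntisymPower.eq_zero_of_inner (Submodule.sub_mem _ (Submodule.coe_mem _)
    (antisymTensor_mem _)) fun g => ?_
  rw [inner_sub_right, sub_eq_zero, ← Submodule.starProjection_apply]
  have h1 : ⟪antisymTensor g, tmul n w (antisymTensor h)⟫ =
      ⟪antisymTensor g, (AntisymPower ν (n + 1)).starProjection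
        (tmul n w (antisymTensor h))⟫ := by
    have := Submodule.starProjection_inner_eq_zero (tmul n w (antisymTensor h)) (antisymTensor g)
      (antisymTensor_mem (ν := ν) g)
    rw [← sub_eq_zero, ← inner_sub_right, ← inner_conj_symm, this, map_zero]
  rw [← h1, ← inner_conj_symm, ← inner_conj_symm (antisymTensor g)]
  congr 1
  have key : ∀ σ : Equiv.Perm (Fin n),
      ⟪(((Equiv.Perm.sign σ : ℤ) : ℂ) • tmul n w (tensor (h ∘ σ))), antisymTensor g⟫ =
      ⟪(antisymTensor (Fin.cons w h : Fin (n + 1) → Lp ℂ 2 ν)), antisymTensor g⟫ := by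
    intro σ
    rw [tmul_tensor, inner_smul_left, inner_tensor_antisymTensor, inner_antisymTensor]
    have := Matrix.det_permute (Equiv.Perm.decomposeFin.symm (0, σ)) (Matrix.of fun i j =>
      ⟪((Fin.cons w h : Fin (n + 1) → Lp ℂ 2 ν) i), g j⟫)
    rw [Equiv.Perm.decomposeFin.symm_sign] at this
    rw [show (Matrix.of fun i j => ⟪((Fin.cons w (h ∘ σ) : Fin (n + 1) → Lp ℂ 2 ν) i), g j⟫) =
        (Matrix.of fun i j => ⟪((Fin.cons w h : Fin (n + 1) → Lp ℂ 2 ν) i), g j⟫).submatrix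
          (Equiv.Perm.decomposeFin.symm (0, σ)) id from ?_, this]
    · rcases Int.units_eq_one_or (Equiv.Perm.sign σ) with hs | hs <;> simp [hs]
    · ext i j
      refine Fin.cases ?_ (fun i => ?_) i <;> simp
  conv_lhs => rw [antisymTensor]
  rw [map_smul, map_sum, inner_smul_left, sum_inner]
  simp only [map_smul]
  rw [Finset.sum_congr rfl fun σ _ => key σ, Finset.sum_const, Finset.card_univ,
    Fintype.card_perm, Fintype.card_fin]
  simp only [map_inv₀, map_natCast, nsmul_eq_mul]
  field_simp

theorem createSector_antisymTensor {n : ℕ} (w : Lp ℂ 2 ν) (h : Fin n → Lp ℂ 2 ν) :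
    createSector n w ⟨antisymTensor h, antisymTensor_mem h⟩ = (Real.sqrt (n + 1 : ℝ) : ℂ) •
      ⟨antisymTensor (Fin.cons w h : Fin (n + 1) → Lp ℂ 2 ν), antisymTensor_mem _⟩ := by
  rw [createSector_apply, orthogonalProjectionOnto_tmul]

/-- On `n + 1` particles, the number operator dominates `∑ᵢ a*(T eᵢ) a(T eᵢ)` up to `‖T‖²`. -/
theorem sum_norm_adjoint_createSector_le {K : Type*} [NormedAddCommGroup K]
    [InnerProductSpace ℂ K] {n : ℕ} {ι : Type*} {e : ι → K} (he : Orthonormal ℂ e)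
    (T : K →L[ℂ] Lp ℂ 2 ν) (t : Finset ι) (g : AntisymPower ν (n + 1)) :
    ∑ i ∈ t, ‖(createSector n (T (e i))).adjoint g‖ ^ 2 ≤ (n + 1) * ‖T‖ ^ 2 * ‖g‖ ^ 2 := by
  set v : ι → AntisymPower ν n := fun i => (createSector n (T (e i))).adjoint g with hv
  set S : ℝ := ∑ i ∈ t, ‖v i‖ ^ 2 with hS
  have hS0 : 0 ≤ S := Finset.sum_nonneg fun i _ => by positivity
  set z : TensorPower ν (n + 1) := ∑ i ∈ t, tmul n (T (e i)) (v i)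
  have hz : ‖z‖ ^ 2 ≤ ‖T‖ ^ 2 * S := norm_sum_tmul_le he T t fun i => (v i : TensorPower ν n)
  have h1 : (S : ℂ) = ⟪((Real.sqrt (n + 1 : ℝ) : ℂ) •
      (AntisymPower ν (n + 1)).orthogonalProjectionOnto z), g⟫ := by
    have : (Real.sqrt (n + 1 : ℝ) : ℂ) • (AntisymPower ν (n + 1)).orthogonalProjectionOnto z =
        ∑ i ∈ t, createSector n (T (e i)) (v i) := by
      simp only [createSector_apply, z, map_sum, Finset.smul_sum]
    rw [this, sum_inner, hS, Complex.ofReal_sum]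
    refine Finset.sum_congr rfl fun i _ => ?_
    rw [← ContinuousLinearMap.adjoint_inner_right]
    rw [Complex.ofReal_pow]
    exact (inner_self_eq_norm_sq_to_K (𝕜 := ℂ) (v i)).symm
  have h2 : S ≤ Real.sqrt (n + 1) * ‖z‖ * ‖g‖ := by
    calc S = ‖(S : ℂ)‖ := by rw [Complex.norm_real, Real.norm_of_nonneg hS0]
      _ ≤ ‖(Real.sqrt (n + 1 : ℝ) : ℂ) •
          (AntisymPower ν (n + 1)).orthogonalProjectionOnto z‖ * ‖g‖ := by
        rw [h1]; exact norm_inner_le_norm _ _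
      _ ≤ _ := by
        rw [norm_smul, Complex.norm_real, Real.norm_of_nonneg (Real.sqrt_nonneg _)]
        gcongr
        exact Submodule.norm_orthogonalProjectionOnto_apply_le _ _
  have h3 : S ^ 2 ≤ (n + 1) * (‖T‖ ^ 2 * S) * ‖g‖ ^ 2 := by
    calc S ^ 2 ≤ (Real.sqrt (n + 1) * ‖z‖ * ‖g‖) ^ 2 := by gcongr
      _ = (n + 1) * ‖z‖ ^ 2 * ‖g‖ ^ 2 := by
        rw [mul_pow, mul_pow, Real.sq_sqrt (by positivity)]
      _ ≤ _ := by gcongr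
  -- divide `S² ≤ (n + 1) ‖T‖² S ‖g‖²` by `S`
  rcases hS0.eq_or_lt with h0 | h0
  · rw [← h0]; positivity
  · nlinarith

end FockOperators

/-! ### Finite particle vectors -/

section FockFinOperators

variable {X : Type*} [MeasurableSpace X] {ν : Measure X} [SigmaFinite ν]

/-- The finite particle vector with given coordinates. -/
def FockFin.ofCoord (g : ∀ n, AntisymPower ν n) (hg : ∃ N, ∀ n, N ≤ n → g n = 0) : FockFin ν :=
  ⟨⟨g, by
    obtain ⟨N, hN⟩ := hg
    refine memℓp_gen (summable_of_hasFiniteSupport ((Set.finite_lt_nat N).subset fun n hn => ?_))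
    by_contra h
    exact hn (by simp [hN n (not_lt.1 h)])⟩, hg⟩

@[simp]
theorem FockFin.ofCoord_apply (g : ∀ n, AntisymPower ν n) (hg) (n : ℕ) :
    (FockFin.ofCoord g hg : Fock ν) n = g n := rfl

theorem FockFin.ext_coord {G G' : FockFin ν} (h : ∀ n, (G : Fock ν) n = (G' : Fock ν) n) :
    G = G' := Subtype.ext (lp.ext (funext h))

theorem FockFin.hasSum_inner (G G' : FockFin ν) :
    HasSum (fun n => ⟪((G : Fock ν) n), ((G' : Fock ν) n)⟫) (⟪G, G'⟫) :=
  lp.hasSum_inner (G : Fock ν) (G' : Fock ν)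

theorem FockFin.hasSum_norm_sq (G : FockFin ν) :
    HasSum (fun n => ‖(G : Fock ν) n‖ ^ 2) (‖G‖ ^ 2) := by
  have := lp.hasSum_norm (p := 2) (by norm_num) (G : Fock ν)
  simpa using this

@[simp] theorem FockFin.coord_add (G G' : FockFin ν) (n : ℕ) :
    ((G + G' : FockFin ν) : Fock ν) n = (G : Fock ν) n + (G' : Fock ν) n := rfl

@[simp] theorem FockFin.coord_smul (c : ℂ) (G : FockFin ν) (n : ℕ) :
    ((c • G : FockFin ν) : Fock ν) n = c • (G : Fock ν) n := rfl

/-- The inclusion of the `n`-particle space. -/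
def FockFin.single (n : ℕ) : AntisymPower ν n →ₗ[ℂ] FockFin ν :=
  LinearMap.codRestrict (FockFin ν) (lp.lsingle (𝕜 := ℂ) (E := fun n => AntisymPower ν n) 2 n)
    fun v => ⟨n + 1, fun m hm => lp.single_apply_ne (E := fun n => AntisymPower ν n) 2 n v
      (by omega)⟩

theorem FockFin.single_self (n : ℕ) (v : AntisymPower ν n) :
    (FockFin.single n v : Fock ν) n = v :=
  lp.single_apply_self (E := fun n => AntisymPower ν n) 2 n v

theorem FockFin.single_ne {n m : ℕ} (h : m ≠ n) (v : AntisymPower ν n) :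
    (FockFin.single n v : Fock ν) m = 0 :=
  lp.single_apply_ne (E := fun n => AntisymPower ν n) 2 n v h

theorem wedge_eq_single {n : ℕ} (h : Fin n → Lp ℂ 2 ν) :
    wedge h = FockFin.single n ⟨antisymTensor h, antisymTensor_mem h⟩ := rfl

theorem FockFin.inner_single (n : ℕ) (v : AntisymPower ν n) (G : FockFin ν) :
    ⟪FockFin.single n v, G⟫ = ⟪v, ((G : Fock ν) n)⟫ :=
  lp.inner_single_left (G := fun n => AntisymPower ν n) n v (G : Fock ν)

theorem inner_wedge_left {n : ℕ} (h : Fin n → Lp ℂ 2 ν) (G : FockFin ν) :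
    ⟪wedge h, G⟫ = ⟪antisymTensor h, ((G : Fock ν) n : TensorPower ν n)⟫ :=
  FockFin.inner_single n _ G

theorem inner_wedge {n : ℕ} (h g : Fin n → Lp ℂ 2 ν) : ⟪wedge h, wedge g⟫ =
    (n.factorial : ℂ)⁻¹ * (Matrix.of fun i j => ⟪h i, g j⟫).det := by
  rw [inner_wedge_left, wedge_eq_single, FockFin.single_self, inner_antisymTensor]

theorem inner_wedge_of_ne {m n : ℕ} (hmn : m ≠ n) (h : Fin m → Lp ℂ 2 ν) (g : Fin n → Lp ℂ 2 ν) :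
    ⟪wedge h, wedge g⟫ = 0 := by
  rw [inner_wedge_left, wedge_eq_single, FockFin.single_ne hmn, Submodule.coe_zero,
    inner_zero_right]

theorem FockFin.inner_smul_left (c : ℂ) (G G' : FockFin ν) :
    ⟪c • G, G'⟫ = (starRingEnd ℂ) c * ⟪G, G'⟫ :=
  _root_.inner_smul_left (𝕜 := ℂ) G G' c

theorem FockFin.inner_smul_right (c : ℂ) (G G' : FockFin ν) :
    ⟪G, c • G'⟫ = c * ⟪G, G'⟫ :=
  _root_.inner_smul_right (𝕜 := ℂ) G G' c

theorem FockFin.norm_smul (c : ℂ) (G : FockFin ν) : ‖c • G‖ = ‖c‖ * ‖G‖ :=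
  _root_.norm_smul c G

/-- The vectors with fewer than `N` particles. -/
def FockFin.below (ν : Measure X) [SigmaFinite ν] (N : ℕ) : Submodule ℂ (FockFin ν) where
  carrier := {G | ∀ n, N ≤ n → (G : Fock ν) n = 0}
  zero_mem' := fun _ _ => rfl
  add_mem' := fun {a b} ha hb n hn => by
    rw [FockFin.coord_add, ha n hn, hb n hn, add_zero]
  smul_mem' := fun c a ha n hn => by rw [FockFin.coord_smul, ha n hn, smul_zero]

theorem FockFin.exists_mem_below (G : FockFin ν) : ∃ N, G ∈ FockFin.below ν N := G.2

theorem FockFin.below_mono {M N : ℕ} (h : M ≤ N) : FockFin.below ν M ≤ FockFin.below ν N :=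
  fun _ hG n hn => hG n (h.trans hn)

theorem wedge_mem_below {n : ℕ} (h : Fin n → Lp ℂ 2 ν) : wedge h ∈ FockFin.below ν (n + 1) :=
  fun m hm => FockFin.single_ne (show m ≠ n by omega) _

/-! #### The topology of the finite particle vectors -/

theorem FockFin.norm_coord_le (G : FockFin ν) (n : ℕ) : ‖(G : Fock ν) n‖ ≤ ‖G‖ :=
  lp.norm_apply_le_norm two_ne_zero (G : Fock ν) n

theorem FockFin.sum_single {G : FockFin ν} {N : ℕ} (hG : G ∈ FockFin.below ν N) :
    G = ∑ n ∈ Finset.range N, FockFin.single n ((G : Fock ν) n) := by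
  refine FockFin.ext_coord fun m => ?_
  have h : ((∑ n ∈ Finset.range N, FockFin.single n ((G : Fock ν) n) : FockFin ν) : Fock ν) m =
      ∑ n ∈ Finset.range N, (FockFin.single n ((G : Fock ν) n) : Fock ν) m := by
    simp only [Submodule.coe_sum, lp.coeFn_sum, Finset.sum_apply]
  rw [h]
  by_cases hm : m < N
  · rw [Finset.sum_eq_single m, FockFin.single_self]
    · intro n _ hn
      exact FockFin.single_ne hn.symm _
    · intro h'
      exact absurd (Finset.mem_range.2 hm) h'
  · rw [hG m (not_lt.1 hm), Finset.sum_eq_zero]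
    intro n hn
    exact FockFin.single_ne (by have := Finset.mem_range.1 hn; omega) _

theorem FockFin.norm_single (n : ℕ) (v : AntisymPower ν n) : ‖FockFin.single n v‖ = ‖v‖ :=
  lp.norm_single (E := fun n => AntisymPower ν n) (by norm_num) n v

/-- Convergence in the topology of the direct sum is convergence in norm of vectors with a
uniformly bounded number of particles. -/
theorem finTendsto_iff {G : ℕ → FockFin ν} {G₀ : FockFin ν} :
    FinTendsto G G₀ ↔ (∃ N, ∀ j, G j ∈ FockFin.below ν N) ∧
      Filter.Tendsto G Filter.atTop (nhds G₀) := by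
  refine and_congr_right fun ⟨N, hN⟩ => ⟨fun h => ?_, fun h n => ?_⟩
  · obtain ⟨M, hM⟩ := FockFin.exists_mem_below G₀
    have h1 : ∀ j, G j = ∑ n ∈ Finset.range (max N M), FockFin.single n ((G j : Fock ν) n) :=
      fun j => FockFin.sum_single (FockFin.below_mono (le_max_left _ _) (hN j))
    rw [FockFin.sum_single (FockFin.below_mono (le_max_right N M) hM)]
    refine Filter.Tendsto.congr (fun j => (h1 j).symm) ?_
    refine tendsto_finsetSum _ fun n _ => ?_
    have hc : Continuous (FockFin.single (ν := ν) n) :=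
      AddMonoidHomClass.continuous_of_bound (FockFin.single n) 1 fun v => by
        rw [one_mul, FockFin.norm_single]
    exact (hc.tendsto _).comp (h n)
  · rw [tendsto_iff_norm_sub_tendsto_zero] at h ⊢
    exact squeeze_zero (fun _ => norm_nonneg _) (fun j => FockFin.norm_coord_le (G j - G₀) n) h

theorem FinTendsto.tendsto {G : ℕ → FockFin ν} {G₀ : FockFin ν} (h : FinTendsto G G₀) :
    Filter.Tendsto G Filter.atTop (nhds G₀) := (finTendsto_iff.1 h).2

/-- An operator that is bounded on the vectors with a bounded number of particles, and raises this
number in a controlled way, is continuous. -/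
theorem FinContinuous.of_bound {T : Module.End ℂ (FockFin ν)} (h : ∀ N, ∃ M, ∃ C : ℝ,
    ∀ G ∈ FockFin.below ν N, T G ∈ FockFin.below ν M ∧ ‖T G‖ ≤ C * ‖G‖) : FinContinuous T := by
  intro G G₀ hG
  rw [finTendsto_iff] at hG ⊢
  obtain ⟨⟨N, hN⟩, hG⟩ := hG
  obtain ⟨N', hN'⟩ := FockFin.exists_mem_below G₀
  obtain ⟨M, C, hM⟩ := h (max N N')
  have hj : ∀ j, G j ∈ FockFin.below ν (max N N') := fun j =>
    FockFin.below_mono (le_max_left _ _) (hN j)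
  refine ⟨⟨M, fun j => (hM _ (hj j)).1⟩, ?_⟩
  rw [tendsto_iff_norm_sub_tendsto_zero] at hG ⊢
  refine squeeze_zero (fun _ => norm_nonneg _) (fun j => ?_)
    (by simpa using hG.const_mul C : Filter.Tendsto (fun j => C * ‖G j - G₀‖) _ _)
  rw [← map_sub]
  exact (hM _ (Submodule.sub_mem _ (hj j) (FockFin.below_mono (le_max_right _ _) hN'))).2

theorem FinTendsto.add {G G' : ℕ → FockFin ν} {G₀ G₀' : FockFin ν} (h : FinTendsto G G₀)
    (h' : FinTendsto G' G₀') : FinTendsto (fun j => G j + G' j) (G₀ + G₀') := by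
  rw [finTendsto_iff] at *
  obtain ⟨⟨N, hN⟩, hG⟩ := h
  obtain ⟨⟨N', hN'⟩, hG'⟩ := h'
  exact ⟨⟨max N N', fun j => Submodule.add_mem _ (FockFin.below_mono (le_max_left _ _) (hN j))
    (FockFin.below_mono (le_max_right _ _) (hN' j))⟩, hG.add hG'⟩

theorem FinTendsto.smul {G : ℕ → FockFin ν} {G₀ : FockFin ν} (c : ℂ) (h : FinTendsto G G₀) :
    FinTendsto (fun j => c • G j) (c • G₀) := by
  rw [finTendsto_iff] at *
  obtain ⟨⟨N, hN⟩, hG⟩ := h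
  exact ⟨⟨N, fun j => Submodule.smul_mem _ _ (hN j)⟩, hG.const_smul c⟩

theorem FinContinuous.add {T T' : Module.End ℂ (FockFin ν)} (h : FinContinuous T)
    (h' : FinContinuous T') : FinContinuous (T + T') :=
  fun G G₀ hG => (h G G₀ hG).add (h' G G₀ hG)

theorem FinContinuous.smul {T : Module.End ℂ (FockFin ν)} (c : ℂ) (h : FinContinuous T) :
    FinContinuous (c • T) := fun G G₀ hG => (h G G₀ hG).smul c

theorem FinContinuous.sub {T T' : Module.End ℂ (FockFin ν)} (h : FinContinuous T)
    (h' : FinContinuous T') : FinContinuous (T - T') := by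
  rw [sub_eq_add_neg, ← neg_one_smul ℂ T']
  exact h.add (h'.smul _)

theorem FinContinuous.mul {T T' : Module.End ℂ (FockFin ν)} (h : FinContinuous T)
    (h' : FinContinuous T') : FinContinuous (T * T') :=
  fun G G₀ hG => h _ _ (h' G G₀ hG)

theorem FinContinuous.one : FinContinuous (1 : Module.End ℂ (FockFin ν)) := fun _ _ hG => hG

theorem FinContinuous.zero : FinContinuous (0 : Module.End ℂ (FockFin ν)) :=
  fun _ _ _ => finTendsto_iff.2 ⟨⟨0, fun _ => Submodule.zero_mem _⟩, tendsto_const_nhds⟩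

theorem FinContinuous.sum {ι : Type*} {T : ι → Module.End ℂ (FockFin ν)} (t : Finset ι)
    (h : ∀ i ∈ t, FinContinuous (T i)) : FinContinuous (∑ i ∈ t, T i) := by
  classical
  induction t using Finset.induction_on with
  | empty => exact FinContinuous.zero
  | insert i t hi ih =>
    rw [Finset.sum_insert hi]
    exact (h i (Finset.mem_insert_self _ _)).add
      (ih fun j hj => h j (Finset.mem_insert_of_mem hj))

/-! #### Wedge products of vectors from a dense set are total -/

theorem continuous_wedge (n : ℕ) : Continuous (wedge : (Fin n → Lp ℂ 2 ν) → FockFin ν) := by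
  have hc : Continuous (FockFin.single (ν := ν) n) :=
    AddMonoidHomClass.continuous_of_bound (FockFin.single n) 1 fun v => by
      rw [one_mul, FockFin.norm_single]
  exact hc.comp ((continuous_antisymTensor n).subtype_mk fun h => antisymTensor_mem h)

theorem exists_finTendsto_wedge {S : Set (Lp ℂ 2 ν)} (hS : Dense S) {n : ℕ}
    (h : Fin n → Lp ℂ 2 ν) : ∃ s : ℕ → Fin n → Lp ℂ 2 ν, (∀ j i, s j i ∈ S) ∧
      FinTendsto (fun j => wedge (s j)) (wedge h) := by
  have hd : Dense (Set.pi Set.univ fun _ : Fin n => S) := dense_pi Set.univ fun _ _ => hS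
  obtain ⟨s, hs, hsh⟩ := mem_closure_iff_seq_limit.1 (hd h)
  exact ⟨s, fun j i => hs j i trivial, finTendsto_iff.2
    ⟨⟨n + 1, fun j => wedge_mem_below _⟩, ((continuous_wedge n).tendsto h).comp hsh⟩⟩

/-- A finite particle vector that is orthogonal to the wedge products of vectors from a dense set
vanishes. -/
theorem FockFin.eq_zero_of_inner_wedge {S : Set (Lp ℂ 2 ν)} (hS : Dense S) {Z : FockFin ν}
    (h : ∀ (n : ℕ) (s : Fin n → Lp ℂ 2 ν), (∀ i, s i ∈ S) → ⟪wedge s, Z⟫ = 0) : Z = 0 := by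
  refine FockFin.ext_coord fun n => Subtype.ext ?_
  refine AntisymPower.eq_zero_of_inner (Submodule.coe_mem _) fun g => ?_
  rw [← inner_wedge_left]
  obtain ⟨s, hs, hsg⟩ := exists_finTendsto_wedge hS g
  have h1 : Filter.Tendsto (fun j => ⟪wedge (s j), Z⟫) Filter.atTop
      (nhds (⟪wedge g, Z⟫)) := hsg.tendsto.inner tendsto_const_nhds
  simp only [h n _ (hs _)] at h1
  exact tendsto_nhds_unique h1 tendsto_const_nhds

/-- A continuous operator that vanishes on the wedge products of vectors from a dense set is zero, as
it then vanishes on all wedge products, on their span, and on the closure of the span. -/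
theorem FinContinuous.eq_zero_of_wedge {T : Module.End ℂ (FockFin ν)} (hT : FinContinuous T)
    {S : Set (Lp ℂ 2 ν)} (hS : Dense S)
    (h : ∀ (n : ℕ) (s : Fin n → Lp ℂ 2 ν), (∀ i, s i ∈ S) → T (wedge s) = 0) : T = 0 := by
  have hlim : ∀ (G : ℕ → FockFin ν) (G₀ : FockFin ν), FinTendsto G G₀ → (∀ j, T (G j) = 0) →
      T G₀ = 0 := by
    intro G G₀ hG h0
    have := (hT G G₀ hG).tendsto
    simp only [h0] at this
    exact tendsto_nhds_unique this tendsto_const_nhds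
  have h1 : ∀ (n : ℕ) (g : Fin n → Lp ℂ 2 ν), T (wedge g) = 0 := by
    intro n g
    obtain ⟨s, hs, hsg⟩ := exists_finTendsto_wedge hS g
    exact hlim _ _ hsg fun j => h n _ (hs j)
  have h2 : ∀ (n : ℕ) (v : TensorPower ν n)
      (hv : v ∈ Submodule.span ℂ (Set.range (antisymTensor (ν := ν) (n := n)))),
      T (FockFin.single n ⟨v, Submodule.le_topologicalClosure _ hv⟩) = 0 := by
    intro n v hv
    induction hv using Submodule.span_induction with
    | mem x hx => obtain ⟨g, rfl⟩ := hx; exact h1 n g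
    | zero => exact (congrArg T (map_zero (FockFin.single n))).trans (map_zero T)
    | add x y hx hy ihx ihy =>
      have := map_add (FockFin.single n)
        (⟨x, Submodule.le_topologicalClosure _ hx⟩ : AntisymPower ν n)
        ⟨y, Submodule.le_topologicalClosure _ hy⟩
      refine (congrArg T this).trans ?_
      rw [map_add, ihx, ihy, add_zero]
    | smul c x hx ihx =>
      have := map_smul (FockFin.single n) c
        (⟨x, Submodule.le_topologicalClosure _ hx⟩ : AntisymPower ν n)
      refine (congrArg T this).trans ?_
      rw [map_smul, ihx, smul_zero]
  have h3 : ∀ (n : ℕ) (v : AntisymPower ν n), T (FockFin.single n v) = 0 := by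
    intro n v
    obtain ⟨u, hu, huv⟩ := mem_closure_iff_seq_limit.1 v.2
    refine hlim (fun j => FockFin.single n ⟨u j, Submodule.le_topologicalClosure _ (hu j)⟩) _
      (finTendsto_iff.2 ⟨⟨n + 1, fun j m hm => FockFin.single_ne (by omega) _⟩, ?_⟩)
      fun j => h2 n _ (hu j)
    have hc : Continuous (FockFin.single (ν := ν) n) :=
      AddMonoidHomClass.continuous_of_bound (FockFin.single n) 1 fun v => by
        rw [one_mul, FockFin.norm_single]
    exact (hc.tendsto v).comp (tendsto_subtype_rng.2 huv)
  refine LinearMap.ext fun G => ?_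
  obtain ⟨N, hN⟩ := FockFin.exists_mem_below G
  rw [FockFin.sum_single hN, map_sum]
  exact Finset.sum_eq_zero fun n _ => h3 n _

end FockFinOperators

/-! ### Creation and annihilation operators -/

section CAR

variable {X : Type*} [MeasurableSpace X] {ν : Measure X} [SigmaFinite ν]

/-- The creation operator `a*(w)` on the finite particle vectors. -/
def creation (w : Lp ℂ 2 ν) : Module.End ℂ (FockFin ν) where
  toFun G := FockFin.ofCoord
    (fun n => match n with
      | 0 => 0
      | n + 1 => createSector n w ((G : Fock ν) n)) (by
      obtain ⟨N, hN⟩ := FockFin.exists_mem_below G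
      refine ⟨N + 1, fun n hn => ?_⟩
      match n with
      | 0 => rfl
      | n + 1 => exact (congrArg _ (hN n (by omega))).trans (map_zero _))
  map_add' G G' := FockFin.ext_coord fun n => by
    match n with
    | 0 => simp
    | n + 1 => simp
  map_smul' c G := FockFin.ext_coord fun n => by
    match n with
    | 0 => simp
    | n + 1 => simp

/-- The annihilation operator `a(w)` on the finite particle vectors, the adjoint of `a*(w)`. -/
def annihilation (w : Lp ℂ 2 ν) : Module.End ℂ (FockFin ν) where
  toFun G := FockFin.ofCoord (fun n => (createSector n w).adjoint ((G : Fock ν) (n + 1))) (by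
      obtain ⟨N, hN⟩ := FockFin.exists_mem_below G
      exact ⟨N, fun n hn => (congrArg _ (hN (n + 1) (by omega))).trans (map_zero _)⟩)
  map_add' G G' := FockFin.ext_coord fun n => by simp
  map_smul' c G := FockFin.ext_coord fun n => by simp

theorem creation_coord_zero (w : Lp ℂ 2 ν) (G : FockFin ν) :
    (creation w G : Fock ν) 0 = 0 := rfl

theorem creation_coord_succ (w : Lp ℂ 2 ν) (G : FockFin ν) (n : ℕ) :
    (creation w G : Fock ν) (n + 1) = createSector n w ((G : Fock ν) n) := rfl

theorem annihilation_coord (w : Lp ℂ 2 ν) (G : FockFin ν) (n : ℕ) :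
    (annihilation w G : Fock ν) n = (createSector n w).adjoint ((G : Fock ν) (n + 1)) := rfl

theorem creation_mem_below (w : Lp ℂ 2 ν) {G : FockFin ν} {N : ℕ} (hG : G ∈ FockFin.below ν N) :
    creation w G ∈ FockFin.below ν (N + 1) := by
  intro n hn
  match n with
  | 0 => rfl
  | n + 1 => exact (congrArg _ (hG n (by omega))).trans (map_zero _)

theorem annihilation_mem_below (w : Lp ℂ 2 ν) {G : FockFin ν} {N : ℕ}
    (hG : G ∈ FockFin.below ν N) : annihilation w G ∈ FockFin.below ν N :=
  fun n hn => (congrArg _ (hG (n + 1) (by omega))).trans (map_zero _)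

theorem inner_creation_left (w : Lp ℂ 2 ν) (G G' : FockFin ν) :
    ⟪creation w G, G'⟫ = ⟪G, annihilation w G'⟫ := by
  have h1 := FockFin.hasSum_inner (creation w G) G'
  have h2 := FockFin.hasSum_inner G (annihilation w G')
  rw [← hasSum_nat_add_iff' 1] at h1
  simp only [Finset.range_one, Finset.sum_singleton, creation_coord_zero, inner_zero_left,
    sub_zero, creation_coord_succ] at h1
  simp only [annihilation_coord, ContinuousLinearMap.adjoint_inner_right] at h2
  exact h1.unique h2

theorem inner_annihilation_left (w : Lp ℂ 2 ν) (G G' : FockFin ν) :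
    ⟪annihilation w G, G'⟫ = ⟪G, creation w G'⟫ := by
  rw [← inner_conj_symm, ← inner_creation_left, inner_conj_symm]

theorem creation_add (w w' : Lp ℂ 2 ν) : creation (w + w') = creation w + creation w' :=
  LinearMap.ext fun G => FockFin.ext_coord fun n => by
    match n with
    | 0 => simp [creation_coord_zero]
    | n + 1 => simp [creation_coord_succ, createSector_add]

theorem creation_smul (c : ℂ) (w : Lp ℂ 2 ν) : creation (c • w) = c • creation w :=
  LinearMap.ext fun G => FockFin.ext_coord fun n => by
    match n with
    | 0 => simp [creation_coord_zero]
    | n + 1 => simp [creation_coord_succ, createSector_smul]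

theorem creation_wedge {n : ℕ} (w : Lp ℂ 2 ν) (h : Fin n → Lp ℂ 2 ν) :
    creation w (wedge h) = create w h := by
  refine FockFin.ext_coord fun m => ?_
  rw [create, FockFin.coord_smul, wedge_eq_single, wedge_eq_single]
  match m with
  | 0 => rw [creation_coord_zero, FockFin.single_ne (by omega), smul_zero]
  | m + 1 =>
    rw [creation_coord_succ]
    by_cases hm : m = n
    · subst hm
      rw [FockFin.single_self, FockFin.single_self, createSector_antisymTensor]
    · rw [FockFin.single_ne hm, FockFin.single_ne (by omega), map_zero, smul_zero]

theorem FockFin.eq_of_inner_wedge {Z Z' : FockFin ν}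
    (h : ∀ (n : ℕ) (s : Fin n → Lp ℂ 2 ν), ⟪wedge s, Z⟫ = ⟪wedge s, Z'⟫) : Z = Z' := by
  rw [← sub_eq_zero]
  refine FockFin.eq_zero_of_inner_wedge dense_univ fun n s _ => ?_
  rw [inner_sub_right, h, sub_self]

theorem annihilation_wedge {n : ℕ} (w : Lp ℂ 2 ν) (h : Fin n → Lp ℂ 2 ν) :
    annihilation w (wedge h) = annihilate (fun i => ⟪w, h i⟫) h := by
  refine FockFin.eq_of_inner_wedge fun m g => ?_
  rw [← inner_creation_left, creation_wedge, create, FockFin.inner_smul_left]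
  match n with
  | 0 => rw [inner_wedge_of_ne (by omega), mul_zero, annihilate, inner_zero_right]
  | n + 1 =>
    rw [annihilate, FockFin.inner_smul_right, inner_sum]
    simp only [FockFin.inner_smul_right]
    by_cases hm : m = n
    · subst hm
      have hs : (Real.sqrt (m + 1 : ℝ) : ℂ) ≠ 0 := by
        exact_mod_cast (Real.sqrt_pos.2 (by positivity : (0 : ℝ) < m + 1)).ne'
      have hs2 : (Real.sqrt (m + 1 : ℝ) : ℂ) * (Real.sqrt (m + 1 : ℝ) : ℂ) = m + 1 := by
        exact_mod_cast Real.mul_self_sqrt (by positivity : (0 : ℝ) ≤ m + 1)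
      have hf : (m.factorial : ℂ) ≠ 0 := by exact_mod_cast m.factorial_ne_zero
      have hm1 : (m + 1 : ℂ) ≠ 0 := by exact_mod_cast m.succ_ne_zero
      rw [inner_wedge, Matrix.det_succ_row_zero, Finset.mul_sum, Finset.mul_sum, Finset.mul_sum]
      refine Finset.sum_congr rfl fun i _ => ?_
      rw [inner_wedge, Complex.conj_ofReal, Nat.factorial_succ]
      have : (Matrix.of fun i j => ⟪(Fin.cons w g : Fin (m + 1) → Lp ℂ 2 ν) i, h j⟫).submatrix
          Fin.succ i.succAbove = Matrix.of fun a b => ⟪g a, h (i.succAbove b)⟫ := rfl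
      rw [this, Matrix.of_apply, Fin.cons_zero]
      push_cast
      rw [← hs2]
      field_simp
    · rw [inner_wedge_of_ne (by omega), mul_zero, Finset.sum_eq_zero, mul_zero]
      intro i _
      rw [inner_wedge_of_ne hm, mul_zero]

theorem FinContinuous.creation (w : Lp ℂ 2 ν) : FinContinuous (creation w) := by
  intro G G₀ ⟨⟨N, hN⟩, hG⟩
  refine ⟨⟨N + 1, fun j => creation_mem_below w (hN j)⟩, fun n => ?_⟩
  match n with
  | 0 => exact tendsto_const_nhds
  | n + 1 => exact ((createSector n w).continuous.tendsto _).comp (hG n)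

theorem FinContinuous.annihilation (w : Lp ℂ 2 ν) : FinContinuous (annihilation w) := by
  intro G G₀ ⟨⟨N, hN⟩, hG⟩
  refine ⟨⟨N, fun j => annihilation_mem_below w (hN j)⟩, fun n => ?_⟩
  exact ((createSector n w).adjoint.continuous.tendsto _).comp (hG (n + 1))

theorem FinContinuous.ext_wedge {T T' : Module.End ℂ (FockFin ν)} (hT : FinContinuous T)
    (hT' : FinContinuous T') (h : ∀ (n : ℕ) (s : Fin n → Lp ℂ 2 ν), T (wedge s) = T' (wedge s)) :
    T = T' :=
  sub_eq_zero.1 ((hT.sub hT').eq_zero_of_wedge dense_univ fun n s _ => by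
    rw [LinearMap.sub_apply, h, sub_self])

theorem wedge_cons_cons {n : ℕ} (w w' : Lp ℂ 2 ν) (h : Fin n → Lp ℂ 2 ν) :
    wedge (Fin.cons w (Fin.cons w' h : Fin (n + 1) → Lp ℂ 2 ν) : Fin (n + 2) → Lp ℂ 2 ν) =
      -wedge (Fin.cons w' (Fin.cons w h : Fin (n + 1) → Lp ℂ 2 ν) : Fin (n + 2) → Lp ℂ 2 ν) := by
  have h1 : (Fin.cons w (Fin.cons w' h : Fin (n + 1) → Lp ℂ 2 ν) : Fin (n + 2) → Lp ℂ 2 ν) =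
      (Fin.cons w' (Fin.cons w h : Fin (n + 1) → Lp ℂ 2 ν) : Fin (n + 2) → Lp ℂ 2 ν) ∘
        Equiv.swap 0 1 := by
    funext i
    refine Fin.cases ?_ (fun i => Fin.cases ?_ (fun i => ?_) i) i
    · rw [Function.comp_apply, Equiv.swap_apply_left]
      rfl
    · rw [Function.comp_apply, Fin.succ_zero_eq_one, Equiv.swap_apply_right]
      rfl
    · rw [Function.comp_apply, Equiv.swap_apply_of_ne_of_ne (Fin.succ_ne_zero _)
        (by
          rw [← Fin.succ_zero_eq_one]
          exact fun h => Fin.succ_ne_zero _ (Fin.succ_injective _ h))]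
      simp
  rw [wedge_eq_single, wedge_eq_single, ← map_neg]
  congr 1
  refine Subtype.ext ?_
  change antisymTensor _ = -antisymTensor _
  rw [h1, antisymTensor_comp_perm, Equiv.Perm.sign_swap (by simp)]
  simp

theorem creation_mul_creation (w w' : Lp ℂ 2 ν) :
    creation w * creation w' = -(creation w' * creation w) := by
  rw [← neg_one_smul ℂ]
  refine FinContinuous.ext_wedge ((FinContinuous.creation w).mul (FinContinuous.creation w'))
    (FinContinuous.smul _ ((FinContinuous.creation w').mul (FinContinuous.creation w)))
    fun n h => ?_
  rw [LinearMap.smul_apply, Module.End.mul_apply, Module.End.mul_apply, creation_wedge,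
    creation_wedge, create, create, map_smul, map_smul, creation_wedge, creation_wedge, create,
    create, wedge_cons_cons w w' h]
  simp

/-- The canonical anticommutation relation `a(w) a*(w') + a*(w') a(w) = (w, w')`. -/
theorem annihilation_mul_creation (w w' : Lp ℂ 2 ν) :
    annihilation w * creation w' = ⟪w, w'⟫ • 1 - creation w' * annihilation w := by
  refine FinContinuous.ext_wedge ((FinContinuous.annihilation w).mul (FinContinuous.creation w'))
    ((FinContinuous.one.smul _).sub ((FinContinuous.creation w').mul
      (FinContinuous.annihilation w))) fun n h => ?_
  have hs : ∀ n : ℕ, (Real.sqrt (n + 1 : ℝ) : ℂ) ≠ 0 := fun n => by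
    exact_mod_cast (Real.sqrt_pos.2 (by positivity : (0 : ℝ) < n + 1)).ne'
  rw [LinearMap.sub_apply, LinearMap.smul_apply, Module.End.one_apply, Module.End.mul_apply,
    Module.End.mul_apply, creation_wedge, create, map_smul, annihilation_wedge, annihilation_wedge,
    annihilate, smul_smul, mul_inv_cancel₀ (hs n), one_smul, Fin.sum_univ_succ]
  simp only [Fin.val_zero, pow_zero, one_mul, Fin.cons_zero, Fin.zero_succAbove, Fin.cons_succ,
    Fin.val_succ]
  rw [sub_eq_add_neg]
  congr 1
  match n with
  | 0 => simp [annihilate]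
  | n + 1 =>
    rw [annihilate, map_smul, map_sum, ← smul_neg, ← Finset.sum_neg_distrib, Finset.smul_sum]
    refine Finset.sum_congr rfl fun i _ => ?_
    have : (fun j => (Fin.cons w' h : Fin (n + 2) → Lp ℂ 2 ν) (i.succ.succAbove j)) =
        Fin.cons w' (fun j => h (i.succAbove j)) := by
      funext j
      refine Fin.cases ?_ (fun j => ?_) j <;> simp
    rw [this, map_smul, creation_wedge, create, pow_succ, smul_comm _ (Real.sqrt _ : ℂ), smul_neg,
      smul_smul, inv_mul_cancel₀ (hs n), one_smul, ← neg_smul]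
    congr 1
    ring

theorem annihilation_mul_annihilation (w w' : Lp ℂ 2 ν) :
    annihilation w * annihilation w' = -(annihilation w' * annihilation w) := by
  refine LinearMap.ext fun G => ext_inner_left ℂ fun G' => ?_
  rw [LinearMap.neg_apply, inner_neg_right, Module.End.mul_apply, Module.End.mul_apply,
    ← inner_creation_left, ← inner_creation_left, ← inner_creation_left, ← inner_creation_left,
    ← Module.End.mul_apply, ← Module.End.mul_apply, creation_mul_creation, LinearMap.neg_apply,
    inner_neg_left]

/-- The diagonal case of the anticommutation relation. -/
theorem norm_sq_creation_add (w : Lp ℂ 2 ν) (G : FockFin ν) :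
    ‖creation w G‖ ^ 2 + ‖annihilation w G‖ ^ 2 = ‖w‖ ^ 2 * ‖G‖ ^ 2 := by
  have h : ((‖creation w G‖ ^ 2 + ‖annihilation w G‖ ^ 2 : ℝ) : ℂ) =
      ((‖w‖ ^ 2 * ‖G‖ ^ 2 : ℝ) : ℂ) := by
    have h1 := inner_creation_left w G (creation w G)
    have h2 := inner_annihilation_left w G (annihilation w G)
    rw [← Module.End.mul_apply, annihilation_mul_creation, LinearMap.sub_apply,
      LinearMap.smul_apply, Module.End.one_apply, Module.End.mul_apply, inner_sub_right,
      FockFin.inner_smul_right, ← h2] at h1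
    simp only [inner_self_eq_norm_sq_to_K, Complex.coe_algebraMap] at h1
    push_cast
    rw [h1, sub_add_cancel]
  exact Complex.ofReal_injective h

theorem norm_creation_le (w : Lp ℂ 2 ν) (G : FockFin ν) : ‖creation w G‖ ≤ ‖w‖ * ‖G‖ := by
  have := norm_sq_creation_add w G
  refine (sq_le_sq₀ (norm_nonneg _) (by positivity)).1 ?_
  rw [mul_pow]
  nlinarith [sq_nonneg ‖annihilation w G‖]

/-- The number operator dominates `∑ᵢ a*(T eᵢ) a(T eᵢ)` up to `‖T‖²`. -/
theorem sum_norm_sq_annihilation_le {K : Type*} [NormedAddCommGroup K] [InnerProductSpace ℂ K]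
    {ι : Type*} {e : ι → K} (he : Orthonormal ℂ e) (T : K →L[ℂ] Lp ℂ 2 ν) (t : Finset ι) {N : ℕ}
    {G : FockFin ν} (hG : G ∈ FockFin.below ν N) :
    ∑ i ∈ t, ‖annihilation (T (e i)) G‖ ^ 2 ≤ N * ‖T‖ ^ 2 * ‖G‖ ^ 2 := by
  have h1 : HasSum (fun n => ∑ i ∈ t, ‖(annihilation (T (e i)) G : Fock ν) n‖ ^ 2)
      (∑ i ∈ t, ‖annihilation (T (e i)) G‖ ^ 2) :=
    hasSum_sum fun i _ => FockFin.hasSum_norm_sq _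
  have h2 := FockFin.hasSum_norm_sq G
  rw [← hasSum_nat_add_iff' 1] at h2
  refine (hasSum_le (fun n => ?_) h1 (h2.mul_left (N * ‖T‖ ^ 2))).trans ?_
  · by_cases hn : n + 1 < N
    · refine (sum_norm_adjoint_createSector_le he T t ((G : Fock ν) (n + 1))).trans ?_
      gcongr
      exact_mod_cast hn.le
    · rw [hG (n + 1) (by omega)]
      simp only [annihilation_coord, hG (n + 1) (not_lt.1 hn), map_zero, norm_zero]
      simp
  · gcongr
    simp

end CAR

/-! ### Parseval's identity for vector valued functions -/

section VectorParseval

theorem hasSum_norm_sq_inner {ι K : Type*} [NormedAddCommGroup K] [InnerProductSpace ℂ K]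
    (b : HilbertBasis ι ℂ K) (x : K) : HasSum (fun i => ‖⟪b i, x⟫‖ ^ 2) (‖x‖ ^ 2) := by
  have h := b.hasSum_inner_mul_inner x x
  rw [inner_self_eq_norm_sq_to_K] at h
  rw [← Complex.hasSum_ofReal]
  convert! h using 1
  · funext i
    rw [← inner_conj_symm x, Complex.conj_mul', Complex.ofReal_pow]
  · simp

theorem tsum_enorm_sq_inner {ι K : Type*} [NormedAddCommGroup K] [InnerProductSpace ℂ K]
    (b : HilbertBasis ι ℂ K) (x : K) : ∑' i, ‖⟪b i, x⟫‖ₑ ^ 2 = ‖x‖ₑ ^ 2 := by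
  have h := hasSum_norm_sq_inner b x
  have h2 := ENNReal.ofReal_tsum_of_nonneg (fun i => by positivity) h.summable
  rw [h.tsum_eq] at h2
  simp only [ENNReal.ofReal_pow (norm_nonneg _), ofReal_norm] at h2
  exact h2.symm

theorem countable_hilbertBasis {ι K : Type*} [NormedAddCommGroup K] [InnerProductSpace ℂ K]
    [TopologicalSpace.SeparableSpace K] (b : HilbertBasis ι ℂ K) : Countable ι := by
  have h : (Set.univ : Set ι).PairwiseDisjoint fun i => Metric.ball (b i) (1 / 2) := by
    intro i _ j _ hij
    refine Metric.ball_disjoint_ball ?_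
    have h1 : ‖b i - b j‖ ^ 2 = 2 := by
      rw [@norm_sub_sq ℂ, b.orthonormal.1, b.orthonormal.1, b.orthonormal.2 hij]
      norm_num
    rw [dist_eq_norm]
    nlinarith [norm_nonneg (b i - b j)]
  exact Set.countable_univ_iff.1 (h.countable_of_isOpen (fun _ _ => Metric.isOpen_ball)
    fun i _ => Metric.nonempty_ball.2 (by norm_num))

variable {α : Type*} [MeasurableSpace α] {μ : Measure α}
variable {K : Type*} [NormedAddCommGroup K] [InnerProductSpace ℂ K]

/-- The coefficient `∫ \bar{e(x)} p(x) dx` of a vector valued function `p` along `e ∈ L²`. -/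
def vecCoeff (e : Lp ℂ 2 μ) (p : α → K) : K := ∫ x, (starRingEnd ℂ) (e x) • p x ∂μ

theorem integrable_conj_smul (e : Lp ℂ 2 μ) {p : α → K} (hp : MemLp p 2 μ) :
    Integrable (fun x => (starRingEnd ℂ) (e x) • p x) μ := by
  have h1 : MemLp (fun x => (starRingEnd ℂ) (e x)) 2 μ :=
    (Lp.memLp e).star
  exact memLp_one_iff_integrable.1 (MemLp.smul (p := 2) (q := 2) (r := 1) hp h1)

/-- Parseval's identity for values in a separable space `K`, by expansion of the values in a
countable orthonormal basis of `K`; countability is needed to exchange sum and integral. -/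
theorem tsum_enorm_sq_vecCoeff_of_separableSpace [CompleteSpace K]
    [TopologicalSpace.SeparableSpace K] {ι : Type*}
    (b : HilbertBasis ι ℂ (Lp ℂ 2 μ)) {p : α → K} (hp : MemLp p 2 μ) :
    ∑' i, ‖vecCoeff (b i) p‖ₑ ^ 2 = ∫⁻ x, ‖p x‖ₑ ^ 2 ∂μ := by
  obtain ⟨w, c, -⟩ := exists_hilbertBasis ℂ K
  have := countable_hilbertBasis c
  simp_rw [← tsum_enorm_sq_inner c]
  rw [lintegral_tsum fun m => ((hp.const_inner (c m)).aestronglyMeasurable.enorm.pow_const 2),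
    ENNReal.tsum_comm]
  refine tsum_congr fun m => ?_
  have h1 := tsum_enorm_sq_inner b (hp.const_inner (𝕜 := ℂ) (c m)).toLp
  have h2 : ‖(hp.const_inner (𝕜 := ℂ) (c m)).toLp‖ₑ ^ 2 = ∫⁻ x, ‖⟪c m, p x⟫‖ₑ ^ 2 ∂μ := by
    rw [Lp.enorm_toLp, eLpNorm_eq_lintegral_rpow_enorm_toReal two_ne_zero ENNReal.ofNat_ne_top,
      ← ENNReal.rpow_natCast, ← ENNReal.rpow_mul]
    norm_num
  rw [← h2, ← h1]
  refine tsum_congr fun i => ?_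
  congr 2
  rw [vecCoeff, ← integral_inner (integrable_conj_smul _ hp), L2.inner_def]
  refine integral_congr_ae ?_
  filter_upwards [(hp.const_inner (𝕜 := ℂ) (c m)).coeFn_toLp] with x hx
  rw [hx, inner_smul_right, RCLike.inner_apply, mul_comm]

theorem tsum_enorm_sq_vecCoeff [CompleteSpace K] {ι : Type*}
    (b : HilbertBasis ι ℂ (Lp ℂ 2 μ)) {p : α → K} (hp : MemLp p 2 μ) :
    ∑' i, ‖vecCoeff (b i) p‖ₑ ^ 2 = ∫⁻ x, ‖p x‖ₑ ^ 2 ∂μ := by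
  -- the values of `p` lie almost everywhere in a separable closed subspace
  have hsm := hp.aestronglyMeasurable
  set p' := hsm.mk p with hp'
  have hs : TopologicalSpace.IsSeparable (Set.range p') :=
    hsm.stronglyMeasurable_mk.isSeparable_range
  let V : Submodule ℂ K := (Submodule.span ℂ (Set.range p')).topologicalClosure
  have hVs : TopologicalSpace.SeparableSpace V :=
    ((hs.span (R := ℂ)).closure).separableSpace
  have hVc : CompleteSpace V := (Submodule.isClosed_topologicalClosure _).completeSpace_coe
  let q : α → V := fun x => ⟨p' x, Submodule.le_topologicalClosure _
    (Submodule.subset_span ⟨x, rfl⟩)⟩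
  have hq : MemLp q 2 μ := by
    refine ⟨?_, ?_⟩
    · exact (Topology.IsEmbedding.subtypeVal.aestronglyMeasurable_comp_iff).1
        hsm.stronglyMeasurable_mk.aestronglyMeasurable
    · have : eLpNorm q 2 μ = eLpNorm p 2 μ := by
        rw [eLpNorm_congr_ae hsm.ae_eq_mk]
        exact eLpNorm_congr_norm_ae (Filter.Eventually.of_forall fun x => rfl)
      rw [this]
      exact hp.2
  have h := tsum_enorm_sq_vecCoeff_of_separableSpace b hq
  have h1 : ∀ i, ‖vecCoeff (b i) q‖ₑ = ‖vecCoeff (b i) p‖ₑ := by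
    intro i
    have h2 := V.subtypeL.integral_comp_comm (integrable_conj_smul (b i) hq)
    have h3 : vecCoeff (b i) p = V.subtypeL (vecCoeff (b i) q) := by
      rw [vecCoeff, vecCoeff, ← h2]
      refine integral_congr_ae ?_
      filter_upwards [hsm.ae_eq_mk] with x hx
      rw [hx, map_smul]
      rfl
    rw [h3]
    rfl
  simp only [h1] at h
  rw [h]
  refine lintegral_congr_ae ?_
  filter_upwards [hsm.ae_eq_mk] with x hx
  rw [hx]
  rfl

theorem integrable_inner_of_memLp {p q : α → K} (hp : MemLp p 2 μ) (hq : MemLp q 2 μ) :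
    Integrable (fun x => ⟪p x, q x⟫) μ := by
  have h : Integrable (fun x => ‖p x‖ * ‖q x‖) μ :=
    memLp_one_iff_integrable.1 (MemLp.mul (p := 2) (q := 2) (r := 1) hq.norm hp.norm)
  exact h.mono (hp.aestronglyMeasurable.inner hq.aestronglyMeasurable)
    (Filter.Eventually.of_forall fun x => by
      rw [Real.norm_of_nonneg (by positivity)]; exact norm_inner_le_norm _ _)

theorem hasSum_norm_sq_vecCoeff [CompleteSpace K] {ι : Type*}
    (b : HilbertBasis ι ℂ (Lp ℂ 2 μ)) {p : α → K} (hp : MemLp p 2 μ) :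
    HasSum (fun i => ‖vecCoeff (b i) p‖ ^ 2) (∫ x, ‖p x‖ ^ 2 ∂μ) := by
  have h := tsum_enorm_sq_vecCoeff b hp
  have hint := (memLp_two_iff_integrable_sq_norm hp.aestronglyMeasurable).1 hp
  have h2 : ∫⁻ x, ‖p x‖ₑ ^ 2 ∂μ = ENNReal.ofReal (∫ x, ‖p x‖ ^ 2 ∂μ) := by
    rw [ofReal_integral_eq_lintegral_ofReal hint
      (Filter.Eventually.of_forall fun x => by positivity)]
    refine lintegral_congr fun x => ?_
    rw [ENNReal.ofReal_pow (norm_nonneg _), ofReal_norm]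
  rw [h2] at h
  have h3 := ENNReal.hasSum_toReal (h.trans_ne ENNReal.ofReal_ne_top)
  rw [← ENNReal.tsum_toReal_eq fun i => by simp, h,
    ENNReal.toReal_ofReal (integral_nonneg fun x => by positivity)] at h3
  simpa using h3

/-- Parseval's identity for vector valued functions: with the coefficients `pᵢ`, `qᵢ` of
`p, q ∈ L²(α; K)` along an orthonormal basis of `L²(α)`, `∑ᵢ (pᵢ, qᵢ) = ∫ (p(x), q(x)) dx`. -/
theorem hasSum_inner_vecCoeff [CompleteSpace K] {ι : Type*}
    (b : HilbertBasis ι ℂ (Lp ℂ 2 μ)) {p q : α → K} (hp : MemLp p 2 μ) (hq : MemLp q 2 μ) :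
    HasSum (fun i => ⟪vecCoeff (b i) p, vecCoeff (b i) q⟫) (∫ x, ⟪p x, q x⟫ ∂μ) := by
  have hadd : ∀ {p q : α → K}, MemLp p 2 μ → MemLp q 2 μ → ∀ i, vecCoeff (b i) (p + q) =
      vecCoeff (b i) p + vecCoeff (b i) q := fun hp hq i => by
    rw [vecCoeff, vecCoeff, vecCoeff, ← integral_add (integrable_conj_smul _ hp)
      (integrable_conj_smul _ hq)]
    simp only [Pi.add_apply, smul_add]
  have hsmul : ∀ (c : ℂ) (p : α → K) i, vecCoeff (b i) (c • p) = c • vecCoeff (b i) p :=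
    fun c p i => by
    rw [vecCoeff, vecCoeff, ← integral_smul]
    simp only [Pi.smul_apply, smul_comm c]
  -- the identity of the norms for `p + c q` gives the identity of scalar products by polarization
  have key : ∀ c : ℂ, HasSum (fun i => ((‖vecCoeff (b i) p + c • vecCoeff (b i) q‖ : ℝ) : ℂ) ^ 2)
      (∫ x, ((‖p x + c • q x‖ : ℝ) : ℂ) ^ 2 ∂μ) := by
    intro c
    have h := hasSum_norm_sq_vecCoeff b (hp.add (hq.const_smul c))
    rw [← Complex.hasSum_ofReal, ← integral_complex_ofReal] at h
    simpa only [hadd hp (hq.const_smul c), hsmul, Complex.ofReal_pow, Pi.add_apply,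
      Pi.smul_apply] using h
  have hint : ∀ c : ℂ, Integrable (fun x => ((‖p x + c • q x‖ : ℝ) : ℂ) ^ 2) μ := by
    intro c
    have h := (memLp_two_iff_integrable_sq_norm (hp.add (hq.const_smul c)).aestronglyMeasurable).1
      (hp.add (hq.const_smul c))
    have h2 := h.ofReal (𝕜 := ℂ)
    simpa using h2
  have hs : ∀ c c' : ℂ, Integrable (fun x => ((‖p x + c • q x‖ : ℝ) : ℂ) ^ 2 -
      ((‖p x + c' • q x‖ : ℝ) : ℂ) ^ 2) μ := fun c c' => (hint c).sub (hint c')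
  have h := (((key 1).sub (key (-1))).add (((key (-Complex.I)).sub (key Complex.I)).mul_right
    Complex.I)).div_const 4
  rw [← integral_sub (hint _) (hint _), ← integral_sub (hint _) (hint _), ← integral_mul_const,
    ← integral_add (hs 1 (-1)) ((hs (-Complex.I) Complex.I).mul_const _),
    ← integral_div] at h
  simp only [one_smul, neg_smul, ← sub_eq_add_neg] at h
  have e : ∀ x y : K, ⟪x, y⟫ = (((‖x + y‖ : ℝ) : ℂ) ^ 2 - ((‖x - y‖ : ℝ) : ℂ) ^ 2 +
      (((‖x - Complex.I • y‖ : ℝ) : ℂ) ^ 2 - ((‖x + Complex.I • y‖ : ℝ) : ℂ) ^ 2) * Complex.I) / 4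
    :=
    fun x y => by
      rw [inner_eq_sum_norm_sq_div_four x y]
      rfl
  simp only [e]
  exact h

end VectorParseval

/-! ### Smeared fields and their quadratic expressions -/

section Field

variable {X : Type*} [MeasurableSpace X] {ν : Measure X} [SigmaFinite ν]

theorem annihilation_add (w w' : Lp ℂ 2 ν) :
    annihilation (w + w') = annihilation w + annihilation w' :=
  LinearMap.ext fun G => ext_inner_right ℂ fun G' => by
    rw [LinearMap.add_apply, inner_add_left, inner_annihilation_left, inner_annihilation_left,
      inner_annihilation_left, creation_add, LinearMap.add_apply, inner_add_right]

theorem annihilation_smul (c : ℂ) (w : Lp ℂ 2 ν) :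
    annihilation (c • w) = (starRingEnd ℂ) c • annihilation w :=
  LinearMap.ext fun G => ext_inner_right ℂ fun G' => by
    rw [LinearMap.smul_apply, FockFin.inner_smul_left, inner_annihilation_left,
      inner_annihilation_left, creation_smul, LinearMap.smul_apply, FockFin.inner_smul_right,
      Complex.conj_conj]

/-- A continuous operator is bounded on the vectors with a bounded number of particles. -/
theorem FinContinuous.exists_bound {T : Module.End ℂ (FockFin ν)} (hT : FinContinuous T) (N : ℕ) :
    ∃ C : ℝ, 0 ≤ C ∧ ∀ G ∈ FockFin.below ν N, ‖T G‖ ≤ C * ‖G‖ := by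
  by_contra! hcon
  choose G hG hTG using fun j : ℕ => hcon (j + 1) (by positivity)
  have hpos : ∀ j, 0 < ‖G j‖ := fun j => by
    rcases (norm_nonneg (G j)).eq_or_lt with h | h
    · have h1 : G j = 0 := norm_eq_zero.1 h.symm
      have h2 := hTG j
      rw [h1, map_zero] at h2
      simp at h2
    · exact h
  -- the normalized vectors tend to zero, but their images stay away from zero
  let c : ℕ → ℝ := fun j => ((j + 1) * ‖G j‖)⁻¹
  have hc : ∀ j, 0 < c j := fun j => inv_pos.2 (mul_pos (by positivity) (hpos j))
  have hnorm : ∀ j (Z : FockFin ν), ‖(c j : ℂ) • Z‖ = c j * ‖Z‖ := fun j Z => by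
    rw [FockFin.norm_smul, Complex.norm_real, Real.norm_of_nonneg (hc j).le]
  have h0 : FinTendsto (fun j => (c j : ℂ) • G j) 0 := by
    refine finTendsto_iff.2 ⟨⟨N, fun j => Submodule.smul_mem _ _ (hG j)⟩, ?_⟩
    rw [tendsto_zero_iff_norm_tendsto_zero]
    refine tendsto_one_div_add_atTop_nhds_zero_nat.congr fun j => ?_
    have := (hpos j).ne'
    rw [hnorm]
    simp only [c]
    field_simp
  have h1 := (hT _ _ h0).tendsto
  rw [map_zero, tendsto_zero_iff_norm_tendsto_zero] at h1
  obtain ⟨j, hj⟩ := (h1.eventually_lt_const one_pos).exists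
  rw [map_smul, hnorm] at hj
  have h2 := mul_lt_mul_of_pos_left (hTG j) (hc j)
  have h3 : c j * ((j + 1) * ‖G j‖) = 1 :=
    inv_mul_cancel₀ (mul_pos (by positivity) (hpos j)).ne'
  linarith

/-- The data of the smeared field `Ψ(u) = ∫ \bar{u(x)} ψ(x) dx = a(J u) + a*(C u)`, with `J` linear
and `C` antilinear, together with the multiplication operators by test functions `f`, by a fixed
weight `p`, and by the quotients `f / p`. The weight makes `C p` and `C (f / p)` Hilbert-Schmidt. -/
structure FieldData (d : ℕ) (ι 𝔥 : Type*) [NormedAddCommGroup 𝔥] [InnerProductSpace ℂ 𝔥]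
    {X : Type*} [MeasurableSpace X] (ν : Measure X) [SigmaFinite ν] where
  basis : HilbertBasis ι ℂ 𝔥
  J : 𝔥 →L[ℂ] Lp ℂ 2 ν
  C : 𝔥 →SL[starRingEnd ℂ] Lp ℂ 2 ν
  inner_J_add_inner_C : ∀ u v, ⟪J u, J v⟫ + ⟪C v, C u⟫ = ⟪u, v⟫
  inner_J_C : ∀ u v, ⟪J u, C v⟫ = 0
  mul : 𝓢(Space d, ℝ) → 𝔥 →L[ℂ] 𝔥
  quot : 𝓢(Space d, ℝ) → 𝔥 →L[ℂ] 𝔥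
  weight : 𝔥 →L[ℂ] 𝔥
  quot_weight : ∀ f u, quot f (weight u) = mul f u
  mul_quot : ∀ f g u, mul f (quot g u) = quot (mulTest f g) u
  inner_weight : ∀ u v, ⟪weight u, v⟫ = ⟪u, weight v⟫
  summable_weight : Summable fun i => ‖C (weight (basis i))‖ ^ 2
  summable_quot : ∀ f, Summable fun i => ‖C (quot f (basis i))‖ ^ 2

namespace FieldData

variable {d : ℕ} {ι 𝔥 : Type*} [NormedAddCommGroup 𝔥] [InnerProductSpace ℂ 𝔥]
  (F : FieldData d ι 𝔥 ν)

/-- The smeared field `Ψ(u) = a(J u) + a*(C u)`, antilinear in `u`. -/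
def field (u : 𝔥) : Module.End ℂ (FockFin ν) := annihilation (F.J u) + creation (F.C u)

/-- The adjoint `Ψ*(u) = a*(J u) + a(C u)` of the smeared field. -/
def fieldAdj (u : 𝔥) : Module.End ℂ (FockFin ν) := creation (F.J u) + annihilation (F.C u)

theorem field_apply (u : 𝔥) (G : FockFin ν) :
    F.field u G = annihilation (F.J u) G + creation (F.C u) G := rfl

theorem inner_field_left (u : 𝔥) (G G' : FockFin ν) :
    ⟪F.field u G, G'⟫ = ⟪G, F.fieldAdj u G'⟫ := by
  rw [field, fieldAdj, LinearMap.add_apply, LinearMap.add_apply, inner_add_left, inner_add_right,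
    inner_annihilation_left, inner_creation_left]

theorem inner_fieldAdj_left (u : 𝔥) (G G' : FockFin ν) :
    ⟪F.fieldAdj u G, G'⟫ = ⟪G, F.field u G'⟫ := by
  rw [← inner_conj_symm, ← inner_field_left, inner_conj_symm]

theorem field_mul_field (u v : 𝔥) : F.field u * F.field v = -(F.field v * F.field u) := by
  simp only [field, mul_add, add_mul]
  rw [annihilation_mul_annihilation (F.J u), creation_mul_creation (F.C u),
    annihilation_mul_creation (F.J u), annihilation_mul_creation (F.J v), F.inner_J_C, F.inner_J_C]
  simp only [zero_smul]
  abel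

/-- The anticommutation relation `Ψ(u) Ψ*(v) + Ψ*(v) Ψ(u) = (u, v)` of the field. -/
theorem field_mul_fieldAdj (u v : 𝔥) :
    F.field u * F.fieldAdj v = ⟪u, v⟫ • 1 - F.fieldAdj v * F.field u := by
  simp only [field, fieldAdj, mul_add, add_mul]
  have h := annihilation_mul_creation (F.C v) (F.C u)
  rw [annihilation_mul_annihilation (F.J u), creation_mul_creation (F.C u),
    annihilation_mul_creation (F.J u), h, ← F.inner_J_add_inner_C, add_smul]
  abel

/-- The anticommutation relation gives `‖Ψ(u) G‖² + ‖Ψ*(u) G‖² = ‖u‖² ‖G‖²`. -/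
theorem norm_field_le (u : 𝔥) (G : FockFin ν) : ‖F.field u G‖ ≤ ‖u‖ * ‖G‖ := by
  have h : ((‖F.field u G‖ ^ 2 + ‖F.fieldAdj u G‖ ^ 2 : ℝ) : ℂ) =
      ((‖u‖ ^ 2 * ‖G‖ ^ 2 : ℝ) : ℂ) := by
    have h1 := F.inner_fieldAdj_left u G (F.fieldAdj u G)
    have h2 := F.inner_field_left u G (F.field u G)
    rw [← Module.End.mul_apply, field_mul_fieldAdj, LinearMap.sub_apply,
      LinearMap.smul_apply, Module.End.one_apply, Module.End.mul_apply, inner_sub_right,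
      FockFin.inner_smul_right, ← h2] at h1
    simp only [inner_self_eq_norm_sq_to_K, Complex.coe_algebraMap] at h1
    push_cast
    rw [h1, add_sub_cancel]
  have := Complex.ofReal_injective h
  refine (sq_le_sq₀ (norm_nonneg _) (by positivity)).1 ?_
  rw [mul_pow]
  nlinarith [sq_nonneg ‖F.fieldAdj u G‖]

theorem field_mem_below (u : 𝔥) {G : FockFin ν} {N : ℕ} (hG : G ∈ FockFin.below ν N) :
    F.field u G ∈ FockFin.below ν (N + 1) :=
  Submodule.add_mem _ (FockFin.below_mono N.le_succ (annihilation_mem_below _ hG))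
    (creation_mem_below _ hG)

theorem fieldAdj_mem_below (u : 𝔥) {G : FockFin ν} {N : ℕ} (hG : G ∈ FockFin.below ν N) :
    F.fieldAdj u G ∈ FockFin.below ν (N + 1) :=
  Submodule.add_mem _ (creation_mem_below _ hG)
    (FockFin.below_mono N.le_succ (annihilation_mem_below _ hG))

theorem field_add (u v : 𝔥) : F.field (u + v) = F.field u + F.field v := by
  simp only [field, map_add, annihilation_add, creation_add]
  abel

theorem field_smul (c : ℂ) (u : 𝔥) : F.field (c • u) = (starRingEnd ℂ) c • F.field u := by
  simp only [field, map_smul, ContinuousLinearMap.map_smulₛₗ, annihilation_smul, creation_smul,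
    smul_add]

/-- The continuous linear functional `u ↦ (T Ψ(u) G, G')`. -/
theorem exists_clm_inner_field {T : Module.End ℂ (FockFin ν)} (hT : FinContinuous T)
    (G G' : FockFin ν) : ∃ φ : 𝔥 →L[ℂ] ℂ, ∀ u, φ u = ⟪T (F.field u G), G'⟫ := by
  obtain ⟨N, hN⟩ := FockFin.exists_mem_below G
  obtain ⟨C, hC, hTC⟩ := hT.exists_bound (N + 1)
  refine ⟨LinearMap.mkContinuous
    { toFun := fun u => ⟪T (F.field u G), G'⟫
      map_add' := fun u v => by rw [field_add, LinearMap.add_apply, map_add, inner_add_left]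
      map_smul' := fun c u => by
        rw [field_smul, LinearMap.smul_apply, map_smul, FockFin.inner_smul_left, Complex.conj_conj]
        rfl } (C * ‖G‖ * ‖G'‖) fun u => ?_, fun u => rfl⟩
  calc ‖⟪T (F.field u G), G'⟫‖ ≤ ‖T (F.field u G)‖ * ‖G'‖ := norm_inner_le_norm _ _
    _ ≤ (C * (‖u‖ * ‖G‖)) * ‖G'‖ := by
      gcongr
      exact (hTC _ (F.field_mem_below u hN)).trans (by gcongr; exact F.norm_field_le u G)
    _ = _ := by ring

/-- The annihilation parts of `Ψ(B eᵢ)` are square summable by the bound by the number operator, the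
creation parts because `u ↦ C (B u)` is Hilbert-Schmidt. -/
theorem exists_sum_norm_sq_field_le (B : 𝔥 →L[ℂ] 𝔥)
    (hB : Summable fun i => ‖F.C (B (F.basis i))‖ ^ 2) (N : ℕ) : ∃ D : ℝ, 0 ≤ D ∧
      ∀ G ∈ FockFin.below ν N, ∀ t : Finset ι,
        ∑ i ∈ t, ‖F.field (B (F.basis i)) G‖ ^ 2 ≤ D * ‖G‖ ^ 2 := by
  refine ⟨2 * (N * ‖F.J ∘L B‖ ^ 2) + 2 * ∑' i, ‖F.C (B (F.basis i))‖ ^ 2,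
    add_nonneg (by positivity) (mul_nonneg zero_le_two (tsum_nonneg fun i => by positivity)),
    fun G hG t => ?_⟩
  have h1 := sum_norm_sq_annihilation_le F.basis.orthonormal (F.J ∘L B) t hG
  have h2 : ∑ i ∈ t, ‖creation (F.C (B (F.basis i))) G‖ ^ 2 ≤
      (∑' i, ‖F.C (B (F.basis i))‖ ^ 2) * ‖G‖ ^ 2 := by
    calc _ ≤ ∑ i ∈ t, ‖F.C (B (F.basis i))‖ ^ 2 * ‖G‖ ^ 2 := by
          refine Finset.sum_le_sum fun i _ => ?_
          rw [← mul_pow]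
          exact pow_le_pow_left₀ (norm_nonneg _) (norm_creation_le _ _) 2
      _ ≤ _ := by
        rw [← Finset.sum_mul]
        gcongr
        exact hB.sum_le_tsum t fun i _ => by positivity
  calc ∑ i ∈ t, ‖F.field (B (F.basis i)) G‖ ^ 2
      ≤ ∑ i ∈ t, (2 * ‖annihilation ((F.J ∘L B) (F.basis i)) G‖ ^ 2 +
          2 * ‖creation (F.C (B (F.basis i))) G‖ ^ 2) := by
        refine Finset.sum_le_sum fun i _ => ?_
        rw [field_apply, ContinuousLinearMap.comp_apply]
        have := norm_add_le (annihilation (F.J (B (F.basis i))) G)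
          (creation (F.C (B (F.basis i))) G)
        have h3 := pow_le_pow_left₀ (norm_nonneg _) this 2
        nlinarith [sq_nonneg (‖annihilation (F.J (B (F.basis i))) G‖ -
          ‖creation (F.C (B (F.basis i))) G‖)]
    _ ≤ _ := by
      rw [Finset.sum_add_distrib, ← Finset.mul_sum, ← Finset.mul_sum]
      nlinarith

theorem summable_norm_sq_field (B : 𝔥 →L[ℂ] 𝔥)
    (hB : Summable fun i => ‖F.C (B (F.basis i))‖ ^ 2) (G : FockFin ν) :
    Summable fun i => ‖F.field (B (F.basis i)) G‖ ^ 2 := by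
  obtain ⟨N, hN⟩ := FockFin.exists_mem_below G
  obtain ⟨D, -, hD⟩ := F.exists_sum_norm_sq_field_le B hB N
  exact summable_of_sum_le (fun i => by positivity) fun t => hD G hN t

/-- The adjoint estimate of `exists_sum_norm_sq_field_le`. -/
theorem norm_sum_fieldAdj_sq_le (B : 𝔥 →L[ℂ] 𝔥) {N : ℕ} {D : ℝ} (hD0 : 0 ≤ D)
    (hD : ∀ G ∈ FockFin.below ν (N + 1), ∀ t : Finset ι,
        ∑ i ∈ t, ‖F.field (B (F.basis i)) G‖ ^ 2 ≤ D * ‖G‖ ^ 2)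
    {v : ι → FockFin ν} (hv : ∀ i, v i ∈ FockFin.below ν N) (t : Finset ι) :
    ‖∑ i ∈ t, F.fieldAdj (B (F.basis i)) (v i)‖ ^ 2 ≤ D * ∑ i ∈ t, ‖v i‖ ^ 2 := by
  set z := ∑ i ∈ t, F.fieldAdj (B (F.basis i)) (v i) with hz
  have hzN : z ∈ FockFin.below ν (N + 1) :=
    Submodule.sum_mem _ fun i _ => F.fieldAdj_mem_below _ (hv i)
  have h1 : ‖z‖ ^ 2 ≤ ∑ i ∈ t, ‖v i‖ * ‖F.field (B (F.basis i)) z‖ := by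
    have h2 : ((‖z‖ : ℝ) : ℂ) ^ 2 = ∑ i ∈ t, ⟪v i, F.field (B (F.basis i)) z⟫ := by
      have h3 : ⟪z, z⟫ = ∑ i ∈ t, ⟪v i, F.field (B (F.basis i)) z⟫ := by
        conv_lhs => rw [hz, sum_inner]
        exact Finset.sum_congr rfl fun i _ => F.inner_fieldAdj_left _ _ _
      rw [← h3, inner_self_eq_norm_sq_to_K]
      rfl
    calc ‖z‖ ^ 2 = ‖((‖z‖ : ℝ) : ℂ) ^ 2‖ := by simp
      _ ≤ _ := by
        rw [h2]
        exact (norm_sum_le _ _).trans (Finset.sum_le_sum fun i _ => norm_inner_le_norm _ _)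
  have h4 := Finset.sum_mul_sq_le_sq_mul_sq t (fun i => ‖v i‖)
    fun i => ‖F.field (B (F.basis i)) z‖
  have h5 : (‖z‖ ^ 2) ^ 2 ≤ (∑ i ∈ t, ‖v i‖ ^ 2) * (D * ‖z‖ ^ 2) :=
    (pow_le_pow_left₀ (by positivity) h1 2).trans (h4.trans (by
      gcongr
      exact hD z hzN t))
  rcases (sq_nonneg ‖z‖).eq_or_lt with h0 | h0
  · rw [← h0]
    exact mul_nonneg hD0 (Finset.sum_nonneg fun i _ => by positivity)
  · nlinarith

/-- The sum `∑ᵢ Ψ*(B' eᵢ) Ψ(B eᵢ)` converges weakly to a continuous operator when the creation parts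
of `Ψ(B ·)` and `Ψ(B' ·)` are Hilbert-Schmidt. -/
theorem exists_hasSum_fieldAdj_mul_field (B B' : 𝔥 →L[ℂ] 𝔥)
    (hB : Summable fun i => ‖F.C (B (F.basis i))‖ ^ 2)
    (hB' : Summable fun i => ‖F.C (B' (F.basis i))‖ ^ 2) :
    ∃ T : Module.End ℂ (FockFin ν), FinContinuous T ∧ ∀ G G' : FockFin ν,
      HasSum (fun i => ⟪F.field (B (F.basis i)) G, F.field (B' (F.basis i)) G'⟫) ⟪T G, G'⟫ := by
  let s : FockFin ν → ι → FockFin ν := fun G i =>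
    F.fieldAdj (B' (F.basis i)) (F.field (B (F.basis i)) G)
  -- the sum converges in the norm of the complete Fock space, and the limit has finitely many
  -- particles
  have hsum : ∀ G, Summable fun i => (s G i : Fock ν) := by
    intro G
    obtain ⟨N, hN⟩ := FockFin.exists_mem_below G
    obtain ⟨D, hD0, hD⟩ := F.exists_sum_norm_sq_field_le B' hB' (N + 1 + 1)
    have h1 := F.summable_norm_sq_field B hB G
    rw [summable_iff_vanishing_norm] at h1 ⊢
    intro ε hε
    obtain ⟨t₀, ht₀⟩ := h1 (ε ^ 2 / (D + 1)) (by positivity)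
    refine ⟨t₀, fun t ht => ?_⟩
    have h2 := F.norm_sum_fieldAdj_sq_le B' hD0 hD
      (fun i => F.field_mem_below (B (F.basis i)) hN) t
    have h3 := ht₀ t ht
    rw [Real.norm_of_nonneg (Finset.sum_nonneg fun i _ => by positivity),
      lt_div_iff₀ (by positivity)] at h3
    have h4 : ‖∑ i ∈ t, s G i‖ ^ 2 < ε ^ 2 := by
      have : 0 ≤ ∑ i ∈ t, ‖F.field (B (F.basis i)) G‖ ^ 2 :=
        Finset.sum_nonneg fun i _ => by positivity
      refine h2.trans_lt (lt_of_le_of_lt ?_ h3)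
      nlinarith
    have h5 := lt_of_pow_lt_pow_left₀ 2 hε.le h4
    rw [← Submodule.coe_sum]
    exact h5
  have hmem : ∀ (G : FockFin ν) (N : ℕ), G ∈ FockFin.below ν N → ∀ n, N + 2 ≤ n →
      (∑' i, (s G i : Fock ν)) n = 0 := by
    intro G N hN n hn
    let ev : Fock ν →+ AntisymPower ν n :=
      { toFun := fun g => g n, map_zero' := rfl, map_add' := fun _ _ => rfl }
    have hev : Continuous ev := AddMonoidHomClass.continuous_of_bound ev 1 fun g => by
      rw [one_mul]; exact lp.norm_apply_le_norm two_ne_zero g n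
    have h1 := (hsum G).hasSum.map ev hev
    have h2 : (ev ∘ fun i => (s G i : Fock ν)) = fun _ => 0 := funext fun i =>
      F.fieldAdj_mem_below _ (F.field_mem_below _ hN) n hn
    rw [h2] at h1
    exact h1.unique hasSum_zero
  let T : Module.End ℂ (FockFin ν) :=
    { toFun := fun G => ⟨∑' i, (s G i : Fock ν), by
        obtain ⟨N, hN⟩ := FockFin.exists_mem_below G
        exact ⟨N + 2, hmem G N hN⟩⟩
      map_add' := fun G G' => by
        refine Subtype.ext ?_
        change ∑' i, (s (G + G') i : Fock ν) = ∑' i, (s G i : Fock ν) + ∑' i, (s G' i : Fock ν)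
        rw [← (hsum G).tsum_add (hsum G')]
        refine tsum_congr fun i => ?_
        rw [← Submodule.coe_add]
        simp only [s, map_add]
      map_smul' := fun c G => by
        refine Subtype.ext ?_
        change ∑' i, (s (c • G) i : Fock ν) = c • ∑' i, (s G i : Fock ν)
        rw [← (hsum G).tsum_const_smul c]
        refine tsum_congr fun i => ?_
        rw [← Submodule.coe_smul]
        simp only [s, map_smul] }
  have hT : ∀ G G' : FockFin ν,
      HasSum (fun i => ⟪F.field (B (F.basis i)) G, F.field (B' (F.basis i)) G'⟫) ⟪T G, G'⟫ := by
    intro G G'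
    have h1 := ((hsum G).hasSum.mapL (innerSL ℂ (G' : Fock ν))).map (starRingEnd ℂ)
      Complex.continuous_conj
    convert! h1 using 1
    · funext i
      simp only [Function.comp_apply, innerSL_apply_apply, inner_conj_symm]
      exact (F.inner_fieldAdj_left _ _ _).symm
    · simp only [innerSL_apply_apply, inner_conj_symm]
      rfl
  refine ⟨T, FinContinuous.of_bound fun N => ?_, hT⟩
  obtain ⟨D, hD0, hD⟩ := F.exists_sum_norm_sq_field_le B hB N
  obtain ⟨D', hD0', hD'⟩ := F.exists_sum_norm_sq_field_le B' hB' (N + 1 + 1)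
  refine ⟨N + 2, Real.sqrt (D' * D), fun G hG => ⟨hmem G N hG, ?_⟩⟩
  refine le_of_tendsto ((hsum G).hasSum.norm) (Filter.Eventually.of_forall fun t => ?_)
  have h2 := F.norm_sum_fieldAdj_sq_le B' hD0' hD' (fun i => F.field_mem_below (B (F.basis i)) hG) t
  rw [← Submodule.coe_sum]
  refine (sq_le_sq₀ (norm_nonneg _) (by positivity)).1 ?_
  rw [mul_pow, Real.sq_sqrt (by positivity), mul_assoc]
  exact h2.trans (by gcongr; exact hD G hG t)

end FieldData

end Field

/-! ### Smearing and the recursion of the normal products -/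

section Smearing

variable {X : Type*} [MeasurableSpace X] {ν : Measure X} [SigmaFinite ν]

namespace FieldData

variable {d : ℕ} {ι 𝔥 : Type*} [NormedAddCommGroup 𝔥] [InnerProductSpace ℂ 𝔥]
  (F : FieldData d ι 𝔥 ν)

/-- `R = ∫ f(x) ψ*(x) T ψ(x) dx`, expressed through an orthonormal basis `eᵢ` of the test space
as the weak sum `R = ∑ᵢ Ψ*(p eᵢ) T Ψ((f / p) eᵢ)`. -/
def IsSmearing (T : Module.End ℂ (FockFin ν)) (f : 𝓢(Space d, ℝ))
    (R : Module.End ℂ (FockFin ν)) : Prop :=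
  ∀ G G' : FockFin ν, HasSum (fun i => ⟪T (F.field (F.quot f (F.basis i)) G),
    F.field (F.weight (F.basis i)) G'⟫) ⟪R G, G'⟫

variable {F}

theorem IsSmearing.unique {T R R' : Module.End ℂ (FockFin ν)} {f : 𝓢(Space d, ℝ)}
    (h : F.IsSmearing T f R) (h' : F.IsSmearing T f R') : R = R' :=
  LinearMap.ext fun G => ext_inner_right ℂ fun G' => (h G G').unique (h' G G')

theorem IsSmearing.sum {κ : Type*} (t : Finset κ) {T R : κ → Module.End ℂ (FockFin ν)}
    {f : 𝓢(Space d, ℝ)} (h : ∀ j ∈ t, F.IsSmearing (T j) f (R j)) :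
    F.IsSmearing (∑ j ∈ t, T j) f (∑ j ∈ t, R j) := by
  intro G G'
  simp only [LinearMap.sum_apply, sum_inner]
  exact hasSum_sum fun j hj => h j hj G G'

/-- The sign comes from the exchange of `Ψ(v)` with `ψ(x)`. -/
theorem IsSmearing.mul_field {T R : Module.End ℂ (FockFin ν)} {f : 𝓢(Space d, ℝ)}
    (h : F.IsSmearing T f R) (v : 𝔥) : F.IsSmearing (T * F.field v) f (-(R * F.field v)) := by
  intro G G'
  rw [LinearMap.neg_apply, inner_neg_left]
  refine (h (F.field v G) G').neg.congr_fun ?_ |> fun h => h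
  intro i
  have := LinearMap.congr_fun (F.field_mul_field v (F.quot f (F.basis i))) G
  rw [Module.End.mul_apply, LinearMap.neg_apply, Module.End.mul_apply] at this
  rw [Module.End.mul_apply, this, map_neg, inner_neg_left]

/-- The commutator of the field with `∫ f(x) ψ*(x) T ψ(x) dx` consists of the contraction of `Ψ(u)`
with `ψ*(x)` and of the commutator with `T`. -/
theorem IsSmearing.commutator {T R : Module.End ℂ (FockFin ν)} {f : 𝓢(Space d, ℝ)}
    (hT : FinContinuous T) (h : F.IsSmearing T f R) (u : 𝔥) :
    F.IsSmearing (F.field u * T - T * F.field u) f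
      (T * F.field (F.mul f u) - (F.field u * R - R * F.field u)) := by
  intro G G'
  obtain ⟨φ, hφ⟩ := F.exists_clm_inner_field hT G G'
  -- the contraction terms sum to `T Ψ(f u)` by the expansion `p u = ∑ᵢ (p eᵢ, u) eᵢ`
  have h1 : HasSum (fun i => ⟪F.weight (F.basis i), u⟫ *
      ⟪T (F.field (F.quot f (F.basis i)) G), G'⟫) ⟪T (F.field (F.mul f u) G), G'⟫ := by
    have := ((F.basis.hasSum_repr (F.weight u)).mapL (F.quot f)).mapL φ
    rw [F.quot_weight, hφ] at this
    convert! this using 2 with i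
    rw [map_smul, map_smul, hφ, F.basis.repr_apply_apply, F.inner_weight, smul_eq_mul]
  have h2 := h G (F.fieldAdj u G')
  have h3 := h (F.field u G) G'
  have h4 := (h1.sub h2).add h3
  convert! h4 using 1
  · funext i
    have e1 := LinearMap.congr_fun (F.field_mul_fieldAdj (F.weight (F.basis i)) u) G'
    have e2 := LinearMap.congr_fun (F.field_mul_field u (F.quot f (F.basis i))) G
    rw [Module.End.mul_apply, LinearMap.sub_apply, LinearMap.smul_apply, Module.End.one_apply,
      Module.End.mul_apply] at e1
    rw [Module.End.mul_apply, LinearMap.neg_apply, Module.End.mul_apply] at e2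
    rw [LinearMap.sub_apply, Module.End.mul_apply, Module.End.mul_apply, e1, e2, inner_sub_left,
      F.inner_field_left, inner_sub_right, FockFin.inner_smul_right, map_neg, inner_neg_left]
    ring
  · simp only [LinearMap.sub_apply, Module.End.mul_apply, inner_sub_left, F.inner_field_left]
    ring

/-- If the commutator of the field with `T` is `∑ⱼ Tⱼ Ψ(gⱼ u)`, then `∫ f(x) ψ*(x) T ψ(x) dx` is
`ρ(f) T` minus the contraction terms `∑ⱼ ∫ gⱼ(x) f(x) ψ*(x) Tⱼ ψ(x) dx`. -/
theorem IsSmearing.of_commutator {T ρ : Module.End ℂ (FockFin ν)} {f : 𝓢(Space d, ℝ)}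
    (hρ : F.IsSmearing 1 f ρ) {κ : Type*} [Fintype κ] {T' R' : κ → Module.End ℂ (FockFin ν)}
    {g : κ → 𝓢(Space d, ℝ)}
    (hc : ∀ u, F.field u * T = T * F.field u + ∑ j, T' j * F.field (F.mul (g j) u))
    (h : ∀ j, F.IsSmearing (T' j) (mulTest (g j) f) (R' j)) :
    F.IsSmearing T f (ρ * T - ∑ j, R' j) := by
  intro G G'
  have h1 := (hρ (T G) G').sub (hasSum_sum fun j (_ : j ∈ Finset.univ) => h j G G')
  convert! h1 using 1
  · funext i
    have := LinearMap.congr_fun (hc (F.quot f (F.basis i))) G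
    simp only [LinearMap.add_apply, LinearMap.sum_apply, Module.End.mul_apply, F.mul_quot] at this
    rw [Module.End.one_apply, this, inner_add_left, sum_inner, add_sub_cancel_right]
  · rw [LinearMap.sub_apply, Module.End.mul_apply, inner_sub_left, LinearMap.sum_apply, sum_inner]

theorem summable_norm_sq_field_field (B B' : 𝔥 →L[ℂ] 𝔥)
    (hB : Summable fun i => ‖F.C (B (F.basis i))‖ ^ 2)
    (hB' : Summable fun i => ‖F.C (B' (F.basis i))‖ ^ 2) (G : FockFin ν) :
    Summable fun p : ι × ι =>
      ‖F.field (B' (F.basis p.2)) (F.field (B (F.basis p.1)) G)‖ ^ 2 := by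
  obtain ⟨N, hN⟩ := FockFin.exists_mem_below G
  obtain ⟨D, hD0, hD⟩ := F.exists_sum_norm_sq_field_le B' hB' (N + 1)
  rw [summable_prod_of_nonneg fun p => by positivity]
  have h0 : ∀ i, Summable fun j => ‖F.field (B' (F.basis j)) (F.field (B (F.basis i)) G)‖ ^ 2 :=
    fun i => F.summable_norm_sq_field B' hB' (F.field (B (F.basis i)) G)
  have h1 : ∀ i, ∑' j, ‖F.field (B' (F.basis j)) (F.field (B (F.basis i)) G)‖ ^ 2 ≤
      D * ‖F.field (B (F.basis i)) G‖ ^ 2 := fun i =>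
    (h0 i).tsum_le_of_sum_le fun t => hD _ (F.field_mem_below (B (F.basis i)) hN) t
  exact ⟨h0, Summable.of_nonneg_of_le (fun i => tsum_nonneg fun j => sq_nonneg _) h1
    ((F.summable_norm_sq_field B hB G).mul_left D)⟩

theorem summable_inner_field_field {T : Module.End ℂ (FockFin ν)} (hT : FinContinuous T)
    (f g : 𝓢(Space d, ℝ)) (G G' : FockFin ν) :
    Summable fun p : ι × ι => ⟪T (F.field (F.quot g (F.basis p.2))
      (F.field (F.quot f (F.basis p.1)) G)), F.field (F.weight (F.basis p.2))
      (F.field (F.weight (F.basis p.1)) G')⟫ := by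
  obtain ⟨N, hN⟩ := FockFin.exists_mem_below G
  obtain ⟨C, hC, hTC⟩ := hT.exists_bound (N + 1 + 1)
  have h1 := summable_norm_sq_field_field (F := F) (F.quot f) (F.quot g) (F.summable_quot f)
    (F.summable_quot g) G
  have h2 := summable_norm_sq_field_field (F := F) F.weight F.weight F.summable_weight
    F.summable_weight G'
  have h3 : ∀ p : ι × ι, ‖⟪T (F.field (F.quot g (F.basis p.2))
      (F.field (F.quot f (F.basis p.1)) G)), F.field (F.weight (F.basis p.2))
      (F.field (F.weight (F.basis p.1)) G')⟫‖ ≤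
      C * (‖F.field (F.quot g (F.basis p.2)) (F.field (F.quot f (F.basis p.1)) G)‖ ^ 2 +
        ‖F.field (F.weight (F.basis p.2)) (F.field (F.weight (F.basis p.1)) G')‖ ^ 2) := by
    intro p
    have h4 := hTC _ (F.field_mem_below (F.quot g (F.basis p.2))
      (F.field_mem_below (F.quot f (F.basis p.1)) hN))
    have h5 := norm_inner_le_norm (𝕜 := ℂ) (T (F.field (F.quot g (F.basis p.2))
      (F.field (F.quot f (F.basis p.1)) G))) (F.field (F.weight (F.basis p.2))
      (F.field (F.weight (F.basis p.1)) G'))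
    generalize ‖F.field (F.quot g (F.basis p.2)) (F.field (F.quot f (F.basis p.1)) G)‖ = a at *
    have h6 := norm_nonneg (F.field (F.weight (F.basis p.2)) (F.field (F.weight (F.basis p.1)) G'))
    generalize ‖F.field (F.weight (F.basis p.2)) (F.field (F.weight (F.basis p.1)) G')‖ = b at *
    refine h5.trans ((mul_le_mul_of_nonneg_right h4 h6).trans ?_)
    rw [mul_assoc]
    refine mul_le_mul_of_nonneg_left ?_ hC
    nlinarith [sq_nonneg (a - b), sq_nonneg a, sq_nonneg b]
  exact Summable.of_norm_bounded ((h1.add h2).mul_left C) h3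

/-- Smearings with two test functions commute: both are the double sum, the two exchanges of
fields cancelling each other's sign. -/
theorem IsSmearing.comm {T R R' Q Q' : Module.End ℂ (FockFin ν)} {f g : 𝓢(Space d, ℝ)}
    (hT : FinContinuous T) (hR : F.IsSmearing T g R) (hR' : F.IsSmearing R f R')
    (hQ : F.IsSmearing T f Q) (hQ' : F.IsSmearing Q g Q') : R' = Q' := by
  refine LinearMap.ext fun G => ext_inner_right ℂ fun G' => ?_
  obtain ⟨S, hS⟩ := summable_inner_field_field (F := F) hT f g G G'
  have h1 : HasSum (fun i => ⟪R (F.field (F.quot f (F.basis i)) G),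
      F.field (F.weight (F.basis i)) G'⟫) S :=
    hS.prod_fiberwise fun i =>
      hR (F.field (F.quot f (F.basis i)) G) (F.field (F.weight (F.basis i)) G')
  have hS' := (Equiv.prodComm ι ι).hasSum_iff.2 hS
  have h3 : ∀ j, HasSum (fun i => ⟪T (F.field (F.quot g (F.basis j))
      (F.field (F.quot f (F.basis i)) G)), F.field (F.weight (F.basis j))
      (F.field (F.weight (F.basis i)) G')⟫) ⟪Q (F.field (F.quot g (F.basis j)) G),
      F.field (F.weight (F.basis j)) G'⟫ := by
    intro j
    refine (hQ (F.field (F.quot g (F.basis j)) G) (F.field (F.weight (F.basis j)) G')).congr_fun ?_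
    intro i
    have e1 := LinearMap.congr_fun
      (F.field_mul_field (F.quot g (F.basis j)) (F.quot f (F.basis i))) G
    have e2 := LinearMap.congr_fun
      (F.field_mul_field (F.weight (F.basis j)) (F.weight (F.basis i))) G'
    rw [Module.End.mul_apply, LinearMap.neg_apply, Module.End.mul_apply] at e1 e2
    rw [e1, e2, map_neg, inner_neg_neg]
  have h2 : HasSum (fun j => ⟪Q (F.field (F.quot g (F.basis j)) G),
      F.field (F.weight (F.basis j)) G'⟫) S := hS'.prod_fiberwise h3
  exact ((hR' G G').unique h1).trans ((hQ' G G').unique h2).symm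

end FieldData

end Smearing

/-! ### The smeared normal products -/

section NormalProduct

/-- The normal products are symmetric by construction. -/
theorem normalProduct_comp_perm {d : ℕ} {V : Type*} [AddCommGroup V] [Module ℂ V]
    (ρ : 𝓢(Space d, ℝ) → Module.End ℂ V) (n : ℕ) (f : Fin n → 𝓢(Space d, ℝ))
    (τ : Equiv.Perm (Fin n)) : normalProduct ρ n (f ∘ τ) = normalProduct ρ n f := by
  match n with
  | 0 => rfl
  | n + 1 =>
    rw [normalProduct, normalProduct]
    congr 1
    exact Equiv.sum_comp (Equiv.mulLeft τ) fun σ : Equiv.Perm (Fin (n + 1)) =>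
      (ρ (f (σ (Fin.last n))) * normalProduct ρ n (fun j => f (σ j.castSucc)) -
        ∑ i : Fin n, normalProduct ρ n (Function.update (fun j => f (σ j.castSucc)) i
          (mulTest (f (σ i.castSucc)) (f (σ (Fin.last n))))))

variable {X : Type*} [MeasurableSpace X] {ν : Measure X} [SigmaFinite ν]

theorem FinContinuous.normalProduct {d : ℕ} {ρ : 𝓢(Space d, ℝ) → Module.End ℂ (FockFin ν)}
    (hρ : ∀ f, FinContinuous (ρ f)) (n : ℕ) (f : Fin n → 𝓢(Space d, ℝ)) :
    FinContinuous (FermiGas.normalProduct ρ n f) := by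
  induction n with
  | zero => exact FinContinuous.one
  | succ n ih =>
    rw [FermiGas.normalProduct]
    exact (FinContinuous.sum _ fun σ _ => ((hρ _).mul (ih _)).sub
      (FinContinuous.sum _ fun i _ => ih _)).smul _

/-- Symmetry under the exchange of neighbouring arguments implies symmetry. -/
theorem eq_of_forall_swap {n : ℕ} {α β : Type*} (R : (Fin (n + 1) → α) → β)
    (h : ∀ (f : Fin (n + 1) → α) (i : Fin n), R (f ∘ Equiv.swap i.castSucc i.succ) = R f)
    (σ : Equiv.Perm (Fin (n + 1))) (f : Fin (n + 1) → α) : R (f ∘ σ) = R f := by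
  have hσ : σ ∈ Submonoid.closure
      (Set.range fun i : Fin n => Equiv.swap i.castSucc i.succ) := by
    rw [Equiv.Perm.mclosure_swap_castSucc_succ]; trivial
  induction hσ using Submonoid.closure_induction generalizing f with
  | mem x hx => obtain ⟨i, rfl⟩ := hx; exact h f i
  | one => rfl
  | mul x y _ _ hx hy => rw [Equiv.Perm.coe_mul, ← Function.comp_assoc, hy, hx]

/-- One step of the recursion for the normal products, before the symmetrization. -/
def normalStep {d : ℕ} {V : Type*} [AddCommGroup V] [Module ℂ V]
    (ρ : 𝓢(Space d, ℝ) → Module.End ℂ V) (n : ℕ) (f : Fin (n + 1) → 𝓢(Space d, ℝ)) :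
    Module.End ℂ V :=
  ρ (f (Fin.last n)) * normalProduct ρ n (f ∘ Fin.castSucc) -
    ∑ i : Fin n, normalProduct ρ n (Function.update (f ∘ Fin.castSucc) i
      (mulTest (f i.castSucc) (f (Fin.last n))))

theorem normalProduct_eq_normalStep {d : ℕ} {V : Type*} [AddCommGroup V] [Module ℂ V]
    (ρ : 𝓢(Space d, ℝ) → Module.End ℂ V) (n : ℕ) (f : Fin (n + 1) → 𝓢(Space d, ℝ))
    (h : ∀ σ : Equiv.Perm (Fin (n + 1)), normalStep ρ n (f ∘ σ) = normalStep ρ n f) :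
    normalProduct ρ (n + 1) f = normalStep ρ n f := by
  have h1 : normalProduct ρ (n + 1) f = ((n + 1).factorial : ℂ)⁻¹ •
      ∑ σ : Equiv.Perm (Fin (n + 1)), normalStep ρ n (f ∘ σ) := rfl
  rw [h1, Finset.sum_congr rfl fun σ _ => h σ, Finset.sum_const, Finset.card_univ,
    Fintype.card_perm, Fintype.card_fin, ← Nat.cast_smul_eq_nsmul ℂ, smul_smul,
    inv_mul_cancel₀ (by exact_mod_cast (n + 1).factorial_ne_zero), one_smul]

namespace FieldData

variable {d : ℕ} {ι 𝔥 : Type*} [NormedAddCommGroup 𝔥] [InnerProductSpace ℂ 𝔥]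
  {F : FieldData d ι 𝔥 ν} {ρ : 𝓢(Space d, ℝ) → Module.End ℂ (FockFin ν)}

/-- Every factor of a normal product may be the one smeared last. -/
theorem isSmearing_succAbove {n : ℕ}
    (hP : ∀ f : Fin (n + 1) → 𝓢(Space d, ℝ), F.IsSmearing (normalProduct ρ n (f ∘ Fin.castSucc))
      (f (Fin.last n)) (normalProduct ρ (n + 1) f))
    (f : Fin (n + 1) → 𝓢(Space d, ℝ)) (j : Fin (n + 1)) :
    F.IsSmearing (normalProduct ρ n (f ∘ j.succAbove)) (f j) (normalProduct ρ (n + 1) f) := by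
  let σ : Equiv.Perm (Fin (n + 1)) :=
    (finSuccEquiv' (Fin.last n)).trans (finSuccEquiv' j).symm
  have h1 : (f ∘ σ) (Fin.last n) = f j := by simp [σ]
  have h2 : (f ∘ σ) ∘ Fin.castSucc = f ∘ j.succAbove := by
    funext i
    simp only [Function.comp_apply, σ, Equiv.trans_apply]
    rw [← Fin.succAbove_last, finSuccEquiv'_succAbove, finSuccEquiv'_symm_some]
  have h := hP (f ∘ σ)
  rwa [h1, h2, normalProduct_comp_perm] at h

/-- The unsymmetrized recursion step is already symmetric, hence equal to the normal product: with
`Nₙ` for the normal products,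
`N_{n+1}(f₁, …, f_{n+1}) = ∫ f_{n+1}(x) ψ*(x) Nₙ(f₁, …, fₙ) ψ(x) dx`. The induction also carries
the commutator
`[Ψ(u), N_{n+1}(f₁, …, f_{n+1})] = ∑ⱼ Nₙ(f₁, … f̌ⱼ …, f_{n+1}) Ψ(fⱼ u)` with the field, by which
`of_commutator` identifies the recursion step as a smearing. -/
theorem isSmearing_normalProduct_and_commutator (hρ : ∀ f, FinContinuous (ρ f))
    (hρF : ∀ f, F.IsSmearing 1 f (ρ f)) (n : ℕ) :
    (∀ f : Fin (n + 1) → 𝓢(Space d, ℝ), F.IsSmearing (normalProduct ρ n (f ∘ Fin.castSucc))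
      (f (Fin.last n)) (normalProduct ρ (n + 1) f)) ∧
    ∀ (f : Fin (n + 1) → 𝓢(Space d, ℝ)) (u : 𝔥), F.field u * normalProduct ρ (n + 1) f =
      normalProduct ρ (n + 1) f * F.field u +
        ∑ j, normalProduct ρ n (f ∘ j.succAbove) * F.field (F.mul (f j) u) := by
  induction n with
  | zero =>
    have h1 : ∀ f : Fin 1 → 𝓢(Space d, ℝ), normalProduct ρ 1 f = ρ (f 0) := by
      intro f
      rw [normalProduct_eq_normalStep ρ 0 f fun σ => by
        congr 1; funext i; exact congrArg f (@Subsingleton.elim (Fin 1) _ _ _)]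
      simp [normalStep, normalProduct]
    have h2 : ∀ f : Fin 1 → 𝓢(Space d, ℝ), F.IsSmearing (normalProduct ρ 0 (f ∘ Fin.castSucc))
      (f (Fin.last 0)) (normalProduct ρ 1 f) := fun f => by rw [h1]; exact hρF _
    refine ⟨h2, fun f u => ?_⟩
    have h3 := (h2 f).commutator FinContinuous.one u
    have h4 : F.IsSmearing (F.field u * 1 - 1 * F.field u) (f (Fin.last 0)) 0 := by
      intro G G'
      simp [hasSum_zero]
    have h5 := h3.unique h4
    rw [Fin.sum_univ_one]
    change 1 * _ - _ = _ at h5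
    change _ = _ + 1 * _
    rw [sub_eq_zero] at h5
    rw [show f 0 = f (Fin.last 0) from rfl, h5]
    abel
  | succ n ih =>
    obtain ⟨ihP, ihC⟩ := ih
    have hN := fun (m : ℕ) (f : Fin m → 𝓢(Space d, ℝ)) => FinContinuous.normalProduct hρ m f
    have hstep : ∀ f : Fin (n + 2) → 𝓢(Space d, ℝ), F.IsSmearing
        (normalProduct ρ (n + 1) (f ∘ Fin.castSucc)) (f (Fin.last (n + 1)))
        (normalStep ρ (n + 1) f) := by
      intro f
      refine IsSmearing.of_commutator (hρF _) (ihC (f ∘ Fin.castSucc)) fun j => ?_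
      have h := isSmearing_succAbove ihP (Function.update (f ∘ Fin.castSucc) j
        (mulTest (f j.castSucc) (f (Fin.last (n + 1))))) j
      rw [Function.update_self] at h
      convert! h using 2
      funext i
      simp
    have hsymm : ∀ (σ : Equiv.Perm (Fin (n + 2))) (f : Fin (n + 2) → 𝓢(Space d, ℝ)),
        normalStep ρ (n + 1) (f ∘ σ) = normalStep ρ (n + 1) f := by
      refine eq_of_forall_swap _ fun f i => ?_
      refine Fin.lastCases ?_ (fun i => ?_) i
      · -- the last two smearings commute
        set f' := f ∘ Equiv.swap (Fin.last n).castSucc (Fin.last n).succ with hf'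
        have hb : (f' ∘ Fin.castSucc) ∘ Fin.castSucc = (f ∘ Fin.castSucc) ∘ Fin.castSucc := by
          funext j
          simp only [hf', Function.comp_apply]
          rw [Equiv.swap_apply_of_ne_of_ne]
          · simp
          · simp
        have e1 : (f' ∘ Fin.castSucc) (Fin.last n) = f (Fin.last (n + 1)) := by
          simp [hf', Equiv.swap_apply_left]
        have e2 : f' (Fin.last (n + 1)) = (f ∘ Fin.castSucc) (Fin.last n) := by
          simp only [hf', Function.comp_apply]
          rw [← Fin.succ_last, Equiv.swap_apply_right]
        have a1 := ihP (f ∘ Fin.castSucc)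
        have a2 := hstep f
        have b1 := ihP (f' ∘ Fin.castSucc)
        have b2 := hstep f'
        rw [hb, e1] at b1
        rw [e2] at b2
        exact (IsSmearing.comm (hN _ _) a1 a2 b1 b2).symm
      · -- the other exchanges take place within the symmetric `normalProduct ρ (n + 1)`
        have h1 := hstep (f ∘ Equiv.swap i.castSucc.castSucc i.castSucc.succ)
        have e1 : (f ∘ Equiv.swap i.castSucc.castSucc i.castSucc.succ) ∘ Fin.castSucc =
            (f ∘ Fin.castSucc) ∘ Equiv.swap i.castSucc i.succ := by
          funext j
          simp only [Function.comp_apply]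
          rw [Fin.succ_castSucc, ← (Fin.castSucc_injective (n + 1)).swap_apply]
        have e2 : (f ∘ Equiv.swap i.castSucc.castSucc i.castSucc.succ) (Fin.last (n + 1)) =
            f (Fin.last (n + 1)) := by
          simp only [Function.comp_apply]
          rw [Equiv.swap_apply_of_ne_of_ne]
          · exact (Fin.castSucc_lt_last _).ne'
          · rw [Fin.succ_castSucc]; exact (Fin.castSucc_lt_last _).ne'
        rw [e1, e2, normalProduct_comp_perm] at h1
        exact h1.unique (hstep f)
    have hP : ∀ f : Fin (n + 2) → 𝓢(Space d, ℝ), F.IsSmearing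
        (normalProduct ρ (n + 1) (f ∘ Fin.castSucc)) (f (Fin.last (n + 1)))
        (normalProduct ρ (n + 2) f) := fun f => by
      rw [normalProduct_eq_normalStep ρ (n + 1) f fun σ => hsymm σ f]
      exact hstep f
    refine ⟨hP, fun f u => ?_⟩
    -- the commutator with `N_{n+2}`, up to the contraction with the last point, is the smearing of
    -- the commutator with `N_{n+1}`, known by induction; the latter is smeared term by term
    have h1 := (hP f).commutator (hN _ _) u
    rw [ihC (f ∘ Fin.castSucc) u, add_sub_cancel_left] at h1
    have h2 : F.IsSmearing (∑ j : Fin (n + 1), normalProduct ρ n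
        ((f ∘ Fin.castSucc) ∘ j.succAbove) * F.field (F.mul ((f ∘ Fin.castSucc) j) u)) (f (Fin.last (n + 1)))
        (∑ j : Fin (n + 1), -(normalProduct ρ (n + 1) (f ∘ j.castSucc.succAbove) *
          F.field (F.mul (f j.castSucc) u))) := by
      refine IsSmearing.sum _ fun j _ => ?_
      refine IsSmearing.mul_field ?_ _
      have h := ihP (f ∘ j.castSucc.succAbove)
      have e1 : (f ∘ j.castSucc.succAbove) ∘ Fin.castSucc = (f ∘ Fin.castSucc) ∘ j.succAbove := by
        funext i
        simp [Fin.castSucc_succAbove_castSucc]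
      have e2 : (f ∘ j.castSucc.succAbove) (Fin.last n) = f (Fin.last (n + 1)) := by
        simp
      rwa [e1, e2] at h
    have h3 := h1.unique h2
    rw [Finset.sum_neg_distrib] at h3
    rw [Fin.sum_univ_castSucc, Fin.succAbove_last]
    rw [sub_eq_iff_eq_add, neg_add_eq_sub, eq_sub_iff_add_eq] at h3
    rw [add_comm (∑ _, _), h3]
    abel

/-- The recursion in the order of the integrations over `x₁, …, xₙ`, the first point outermost. -/
theorem isSmearing_normalProduct (hρ : ∀ f, FinContinuous (ρ f))
    (hρF : ∀ f, F.IsSmearing 1 f (ρ f)) (n : ℕ) (f : Fin (n + 1) → 𝓢(Space d, ℝ)) :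
    F.IsSmearing (normalProduct ρ n (f ∘ Fin.succ)) (f 0) (normalProduct ρ (n + 1) f) := by
  have := isSmearing_succAbove (isSmearing_normalProduct_and_commutator hρ hρF n).1 f 0
  rwa [Fin.succAbove_zero] at this

end FieldData

end NormalProduct

/-! ### Fourier multipliers on `L²` -/

section Multiplication

open scoped ENNReal

variable {α : Type*} [MeasurableSpace α] {μ : Measure α}

/-- The operator of multiplication by an essentially bounded function on `L²`. -/
def mulLp {m : α → ℂ} (hm : MemLp m ∞ μ) : Lp ℂ 2 μ →L[ℂ] Lp ℂ 2 μ :=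
  (ContinuousLinearMap.mul ℂ ℂ).holderL μ ∞ 2 2 hm.toLp

theorem coeFn_mulLp {m : α → ℂ} (hm : MemLp m ∞ μ) (u : Lp ℂ 2 μ) :
    mulLp hm u =ᵐ[μ] fun x => m x * u x := by
  have h := (ContinuousLinearMap.mul ℂ ℂ).coeFn_holder (r := 2) hm.toLp u
  filter_upwards [h, hm.coeFn_toLp] with x hx hx2
  change (mulLp hm u) x = _ at hx
  rw [hx, hx2]
  rfl

theorem inner_mulLp {m : α → ℂ} (hm : MemLp m ∞ μ) (hr : ∀ x, (starRingEnd ℂ) (m x) = m x)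
    (u v : Lp ℂ 2 μ) : ⟪mulLp hm u, v⟫ = ⟪u, mulLp hm v⟫ := by
  rw [L2.inner_def, L2.inner_def]
  refine integral_congr_ae ?_
  filter_upwards [coeFn_mulLp hm u, coeFn_mulLp hm v] with x h1 h2
  rw [h1, h2, RCLike.inner_apply, RCLike.inner_apply, map_mul, hr]
  ring

theorem mulLp_mulLp {m m' m'' : α → ℂ} (hm : MemLp m ∞ μ) (hm' : MemLp m' ∞ μ)
    (hm'' : MemLp m'' ∞ μ) (h : ∀ x, m x * m' x = m'' x) (u : Lp ℂ 2 μ) :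
    mulLp hm (mulLp hm' u) = mulLp hm'' u := by
  refine Lp.ext ?_
  filter_upwards [coeFn_mulLp hm (mulLp hm' u), coeFn_mulLp hm' u, coeFn_mulLp hm'' u]
    with x h1 h2 h3
  rw [h1, h2, h3, ← h, mul_assoc]

theorem inner_star_star (u v : Lp ℂ 2 μ) : ⟪star u, star v⟫ = ⟪v, u⟫ := by
  rw [L2.inner_def, L2.inner_def]
  refine integral_congr_ae ?_
  filter_upwards [Lp.coeFn_star u, Lp.coeFn_star v] with x h1 h2
  rw [h1, h2, RCLike.inner_apply, RCLike.inner_apply]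
  simp [mul_comm]

theorem norm_star_Lp (u : Lp ℂ 2 μ) : ‖star u‖ = ‖u‖ := by
  have h := inner_star_star u u
  rw [inner_self_eq_norm_sq_to_K, inner_self_eq_norm_sq_to_K] at h
  have h2 : ‖star u‖ ^ 2 = ‖u‖ ^ 2 := by exact_mod_cast h
  exact (sq_eq_sq₀ (norm_nonneg _) (norm_nonneg _)).1 h2

/-- Complex conjugation on `L²`. -/
def conjLp : Lp ℂ 2 μ →SL[starRingEnd ℂ] Lp ℂ 2 μ :=
  LinearMap.mkContinuous
    { toFun := star
      map_add' := fun u v => Lp.ext <| by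
        filter_upwards [Lp.coeFn_star (u + v), Lp.coeFn_add u v, Lp.coeFn_star u, Lp.coeFn_star v,
          Lp.coeFn_add (star u) (star v)] with x h1 h2 h3 h4 h5
        rw [h1, h5, Pi.star_apply, h2, Pi.add_apply, Pi.add_apply, h3, h4, star_add]
        rfl
      map_smul' := fun c u => Lp.ext <| by
        filter_upwards [Lp.coeFn_star (c • u), Lp.coeFn_smul c u, Lp.coeFn_star u,
          Lp.coeFn_smul ((starRingEnd ℂ) c) (star u)] with x h1 h2 h3 h4
        rw [h1, h4, Pi.star_apply, h2, Pi.smul_apply, Pi.smul_apply, h3, star_smul]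
        rfl } 1 fun u => by
    rw [one_mul]
    exact (norm_star_Lp u).le

end Multiplication

section Plancherel

variable {E : Type*} [NormedAddCommGroup E] [InnerProductSpace ℝ E] [FiniteDimensional ℝ E]
  [MeasurableSpace E] [BorelSpace E]

/-- A vector of `L²` with the same scalar products with all test functions as a locally integrable
function is that function. -/
theorem ae_eq_of_inner_toLp {w : Lp ℂ 2 (volume : Measure E)} {h : E → ℂ}
    (hh : LocallyIntegrable h)
    (H : ∀ g : 𝓢(E, ℂ), ⟪g.toLp 2, w⟫ = ∫ x, (starRingEnd ℂ) (g x) * h x) : w =ᵐ[volume] h := by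
  have hw : LocallyIntegrable w := (Lp.memLp w).locallyIntegrable (by norm_num)
  refine ae_eq_of_integral_contDiff_smul_eq hw hh fun g hg hgs => ?_
  have hgc : HasCompactSupport (fun x => (g x : ℂ)) :=
    hgs.comp_left (g := fun r : ℝ => (r : ℂ)) (by simp)
  have hgd : ContDiff ℝ (⊤ : ℕ∞) (fun x => (g x : ℂ)) := Complex.ofRealCLM.contDiff.comp hg
  have h1 := H (hgc.toSchwartzMap hgd)
  rw [L2.inner_def] at h1
  rw [integral_congr_ae (g := fun x => g x • w x)] at h1
  · rw [h1]
    refine integral_congr_ae (Filter.Eventually.of_forall fun x => ?_)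
    simp
  · filter_upwards [(hgc.toSchwartzMap hgd).coeFn_toLp 2 volume] with x hx
    rw [hx]
    simp [mul_comm]

theorem continuous_fourierInv {h : E → ℂ} (h1 : Integrable h) : Continuous (𝓕⁻ h) := by
  have h3 : Continuous (𝓕 h) := VectorFourier.fourierIntegral_continuous
    Real.continuous_fourierChar (L := innerₗ E) (μ := volume) continuous_inner h1
  have h4 : 𝓕⁻ h = fun x => 𝓕 h (-x) := funext fun x => Real.fourierInv_eq_fourier_neg h x
  rw [h4]
  exact h3.comp continuous_neg

theorem norm_fourierInv_le (h : E → ℂ) (x : E) : ‖𝓕⁻ h x‖ ≤ ∫ ξ, ‖h ξ‖ := by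
  rw [Real.fourierInv_eq]
  refine (norm_integral_le_integral_norm _).trans (le_of_eq ?_)
  simp

/-- On functions in `L¹ ∩ L²` the Plancherel transform is given by the integral. -/
theorem fourierInv_toLp_ae_eq {h : E → ℂ} (h2 : MemLp h 2) (h1 : Integrable h) :
    (𝓕⁻ h2.toLp : Lp ℂ 2 (volume : Measure E)) =ᵐ[volume] 𝓕⁻ h := by
  refine ae_eq_of_inner_toLp (continuous_fourierInv h1).locallyIntegrable fun g => ?_
  rw [← Lp.inner_fourier_eq, FourierTransform.fourier_fourierInv_eq, SchwartzMap.toLp_fourier_eq]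
  have h3 := VectorFourier.integral_sesq_fourierIntegral_eq_neg_flip (μ := volume) (ν := volume)
    (f := g) (g := h) (L := innerₗ E) (innerSL ℂ) Real.continuous_fourierChar
    continuous_inner g.integrable h1
  have h4 : ∀ x, VectorFourier.fourierIntegral Real.fourierChar volume (-(innerₗ E).flip) h x =
      𝓕⁻ h x := fun x => by
    rw [Real.fourierInv_eq]
    refine integral_congr_ae (Filter.Eventually.of_forall fun v => ?_)
    simp [real_inner_comm]
  rw [L2.inner_def, integral_congr_ae (g := fun ξ => innerSL ℂ (𝓕 (g : E → ℂ) ξ) (h ξ))]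
  · refine h3.trans (integral_congr_ae (Filter.Eventually.of_forall fun x => ?_))
    simp only [h4]
    simp [mul_comm]
  · filter_upwards [(𝓕 g).coeFn_toLp 2 volume, h2.coeFn_toLp] with x hx hx2
    rw [hx, hx2, SchwartzMap.fourier_coe]
    rfl

/-- The Fourier transform turns translations into multiplication by characters. -/
theorem fourier_compMeasurePreserving_sub (x : E) (w : Lp ℂ 2 (volume : Measure E))
    (hm : MemLp (fun ξ : E => (Real.fourierChar (-inner ℝ x ξ) : ℂ)) ⊤ volume) :
    𝓕 (Lp.compMeasurePreserving (fun y => y - x) (measurePreserving_sub_right volume x) w) =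
      mulLp hm (𝓕 w) := by
  let τ := Lp.compMeasurePreservingₗᵢ (p := 2) (E := ℂ) ℂ (fun y => y - x)
    (measurePreserving_sub_right (volume : Measure E) x)
  have h : ∀ w, 𝓕 (τ w) = mulLp hm (𝓕 w) := by
    intro w
    refine DenseRange.induction_on (p := fun w => 𝓕 (τ w) = mulLp hm (𝓕 w))
      (SchwartzMap.denseRange_toLpCLM (p := 2) (μ := (volume : Measure E)) (F := ℂ)
        ENNReal.ofNat_ne_top) w ?_ ?_
    · exact isClosed_eq ((Lp.fourierTransformₗᵢ E ℂ).continuous.comp τ.continuous)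
        ((mulLp hm).continuous.comp (Lp.fourierTransformₗᵢ E ℂ).continuous)
    · intro g
      have h1 : τ (g.toLp 2) = (g.compSubConstCLM ℂ x).toLp 2 := by
        refine Lp.ext ?_
        filter_upwards [Lp.coeFn_compMeasurePreserving (g.toLp 2)
          (measurePreserving_sub_right (volume : Measure E) x),
          (g.compSubConstCLM ℂ x).coeFn_toLp 2 volume,
          (measurePreserving_sub_right (volume : Measure E) x).quasiMeasurePreserving.ae
            (g.coeFn_toLp 2 volume)] with y h1 h2 h3
        rw [h2]
        exact h1.trans h3
      change 𝓕 (τ (g.toLp 2)) = mulLp hm (𝓕 (g.toLp 2))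
      rw [h1, SchwartzMap.toLp_fourier_eq, SchwartzMap.toLp_fourier_eq]
      refine Lp.ext ?_
      filter_upwards [(𝓕 (g.compSubConstCLM ℂ x)).coeFn_toLp 2 volume,
        (𝓕 g).coeFn_toLp 2 volume, coeFn_mulLp hm ((𝓕 g).toLp 2)] with ξ h1 h2 h3
      have h4 := congrFun (VectorFourier.fourierIntegral_comp_add_right Real.fourierChar
        (volume : Measure E) (innerₗ E) g (-x)) ξ
      rw [h3, h1, h2, SchwartzMap.fourier_coe, SchwartzMap.fourier_coe]
      have h5 : (g.compSubConstCLM ℂ x : E → ℂ) = g ∘ fun v => v + -x := by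
        funext v
        simp [sub_eq_add_neg]
      rw [h5]
      refine Eq.trans ?_ (h4.trans ?_)
      · rfl
      · rw [Circle.smul_def]
        simp
        rfl
  exact h w

/-- The Fourier multiplier `𝓕⁻¹ m 𝓕` on `L²`. -/
def fourierMul {m : E → ℂ} (hm : MemLp m ⊤ volume) :
    Lp ℂ 2 (volume : Measure E) →L[ℂ] Lp ℂ 2 (volume : Measure E) :=
  ((Lp.fourierTransformₗᵢ E ℂ).symm : Lp ℂ 2 (volume : Measure E) →L[ℂ] Lp ℂ 2 volume) ∘L
    mulLp hm ∘L ((Lp.fourierTransformₗᵢ E ℂ) : Lp ℂ 2 (volume : Measure E) →L[ℂ] Lp ℂ 2 volume)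

theorem fourierMul_apply {m : E → ℂ} (hm : MemLp m ⊤ volume) (u : Lp ℂ 2 (volume : Measure E)) :
    fourierMul hm u = 𝓕⁻ (mulLp hm (𝓕 u)) := rfl

theorem inner_fourierInv_left (u v : Lp ℂ 2 (volume : Measure E)) : ⟪𝓕⁻ u, v⟫ = ⟪u, 𝓕 v⟫ := by
  rw [← Lp.inner_fourier_eq, FourierTransform.fourier_fourierInv_eq]

theorem inner_fourierInv_right (u v : Lp ℂ 2 (volume : Measure E)) : ⟪u, 𝓕⁻ v⟫ = ⟪𝓕 u, v⟫ := by
  rw [← Lp.inner_fourier_eq, FourierTransform.fourier_fourierInv_eq]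

theorem inner_fourierMul {m : E → ℂ} (hm : MemLp m ⊤ volume)
    (hr : ∀ x, (starRingEnd ℂ) (m x) = m x) (u v : Lp ℂ 2 (volume : Measure E)) :
    ⟪fourierMul hm u, v⟫ = ⟪u, fourierMul hm v⟫ := by
  rw [fourierMul_apply, fourierMul_apply, inner_fourierInv_left, inner_fourierInv_right,
    inner_mulLp hm hr]

/-- The multipliers `m`, `m'` with `m² + m'² = 1` decompose the scalar product. -/
theorem inner_fourierMul_add {m m' : E → ℂ} (hm : MemLp m ⊤ volume) (hm' : MemLp m' ⊤ volume)
    (hr : ∀ x, (starRingEnd ℂ) (m x) = m x) (hr' : ∀ x, (starRingEnd ℂ) (m' x) = m' x)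
    (h : ∀ᵐ x, m x * m x + m' x * m' x = 1) (u v : Lp ℂ 2 (volume : Measure E)) :
    ⟪fourierMul hm u, fourierMul hm v⟫ + ⟪fourierMul hm' u, fourierMul hm' v⟫ = ⟪u, v⟫ := by
  rw [fourierMul_apply, fourierMul_apply, fourierMul_apply, fourierMul_apply,
    inner_fourierInv_left, inner_fourierInv_left, FourierTransform.fourier_fourierInv_eq,
    FourierTransform.fourier_fourierInv_eq, inner_mulLp hm hr, inner_mulLp hm' hr',
    ← inner_add_right, ← Lp.inner_fourier_eq u v]
  congr 1
  refine Lp.ext ?_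
  filter_upwards [Lp.coeFn_add (mulLp hm (mulLp hm (𝓕 v))) (mulLp hm' (mulLp hm' (𝓕 v))),
    coeFn_mulLp hm (mulLp hm (𝓕 v)), coeFn_mulLp hm (𝓕 v), coeFn_mulLp hm' (mulLp hm' (𝓕 v)),
    coeFn_mulLp hm' (𝓕 v), h] with x h1 h2 h3 h4 h5 h6
  rw [h1, Pi.add_apply, h2, h3, h4, h5, ← mul_assoc, ← mul_assoc, ← add_mul, h6, one_mul]

theorem integrable_mul_fourier {m : E → ℂ} (hm : MemLp m ⊤ volume) (g : 𝓢(E, ℂ)) :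
    Integrable fun ξ => m ξ * 𝓕 g ξ :=
  memLp_one_iff_integrable.1 (((𝓕 g).memLp 1 volume).mul hm)

/-- On test functions a Fourier multiplier is given by the integral. -/
theorem fourierMul_toLp_ae_eq {m : E → ℂ} (hm : MemLp m ⊤ volume) (g : 𝓢(E, ℂ)) :
    fourierMul hm (g.toLp 2) =ᵐ[volume] 𝓕⁻ fun ξ => m ξ * 𝓕 g ξ := by
  have h2 : MemLp (fun ξ => m ξ * 𝓕 g ξ) 2 volume := ((𝓕 g).memLp 2 volume).mul hm
  have h3 : mulLp hm (𝓕 (g.toLp 2)) = h2.toLp := by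
    rw [SchwartzMap.toLp_fourier_eq]
    refine Lp.ext ?_
    filter_upwards [coeFn_mulLp hm ((𝓕 g).toLp 2), (𝓕 g).coeFn_toLp 2 volume, h2.coeFn_toLp]
      with x h4 h5 h6
    rw [h4, h5, h6]
  rw [fourierMul_apply, h3]
  exact fourierInv_toLp_ae_eq h2 (integrable_mul_fourier hm g)

end Plancherel

/-! ### The kernels of the field -/

theorem inner_vecCoeff {α K : Type*} [MeasurableSpace α] {μ : Measure α} [NormedAddCommGroup K]
    [InnerProductSpace ℂ K] [CompleteSpace K] (w : K) (e : Lp ℂ 2 μ) {p : α → K}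
    (hi : Integrable (fun x => (starRingEnd ℂ) (e x) • p x) μ) :
    ⟪w, vecCoeff e p⟫ = ∫ x, (starRingEnd ℂ) (e x) * ⟪w, p x⟫ ∂μ := by
  rw [vecCoeff, ← integral_inner hi]
  simp only [inner_smul_right]

section Normalization

variable {d : ℕ}

theorem exp_I_inner (l x : Space d) (ξ : Space d) (h : l = (2 * Real.pi) • ξ) :
    Complex.exp (Complex.I * (inner ℝ l x : ℝ)) = (Real.fourierChar (inner ℝ ξ x) : ℂ) := by
  rw [Real.fourierChar_apply, h, real_inner_smul_left]
  congr 1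
  push_cast
  ring

theorem fourierTr_smul (f : Space d → ℂ) (ξ : Space d) :
    fourierTr f ((2 * Real.pi) • ξ) = (((2 * Real.pi) ^ (-(d : ℝ) / 2) : ℝ) : ℂ) * 𝓕 f ξ := by
  rw [fourierTr, Real.fourier_eq]
  congr 1
  refine integral_congr_ae (Filter.Eventually.of_forall fun x => ?_)
  have h := exp_I_inner ((2 * Real.pi) • (-ξ)) x (-ξ) rfl
  simp only [Circle.smul_def, smul_eq_mul]
  rw [inner_neg_left (𝕜 := ℝ) ξ x, smul_neg, inner_neg_left (𝕜 := ℝ), real_inner_comm,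
    real_inner_comm x ξ] at h
  rw [← h]
  simp

theorem fourierInvTr_eq (F : Space d → ℂ) (x : Space d) :
    fourierInvTr F x = (((2 * Real.pi) ^ (-(d : ℝ) / 2) : ℝ) : ℂ)⁻¹ *
      𝓕⁻ (fun ξ => F ((2 * Real.pi) • ξ)) x := by
  have hpi : (0 : ℝ) < 2 * Real.pi := by positivity
  have h := Measure.integral_comp_smul (volume : Measure (Space d))
    (fun l => Complex.exp (Complex.I * (inner ℝ l x : ℝ)) * F l) (2 * Real.pi)
  have h2 : 𝓕⁻ (fun ξ => F ((2 * Real.pi) • ξ)) x = ∫ ξ, (fun l => Complex.exp (Complex.I *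
      (inner ℝ l x : ℝ)) * F l) ((2 * Real.pi) • ξ) := by
    rw [Real.fourierInv_eq]
    refine integral_congr_ae (Filter.Eventually.of_forall fun ξ => ?_)
    simp only
    rw [exp_I_inner _ x ξ rfl, Circle.smul_def, smul_eq_mul]
  have hc : (2 * Real.pi) ^ (-(d : ℝ) / 2) * (2 * Real.pi) ^ (-(d : ℝ) / 2) =
      ((2 * Real.pi) ^ d)⁻¹ := by
    rw [← Real.rpow_add hpi, ← Real.rpow_natCast, ← Real.rpow_neg hpi.le]
    congr 1
    ring
  have hc0 : ((2 * Real.pi) ^ (-(d : ℝ) / 2) : ℝ) ≠ 0 := (Real.rpow_pos_of_pos hpi _).ne'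
  rw [h2, h, fourierInvTr, finrank_euclideanSpace_fin, abs_of_pos (by positivity), ← hc,
    Complex.real_smul, ← mul_assoc, Complex.ofReal_mul, ← mul_assoc, inv_mul_cancel₀, one_mul]
  exact_mod_cast hc0

end Normalization

namespace MomentumDensity

variable {d : ℕ} (k : MomentumDensity d)

theorem ae_mem_Icc : ∀ᵐ ξ : Space d,
    0 ≤ k.toFun ((2 * Real.pi) • ξ) ∧ k.toFun ((2 * Real.pi) • ξ) ≤ 1 := by
  have h2 : (2 * Real.pi) ≠ 0 := by positivity
  exact (Measure.quasiMeasurePreserving_smul (volume : Measure (Space d)) h2).ae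
    (k.nonneg.and k.le_one)

/-- The multiplier `k̂^{1/2}` in the variable `ξ = λ / 2π`. -/
def root (ξ : Space d) : ℂ := ((Real.sqrt (k.toFun ((2 * Real.pi) • ξ)) : ℝ) : ℂ)

/-- The multiplier `(1 - k̂)^{1/2}` in the variable `ξ = λ / 2π`. -/
def coroot (ξ : Space d) : ℂ := ((Real.sqrt (1 - k.toFun ((2 * Real.pi) • ξ)) : ℝ) : ℂ)

theorem conj_root (ξ : Space d) : (starRingEnd ℂ) (k.root ξ) = k.root ξ := Complex.conj_ofReal _

theorem conj_coroot (ξ : Space d) : (starRingEnd ℂ) (k.coroot ξ) = k.coroot ξ :=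
  Complex.conj_ofReal _

theorem memLp_root : MemLp k.root ⊤ volume := by
  refine memLp_top_of_bound k.memLp_sqrt.aestronglyMeasurable 1 ?_
  filter_upwards [k.ae_mem_Icc] with ξ hξ
  rw [root, Complex.norm_real, Real.norm_of_nonneg (Real.sqrt_nonneg _)]
  exact Real.sqrt_le_one.2 hξ.2

theorem memLp_coroot : MemLp k.coroot ⊤ volume := by
  have h2 : (2 * Real.pi) ≠ 0 := by positivity
  have hi : Integrable (fun ξ : Space d => k.toFun ((2 * Real.pi) • ξ)) :=
    k.integrable.comp_smul h2
  refine memLp_top_of_bound ((Complex.continuous_ofReal.comp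
    Real.continuous_sqrt).comp_aestronglyMeasurable
      (aestronglyMeasurable_const.sub hi.aestronglyMeasurable)) 1 ?_
  filter_upwards [k.ae_mem_Icc] with ξ hξ
  rw [coroot, Complex.norm_real, Real.norm_of_nonneg (Real.sqrt_nonneg _)]
  exact Real.sqrt_le_one.2 (by linarith [hξ.1])

theorem coroot_mul_self_add : ∀ᵐ ξ, k.coroot ξ * k.coroot ξ + k.root ξ * k.root ξ = 1 := by
  filter_upwards [k.ae_mem_Icc] with ξ hξ
  rw [root, coroot, ← Complex.ofReal_mul, ← Complex.ofReal_mul, ← Complex.ofReal_add,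
    Real.mul_self_sqrt hξ.1, Real.mul_self_sqrt (by linarith [hξ.2])]
  simp

/-- `ϰ_{2,x}` in the normalization `e^{2πiξ·x}` of the Fourier transform, with `λ = 2πξ`. -/
theorem kappa₂Pairing_eq (x : Space d) (g : 𝓢(Space d, ℂ)) :
    k.kappa₂Pairing x g = 𝓕⁻ (fun ξ => k.coroot ξ * 𝓕 g ξ) x := by
  have hpi : (0 : ℝ) < 2 * Real.pi := by positivity
  have hc0 : (((2 * Real.pi) ^ (-(d : ℝ) / 2) : ℝ) : ℂ) ≠ 0 := by
    exact_mod_cast (Real.rpow_pos_of_pos hpi _).ne'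
  rw [kappa₂Pairing, fourierInvTr_eq, Real.fourierInv_eq, Real.fourierInv_eq,
    ← integral_const_mul]
  refine integral_congr_ae (Filter.Eventually.of_forall fun ξ => ?_)
  simp only
  rw [fourierTr_smul, Circle.smul_def, Circle.smul_def, smul_eq_mul, smul_eq_mul, coroot,
    SchwartzMap.fourier_coe]
  set c := (((2 * Real.pi) ^ (-(d : ℝ) / 2) : ℝ) : ℂ)
  rw [mul_left_comm _ c, mul_left_comm _ c, inv_mul_cancel_left₀ hc0]

theorem kappa_eq (x : Space d) :
    k.kappa x = 𝓕⁻ (fun ξ => (k.toFun ((2 * Real.pi) • ξ) : ℂ)) x := by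
  have hpi : (0 : ℝ) < 2 * Real.pi := by positivity
  have hc0 : (((2 * Real.pi) ^ (-(d : ℝ) / 2) : ℝ) : ℂ) ≠ 0 := by
    exact_mod_cast (Real.rpow_pos_of_pos hpi _).ne'
  rw [kappa, fourierInvTr_eq, mul_inv_cancel_left₀ hc0]

theorem memLp_char (x : Space d) :
    MemLp (fun ξ : Space d => (Real.fourierChar (-inner ℝ x ξ) : ℂ)) ⊤ volume :=
  memLp_top_of_bound (Continuous.aestronglyMeasurable (by fun_prop)) 1
    (Filter.Eventually.of_forall fun ξ => (Circle.norm_coe _).le)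

/-- `ϰ_{1,x}` is the inverse Fourier transform of `e^{-iλ·x} k̂(λ)^{1/2}`. -/
theorem conjKappa₁_eq (x : Space d) :
    k.conjKappa₁ x = star (𝓕⁻ (mulLp (memLp_char x) k.memLp_sqrt.toLp)) := by
  rw [conjKappa₁,
    ← FourierTransform.fourierInv_fourier_eq (E := Lp ℂ 2 (volume : Measure (Space d)))
    (F := Lp ℂ 2 (volume : Measure (Space d))) (Lp.compMeasurePreserving _ _ k.kappa₁),
    fourier_compMeasurePreserving_sub x k.kappa₁ (memLp_char x), kappa₁,
    FourierTransform.fourier_fourierInv_eq]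

/-- The complex conjugation of `ϰ_{1,x}` exchanges the arguments: `(ϰ̄_{1,x}, ϰ̄_{1,y}) = ϰ(y - x)`. -/
theorem inner_conjKappa₁ (x y : Space d) : ⟪k.conjKappa₁ x, k.conjKappa₁ y⟫ = k.kappa (y - x) := by
  rw [conjKappa₁_eq, conjKappa₁_eq, inner_star_star, inner_fourierInv_left,
    FourierTransform.fourier_fourierInv_eq, L2.inner_def, kappa_eq, Real.fourierInv_eq]
  refine integral_congr_ae ?_
  filter_upwards [coeFn_mulLp (memLp_char x) k.memLp_sqrt.toLp,
    coeFn_mulLp (memLp_char y) k.memLp_sqrt.toLp, k.memLp_sqrt.coeFn_toLp, k.ae_mem_Icc]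
    with ξ h1 h2 h3 h4
  rw [h1, h2, h3, RCLike.inner_apply, map_mul, Complex.conj_ofReal, Circle.smul_def, smul_eq_mul,
    inner_sub_right, sub_eq_add_neg, AddChar.map_add_eq_mul, Circle.coe_mul,
    ← Circle.coe_inv_eq_conj, ← AddChar.map_neg_eq_inv, neg_neg, real_inner_comm y ξ,
    real_inner_comm x ξ]
  have h5 : (k.toFun ((2 * Real.pi) • ξ) : ℂ) = ((Real.sqrt (k.toFun ((2 * Real.pi) • ξ)) : ℝ) : ℂ)
      * ((Real.sqrt (k.toFun ((2 * Real.pi) • ξ)) : ℝ) : ℂ) := by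
    rw [← Complex.ofReal_mul, Real.mul_self_sqrt h4.1]
  rw [h5]
  ring

/-- The pairing of a test function with `ϰ_{1,x}`, in the form `⟨ḡ, ϰ̄_{1,x}⟩`. -/
theorem inner_star_conjKappa₁ (x : Space d) (g : 𝓢(Space d, ℂ)) :
    ⟪star (g.toLp 2 : Lp ℂ 2 (volume : Measure (Space d))), k.conjKappa₁ x⟫ =
      𝓕⁻ (fun ξ => k.root ξ * 𝓕 g ξ) x := by
  rw [conjKappa₁_eq, inner_star_star, inner_fourierInv_left, SchwartzMap.toLp_fourier_eq,
    L2.inner_def, Real.fourierInv_eq]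
  refine integral_congr_ae ?_
  filter_upwards [coeFn_mulLp (memLp_char x) k.memLp_sqrt.toLp, k.memLp_sqrt.coeFn_toLp,
    (𝓕 g).coeFn_toLp 2 volume] with ξ h1 h2 h3
  rw [h1, h2, h3, RCLike.inner_apply, map_mul, Complex.conj_ofReal, Circle.smul_def, smul_eq_mul,
    ← Circle.coe_inv_eq_conj, ← AddChar.map_neg_eq_inv, neg_neg, real_inner_comm, root]
  ring

theorem norm_conjKappa₁ (x : Space d) : ‖k.conjKappa₁ x‖ = ‖k.kappa₁‖ := by
  rw [conjKappa₁, norm_star_Lp, Lp.norm_compMeasurePreserving]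

theorem continuous_conjKappa₁ : Continuous k.conjKappa₁ := by
  have h : Continuous fun x : Space d => (⟨fun y => y - x, by fun_prop⟩ : C(Space d, Space d)) :=
    ContinuousMap.continuous_of_continuous_uncurry _ (continuous_snd.sub continuous_fst)
  have h2 : Continuous fun x : Space d => Lp.compMeasurePreserving (fun y => y - x)
      (measurePreserving_sub_right volume x) k.kappa₁ :=
    Continuous.compMeasurePreservingLp (p := 2) (μ := volume) (ν := volume)
      (continuous_const (y := k.kappa₁)) h (fun x => measurePreserving_sub_right volume x)
      ENNReal.ofNat_ne_top
  exact conjLp.continuous.comp h2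

/-- For integrable `u ∈ L²`, the conjugate of `𝓕⁻¹ k̂^{1/2} 𝓕 u` is `∫ \bar{u(x)} ϰ̄_{1,x} dx`. -/
theorem star_fourierMul_root (u : Lp ℂ 2 (volume : Measure (Space d))) (hu : Integrable u) :
    star (fourierMul k.memLp_root u) = vecCoeff u k.conjKappa₁ := by
  have hi : Integrable (fun x => (starRingEnd ℂ) (u x) • k.conjKappa₁ x) := by
    have hu_star : Integrable fun x => (starRingEnd ℂ) (u x) :=
      memLp_one_iff_integrable.1 (memLp_one_iff_integrable.2 hu).star
    exact Integrable.smul_bdd (φ := fun x => (starRingEnd ℂ) (u x)) hu_star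
      ‖k.kappa₁‖ k.continuous_conjKappa₁.aestronglyMeasurable (Filter.Eventually.of_forall fun x => (k.norm_conjKappa₁ x).le)
  have hd : DenseRange fun g : 𝓢(Space d, ℂ) =>
      star (g.toLp 2 : Lp ℂ 2 (volume : Measure (Space d))) :=
    (Function.Surjective.denseRange (f := (star : _ → Lp ℂ 2 (volume : Measure (Space d))))
      fun u => ⟨star u, star_star u⟩).comp
      (SchwartzMap.denseRange_toLpCLM (p := 2) (μ := (volume : Measure (Space d))) (F := ℂ)
        ENNReal.ofNat_ne_top) conjLp.continuous
  refine hd.eq_of_inner_right ℂ fun g => ?_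
  rw [inner_vecCoeff _ _ hi, inner_star_star, inner_fourierMul _ k.conj_root, L2.inner_def]
  refine integral_congr_ae ?_
  filter_upwards [fourierMul_toLp_ae_eq k.memLp_root g] with x hx
  rw [hx, inner_star_conjKappa₁, RCLike.inner_apply, mul_comm]

end MomentumDensity

/-! ### Test vectors and weights -/

section Pair

variable {d : ℕ}

theorem coeFn_pair (f g : Lp ℂ 2 (volume : Measure (Space d))) :
    pair f g =ᵐ[twoCopies d] fun p => if p.1 = 0 then f p.2 else g p.2 :=
  (memLp_pair f g).coeFn_toLp

theorem inner_pair (f g f' g' : Lp ℂ 2 (volume : Measure (Space d))) :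
    ⟪pair f g, pair f' g'⟫ = ⟪f, f'⟫ + ⟪g, g'⟫ := by
  rw [L2.inner_def, integral_congr_ae (g := fun p : Fin 2 × Space d =>
    ⟪(if p.1 = 0 then f p.2 else g p.2 : ℂ), (if p.1 = 0 then f' p.2 else g' p.2 : ℂ)⟫)]
  · rw [integral_prod]
    · rw [integral_fintype Integrable.of_finite, Fin.sum_univ_two]
      simp [L2.inner_def]
    · exact integrable_inner_of_memLp (memLp_pair f g) (memLp_pair f' g')
  · filter_upwards [coeFn_pair f g, coeFn_pair f' g'] with p h1 h2
    rw [h1, h2]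

theorem ae_snd {P : Space d → Prop} (h : ∀ᵐ x, P x) : ∀ᵐ p ∂(twoCopies d), P p.2 :=
  Measure.quasiMeasurePreserving_snd.ae h

theorem pair_add (f g f' g' : Lp ℂ 2 (volume : Measure (Space d))) :
    pair (f + f') (g + g') = pair f g + pair f' g' := by
  refine Lp.ext ?_
  filter_upwards [coeFn_pair (f + f') (g + g'), coeFn_pair f g, coeFn_pair f' g',
    Lp.coeFn_add (pair f g) (pair f' g'), ae_snd (Lp.coeFn_add f f'), ae_snd (Lp.coeFn_add g g')]
    with p h1 h2 h3 h4 h5 h6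
  rw [h1, h4, Pi.add_apply, h2, h3, h5, h6]
  split_ifs <;> rfl

theorem pair_smul (c : ℂ) (f g : Lp ℂ 2 (volume : Measure (Space d))) :
    pair (c • f) (c • g) = c • pair f g := by
  refine Lp.ext ?_
  filter_upwards [coeFn_pair (c • f) (c • g), coeFn_pair f g,
    Lp.coeFn_smul c (pair f g), ae_snd (Lp.coeFn_smul c f), ae_snd (Lp.coeFn_smul c g)]
    with p h1 h2 h3 h4 h5
  rw [h1, h3, Pi.smul_apply, h2, h4, h5]
  split_ifs <;> rfl

theorem norm_sq_pair (f g : Lp ℂ 2 (volume : Measure (Space d))) :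
    ‖pair f g‖ ^ 2 = ‖f‖ ^ 2 + ‖g‖ ^ 2 := by
  have h := inner_pair f g f g
  simp only [inner_self_eq_norm_sq_to_K] at h
  exact_mod_cast h

theorem norm_pair_zero (f : Lp ℂ 2 (volume : Measure (Space d))) : ‖pair f 0‖ = ‖f‖ := by
  refine (sq_eq_sq₀ (norm_nonneg _) (norm_nonneg _)).1 ?_
  simp [norm_sq_pair]

theorem norm_zero_pair (g : Lp ℂ 2 (volume : Measure (Space d))) : ‖pair 0 g‖ = ‖g‖ := by
  refine (sq_eq_sq₀ (norm_nonneg _) (norm_nonneg _)).1 ?_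
  simp [norm_sq_pair]

/-- The inclusion of the first summand of `L² ⊕ L²`. -/
def inl : Lp ℂ 2 (volume : Measure (Space d)) →L[ℂ] Lp ℂ 2 (twoCopies d) :=
  LinearMap.mkContinuous
    { toFun := fun u => pair u 0
      map_add' := fun u v => by rw [← pair_add, add_zero]
      map_smul' := fun c u => by rw [RingHom.id_apply, ← pair_smul, smul_zero] } 1 fun u => by
    rw [one_mul]
    exact (norm_pair_zero u).le

/-- The inclusion of the second summand of `L² ⊕ L²`. -/
def inr : Lp ℂ 2 (volume : Measure (Space d)) →L[ℂ] Lp ℂ 2 (twoCopies d) :=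
  LinearMap.mkContinuous
    { toFun := fun u => pair 0 u
      map_add' := fun u v => by rw [← pair_add, add_zero]
      map_smul' := fun c u => by rw [RingHom.id_apply, ← pair_smul, smul_zero] } 1 fun u => by
    rw [one_mul]
    exact (norm_zero_pair u).le

theorem inl_apply (u : Lp ℂ 2 (volume : Measure (Space d))) : inl u = pair u 0 := rfl

theorem inr_apply (u : Lp ℂ 2 (volume : Measure (Space d))) : inr u = pair 0 u := rfl

theorem pair_eq_inl_add_inr (f g : Lp ℂ 2 (volume : Measure (Space d))) :
    pair f g = inl f + inr g := by
  rw [inl_apply, inr_apply, ← pair_add, add_zero, zero_add]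

theorem exists_pair_eq (w : Lp ℂ 2 (twoCopies d)) : ∃ f g, pair f g = w := by
  have hwm : Measurable w := (Lp.stronglyMeasurable w).measurable
  have hi := (memLp_two_iff_integrable_sq_norm (Lp.aestronglyMeasurable w)).1 (Lp.memLp w)
  have h1 := hi.prod_right_ae
  rw [Measure.ae_count_iff] at h1
  have h2 : ∀ i, MemLp (fun x => w (i, x)) 2 volume := fun i =>
    (memLp_two_iff_integrable_sq_norm
      (hwm.comp measurable_prodMk_left).aestronglyMeasurable).2 (h1 i)
  refine ⟨(h2 0).toLp, (h2 1).toLp, Lp.ext ((coeFn_pair _ _).trans ?_)⟩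
  have h3 := ae_snd (h2 0).coeFn_toLp
  have h4 := ae_snd (h2 1).coeFn_toLp
  filter_upwards [h3, h4] with p h5 h6
  obtain ⟨i, x⟩ := p
  simp only at h5 h6 ⊢
  rw [h5, h6]
  fin_cases i <;> simp

theorem continuous_pair : Continuous fun p : Lp ℂ 2 (volume : Measure (Space d)) ×
    Lp ℂ 2 (volume : Measure (Space d)) => pair p.1 p.2 := by
  simp only [pair_eq_inl_add_inr]
  exact (inl.continuous.comp continuous_fst).add (inr.continuous.comp continuous_snd)

theorem surjective_pair : Function.Surjective fun p : Lp ℂ 2 (volume : Measure (Space d)) ×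
    Lp ℂ 2 (volume : Measure (Space d)) => pair p.1 p.2 := fun w => by
  obtain ⟨f, g, h⟩ := exists_pair_eq w
  exact ⟨(f, g), h⟩

theorem denseRange_toLp : DenseRange fun g : 𝓢(Space d, ℂ) =>
    (g.toLp 2 : Lp ℂ 2 (volume : Measure (Space d))) :=
  SchwartzMap.denseRange_toLpCLM ENNReal.ofNat_ne_top

theorem dense_range_toL2 : Dense (Set.range fun φ : TestVector d => φ.toL2) := by
  have h := surjective_pair.denseRange.dense_image (continuous_pair (d := d))
    (denseRange_toLp (d := d).prod (denseRange_toLp (d := d)))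
  refine h.mono ?_
  rintro _ ⟨⟨_, _⟩, ⟨⟨g, rfl⟩, ⟨g', rfl⟩⟩, rfl⟩
  exact ⟨(g, g'), rfl⟩

end Pair

section Decaying

variable {d : ℕ}

/-- A fixed integrable weight. -/
def bracket (x : Space d) : ℝ := ((1 + ‖x‖) ^ (d + 1))⁻¹

/-- Continuous functions that are dominated by the weight `bracket`. -/
structure Decaying (b : Space d → ℝ) : Prop where
  continuous : Continuous b
  bound : ∃ C, ∀ x, |b x| ≤ C * bracket x

theorem bracket_pos (x : Space d) : 0 < bracket x := by unfold bracket; positivity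

theorem bracket_le_one (x : Space d) : bracket x ≤ 1 :=
  inv_le_one_of_one_le₀ (one_le_pow₀ (by linarith [norm_nonneg x]))

theorem decaying_bracket : Decaying (bracket (d := d)) where
  continuous := by
    unfold bracket
    exact Continuous.inv₀ (by fun_prop) fun x => by positivity
  bound := ⟨1, fun x => by rw [abs_of_pos (bracket_pos x), one_mul]⟩

theorem integrable_bracket : Integrable (bracket (d := d)) := by
  have h := integrable_one_add_norm (μ := (volume : Measure (Space d))) (r := (d + 1 : ℝ)) (by simp)
  refine h.congr (Filter.Eventually.of_forall fun x => ?_)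
  simp only [bracket]
  rw [Real.rpow_neg (by positivity)]
  norm_cast

theorem decaying_div_bracket (f : 𝓢(Space d, ℝ)) : Decaying fun x => f x * (bracket x)⁻¹ where
  continuous := f.continuous.mul (decaying_bracket.continuous.inv₀ fun x => (bracket_pos x).ne')
  bound := by
    refine ⟨2 ^ (2 * (d + 1)) * (Finset.Iic ((2 * (d + 1), 0) : ℕ × ℕ)).sup
      (fun m => SchwartzMap.seminorm ℝ m.1 m.2) f, fun x => ?_⟩
    have h := SchwartzMap.one_add_le_sup_seminorm_apply (𝕜 := ℝ) (m := (2 * (d + 1), 0))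
      (k := 2 * (d + 1)) (n := 0) le_rfl le_rfl f x
    rw [norm_iteratedFDeriv_zero, Real.norm_eq_abs] at h
    have hp : (0 : ℝ) < (1 + ‖x‖) ^ (d + 1) := by positivity
    rw [abs_mul, bracket, inv_inv, abs_of_pos hp, ← div_eq_mul_inv, le_div_iff₀ hp]
    refine le_trans (le_of_eq ?_) h
    ring

theorem decaying_schwartz (f : 𝓢(Space d, ℝ)) : Decaying f where
  continuous := f.continuous
  bound := by
    obtain ⟨C, hC⟩ := (decaying_div_bracket f).bound
    refine ⟨C, fun x => le_trans ?_ (hC x)⟩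
    rw [abs_mul, abs_of_pos (inv_pos.2 (bracket_pos x))]
    exact le_mul_of_one_le_right (abs_nonneg _) ((one_le_inv₀ (bracket_pos x)).2 (bracket_le_one x))

namespace Decaying

variable {b : Space d → ℝ}

theorem memLp_top (hb : Decaying b) : MemLp (fun x => (b x : ℂ)) ⊤ volume := by
  obtain ⟨C, hC⟩ := hb.bound
  have hC0 : 0 ≤ C := by
    by_contra! h
    have h1 := (abs_nonneg _).trans (hC 0)
    have h2 := bracket_pos (0 : Space d)
    nlinarith
  refine memLp_top_of_bound (Complex.continuous_ofReal.comp hb.continuous).aestronglyMeasurable C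
    (Filter.Eventually.of_forall fun x => ?_)
  rw [Complex.norm_real, Real.norm_eq_abs]
  exact (hC x).trans (mul_le_of_le_one_right hC0 (bracket_le_one x))

theorem integrable (hb : Decaying b) : Integrable b := by
  obtain ⟨C, hC⟩ := hb.bound
  exact (integrable_bracket.const_mul C).mono' hb.continuous.aestronglyMeasurable
    (Filter.Eventually.of_forall hC)

theorem memLp_two (hb : Decaying b) : MemLp (fun x => (b x : ℂ)) 2 volume := by
  have h1 := hb.integrable.ofReal (𝕜 := ℂ)
  rw [memLp_two_iff_integrable_sq_norm hb.memLp_top.aestronglyMeasurable]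
  have h2 : MemLp (fun x => ‖(b x : ℂ)‖) ⊤ volume := hb.memLp_top.norm
  have h3 := memLp_one_iff_integrable.1 (h2.mul (p := 1) (q := ⊤) (r := 1)
    (memLp_one_iff_integrable.2 h1.norm))
  refine h3.congr (Filter.Eventually.of_forall fun x => ?_)
  simp [pow_two]

theorem memLp_smul (hb : Decaying b) {K : Type*} [NormedAddCommGroup K] [InnerProductSpace ℂ K]
    {p : Space d → K} (hp : Continuous p) (hC : ∃ C, ∀ x, ‖p x‖ ≤ C) :
    MemLp (fun x => (b x : ℂ) • p x) 2 volume := by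
  obtain ⟨C, hC⟩ := hC
  exact MemLp.smul (p := 2) (q := ⊤) (r := 2) (memLp_top_of_bound hp.aestronglyMeasurable C
    (Filter.Eventually.of_forall hC)) hb.memLp_two

theorem integrable_mulLp (hb : Decaying b) (u : Lp ℂ 2 (volume : Measure (Space d))) :
    Integrable (mulLp hb.memLp_top u) := by
  refine Integrable.congr ?_ (coeFn_mulLp hb.memLp_top u).symm
  exact memLp_one_iff_integrable.1 ((Lp.memLp u).mul (p := 2) (q := 2) (r := 1) hb.memLp_two)

theorem vecCoeff_mulLp (hb : Decaying b) {K : Type*} [NormedAddCommGroup K] [InnerProductSpace ℂ K]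
    (u : Lp ℂ 2 (volume : Measure (Space d))) (p : Space d → K) :
    vecCoeff (mulLp hb.memLp_top u) p = vecCoeff u fun x => (b x : ℂ) • p x := by
  refine integral_congr_ae ?_
  filter_upwards [coeFn_mulLp hb.memLp_top u] with x hx
  rw [hx, map_mul, Complex.conj_ofReal, smul_smul, mul_comm]

end Decaying

end Decaying

theorem vecCoeff_map {α K K' : Type*} [MeasurableSpace α] {μ : Measure α} [NormedAddCommGroup K]
    [InnerProductSpace ℂ K] [CompleteSpace K] [NormedAddCommGroup K']
    [InnerProductSpace ℂ K'] [CompleteSpace K'] (A : K →L[ℂ] K') (e : Lp ℂ 2 μ) {p : α → K}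
    (hp : MemLp p 2 μ) : vecCoeff e (fun x => A (p x)) = A (vecCoeff e p) := by
  rw [vecCoeff, vecCoeff, ← A.integral_comp_comm (integrable_conj_smul e hp)]
  simp only [map_smul]

/-! ### The particle density -/

section CreationMap

variable {X : Type*} [MeasurableSpace X] {ν : Measure X} [SigmaFinite ν]

/-- The map `w ↦ T a*(w) G` into the complete Fock space. -/
def creationMap {T : Module.End ℂ (FockFin ν)} (hT : FinContinuous T) (G : FockFin ν) :
    Lp ℂ 2 ν →L[ℂ] Fock ν :=
  LinearMap.mkContinuousOfExistsBound
    { toFun := fun w => (T (creation w G) : Fock ν)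
      map_add' := fun w w' => by rw [creation_add, LinearMap.add_apply, map_add]; rfl
      map_smul' := fun c w => by rw [creation_smul, LinearMap.smul_apply, map_smul]; rfl } <| by
    obtain ⟨N, hN⟩ := FockFin.exists_mem_below G
    obtain ⟨C, hC, hb⟩ := hT.exists_bound (N + 1)
    refine ⟨C * ‖G‖, fun w => ?_⟩
    have h := hb _ (creation_mem_below w hN)
    refine h.trans ?_
    rw [mul_assoc, mul_comm ‖G‖]
    exact mul_le_mul_of_nonneg_left (norm_creation_le w G) hC

theorem creationMap_apply {T : Module.End ℂ (FockFin ν)} (hT : FinContinuous T) (G : FockFin ν)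
    (w : Lp ℂ 2 ν) : creationMap hT G w = (T (creation w G) : Fock ν) := rfl

/-- The annihilation operator on a wedge product as a linear function of the pairings. -/
def annihilateMap {n : ℕ} (h : Fin n → Lp ℂ 2 ν) : EuclideanSpace ℂ (Fin n) →L[ℂ] Fock ν :=
  LinearMap.toContinuousLinearMap
    { toFun := fun c => (annihilate c h : Fock ν)
      map_add' := fun c c' => by
        cases n with
        | zero => simp [annihilate]
        | succ n =>
          simp only [annihilate]
          rw [← Submodule.coe_add, ← smul_add, ← Finset.sum_add_distrib]
          simp only [PiLp.add_apply, mul_add, add_smul]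
      map_smul' := fun a c => by
        cases n with
        | zero => simp [annihilate]
        | succ n =>
          simp only [annihilate]
          rw [RingHom.id_apply, ← Submodule.coe_smul]
          refine congrArg Subtype.val ?_
          simp only [PiLp.smul_apply, smul_eq_mul, Finset.smul_sum, smul_smul]
          refine Finset.sum_congr rfl fun i _ => ?_
          congr 1
          ring }

theorem annihilateMap_apply {n : ℕ} (h : Fin n → Lp ℂ 2 ν) (c : EuclideanSpace ℂ (Fin n)) :
    annihilateMap h c = (annihilate c h : Fock ν) := rfl

end CreationMap

section

variable {α K K' L : Type*} [MeasurableSpace α] {μ : Measure α} [NormedAddCommGroup K]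
  [InnerProductSpace ℂ K] [NormedAddCommGroup K'] [InnerProductSpace ℂ K']
  [NormedAddCommGroup L] [InnerProductSpace ℂ L]

theorem memLp_map_add (A : K →L[ℂ] L) (B : K' →L[ℂ] L) {p : α → K} {q : α → K'}
    (hp : MemLp p 2 μ) (hq : MemLp q 2 μ) : MemLp (fun x => A (p x) + B (q x)) 2 μ :=
  (A.comp_memLp' hp).add (B.comp_memLp' hq)

theorem vecCoeff_map_add [CompleteSpace K] [CompleteSpace K'] [CompleteSpace L]
    (A : K →L[ℂ] L) (B : K' →L[ℂ] L) (e : Lp ℂ 2 μ) {p : α → K} {q : α → K'}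
    (hp : MemLp p 2 μ) (hq : MemLp q 2 μ) :
    vecCoeff e (fun x => A (p x) + B (q x)) = A (vecCoeff e p) + B (vecCoeff e q) := by
  rw [← vecCoeff_map A e hp, ← vecCoeff_map B e hq, vecCoeff, vecCoeff, vecCoeff]
  simp only [smul_add]
  exact integral_add (integrable_conj_smul e (A.comp_memLp' hp))
    (integrable_conj_smul e (B.comp_memLp' hq))

end

namespace MomentumDensity

variable {d : ℕ} (k : MomentumDensity d)

/-- The index set of an orthonormal basis of `L²(ℝᵈ)`. -/
abbrev BasisIndex (d : ℕ) : Type :=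
  (exists_hilbertBasis ℂ (Lp ℂ 2 (volume : Measure (Space d)))).choose

/-- An orthonormal basis of `L²(ℝᵈ)`. -/
def hilbertBasis (d : ℕ) : HilbertBasis (BasisIndex d) ℂ (Lp ℂ 2 (volume : Measure (Space d))) :=
  (exists_hilbertBasis ℂ (Lp ℂ 2 (volume : Measure (Space d)))).choose_spec.choose

/-- The operator `u ↦ (0, K₂ u)`. -/
def fieldJ : Lp ℂ 2 (volume : Measure (Space d)) →L[ℂ] Lp ℂ 2 (twoCopies d) :=
  inr ∘L fourierMul k.memLp_coroot

/-- The operator `u ↦ (\bar{K₁ u}, 0)`. -/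
def fieldC : Lp ℂ 2 (volume : Measure (Space d)) →SL[starRingEnd ℂ] Lp ℂ 2 (twoCopies d) :=
  inl.comp (conjLp.comp (fourierMul k.memLp_root))

theorem fieldJ_apply (u : Lp ℂ 2 (volume : Measure (Space d))) :
    k.fieldJ u = pair 0 (fourierMul k.memLp_coroot u) := rfl

theorem fieldC_apply (u : Lp ℂ 2 (volume : Measure (Space d))) :
    k.fieldC u = pair (star (fourierMul k.memLp_root u)) 0 := rfl

theorem memLp_smul_conjKappa₁ {b : Space d → ℝ} (hb : Decaying b) :
    MemLp (fun x => (b x : ℂ) • k.conjKappa₁ x) 2 volume :=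
  hb.memLp_smul k.continuous_conjKappa₁ ⟨_, fun x => (k.norm_conjKappa₁ x).le⟩

theorem fieldC_mulLp {b : Space d → ℝ} (hb : Decaying b)
    (u : Lp ℂ 2 (volume : Measure (Space d))) :
    k.fieldC (mulLp hb.memLp_top u) =
      inl (vecCoeff u fun x => (b x : ℂ) • k.conjKappa₁ x) := by
  rw [fieldC_apply, star_fourierMul_root _ _ (hb.integrable_mulLp u), hb.vecCoeff_mulLp]
  rfl

theorem summable_fieldC_mulLp {b : Space d → ℝ} (hb : Decaying b) :
    Summable fun i => ‖k.fieldC (mulLp hb.memLp_top (hilbertBasis d i))‖ ^ 2 := by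
  refine (hasSum_norm_sq_vecCoeff (hilbertBasis d) (k.memLp_smul_conjKappa₁ hb)).summable.congr
    fun i => ?_
  rw [k.fieldC_mulLp hb, inl_apply, norm_pair_zero]

/-- The smeared field of the Fermi gas. -/
def fieldData : FieldData d (BasisIndex d) (Lp ℂ 2 (volume : Measure (Space d))) (twoCopies d) where
  basis := hilbertBasis d
  J := k.fieldJ
  C := k.fieldC
  inner_J_add_inner_C u v := by
    rw [fieldJ_apply, fieldJ_apply, fieldC_apply, fieldC_apply, inner_pair, inner_pair,
      inner_zero_left, zero_add, add_zero, inner_star_star]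
    exact inner_fourierMul_add k.memLp_coroot k.memLp_root k.conj_coroot k.conj_root
      k.coroot_mul_self_add u v
  inner_J_C u v := by
    rw [fieldJ_apply, fieldC_apply, inner_pair, inner_zero_left, inner_zero_right, add_zero]
  mul f := mulLp (decaying_schwartz f).memLp_top
  quot f := mulLp (decaying_div_bracket f).memLp_top
  weight := mulLp decaying_bracket.memLp_top
  quot_weight f u := mulLp_mulLp _ _ _ (fun x => by
    have := (bracket_pos x).ne'
    rw [← Complex.ofReal_mul, inv_mul_cancel_right₀ this]) u
  mul_quot f g u := by
    refine mulLp_mulLp _ _ _ (fun x => ?_) u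
    simp only [mulTest, pairing_apply_apply, ContinuousLinearMap.mul_apply']
    push_cast
    ring
  inner_weight u v := inner_mulLp _ (fun x => Complex.conj_ofReal _) u v
  summable_weight := k.summable_fieldC_mulLp decaying_bracket
  summable_quot f := k.summable_fieldC_mulLp (decaying_div_bracket f)

theorem continuous_kappa₂Pairing (g : 𝓢(Space d, ℂ)) : Continuous fun x => k.kappa₂Pairing x g := by
  simp only [kappa₂Pairing_eq]
  exact continuous_fourierInv (integrable_mul_fourier k.memLp_coroot g)

theorem exists_norm_kappa₂Pairing_le (g : 𝓢(Space d, ℂ)) : ∃ C, ∀ x, ‖k.kappa₂Pairing x g‖ ≤ C :=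
  ⟨_, fun x => by rw [kappa₂Pairing_eq]; exact norm_fourierInv_le _ x⟩

/-- The pairings of `ϰ_{2,x}` with the second components of test vectors. -/
def pairings (x : Space d) {n : ℕ} (φ : Fin n → TestVector d) : EuclideanSpace ℂ (Fin n) :=
  WithLp.toLp 2 fun i => k.kappa₂Pairing x (φ i).2

/-- `ψ(x)` on a wedge product depends linearly on the `L²` vector `ϰ̄_{1,x}` and on the finitely many
pairings with `ϰ_{2,x}`, so that it can be integrated over `x`. -/
theorem psi_eq (x : Space d) {n : ℕ} (φ : Fin n → TestVector d) :
    (k.psi x φ : Fock (twoCopies d)) = annihilateMap (fun i => (φ i).toL2) (k.pairings x φ) +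
      creationMap FinContinuous.one (wedge fun i => (φ i).toL2) (inl (k.conjKappa₁ x)) := by
  rw [creationMap_apply, annihilateMap_apply, Module.End.one_apply, creation_wedge]
  rfl

theorem memLp_smul_pairings {b : Space d → ℝ} (hb : Decaying b) {n : ℕ} (φ : Fin n → TestVector d) :
    MemLp (fun x => (b x : ℂ) • k.pairings x φ) 2 volume := by
  choose C hC using fun i => k.exists_norm_kappa₂Pairing_le (φ i).2
  refine hb.memLp_smul ((PiLp.continuous_toLp 2 _).comp
    (continuous_pi fun i => k.continuous_kappa₂Pairing (φ i).2))
    ⟨Real.sqrt (∑ i, C i ^ 2), fun x => ?_⟩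
  rw [EuclideanSpace.norm_eq]
  exact Real.sqrt_le_sqrt (Finset.sum_le_sum fun i _ =>
    pow_le_pow_left₀ (norm_nonneg _) (hC i x) 2)

theorem vecCoeff_smul_pairings {b : Space d → ℝ} (hb : Decaying b) {n : ℕ}
    (φ : Fin n → TestVector d) (u : Lp ℂ 2 (volume : Measure (Space d))) (i : Fin n) :
    vecCoeff u (fun x => (b x : ℂ) • k.pairings x φ) i =
      ⟪k.fieldJ (mulLp hb.memLp_top u), (φ i).toL2⟫ := by
  have h := vecCoeff_map (EuclideanSpace.proj (𝕜 := ℂ) i) u (k.memLp_smul_pairings hb φ)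
  refine h.symm.trans ?_
  rw [fieldJ_apply, TestVector.toL2, inner_pair, inner_zero_left, zero_add,
    inner_fourierMul _ k.conj_coroot, L2.inner_def]
  refine integral_congr_ae ?_
  filter_upwards [coeFn_mulLp hb.memLp_top u, fourierMul_toLp_ae_eq k.memLp_coroot (φ i).2]
    with x h1 h2
  rw [h1, h2, ← kappa₂Pairing_eq, RCLike.inner_apply, map_mul, Complex.conj_ofReal]
  change (starRingEnd ℂ) (u x) * ((b x : ℂ) * k.kappa₂Pairing x (φ i).2) = _
  ring

theorem smul_psi_eq (b : Space d → ℝ) {n : ℕ} (φ : Fin n → TestVector d) (x : Space d) :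
    (b x : ℂ) • (k.psi x φ : Fock (twoCopies d)) =
      annihilateMap (fun i => (φ i).toL2) ((b x : ℂ) • k.pairings x φ) +
      (creationMap FinContinuous.one (wedge fun i => (φ i).toL2) ∘L inl)
        ((b x : ℂ) • k.conjKappa₁ x) := by
  rw [psi_eq, map_smul, map_smul, smul_add]
  rfl

theorem memLp_smul_psi {b : Space d → ℝ} (hb : Decaying b) {n : ℕ} (φ : Fin n → TestVector d) :
    MemLp (fun x => (b x : ℂ) • (k.psi x φ : Fock (twoCopies d))) 2 volume := by
  simp only [smul_psi_eq]
  exact memLp_map_add _ _ (k.memLp_smul_pairings hb φ) (k.memLp_smul_conjKappa₁ hb)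

/-- The smeared field applied to a wedge product of test vectors is the integral of `ψ(x)`. -/
theorem field_mulLp_wedge {b : Space d → ℝ} (hb : Decaying b) {n : ℕ} (φ : Fin n → TestVector d)
    (u : Lp ℂ 2 (volume : Measure (Space d))) :
    (k.fieldData.field (mulLp hb.memLp_top u) (wedge fun i => (φ i).toL2) : Fock (twoCopies d)) =
      vecCoeff u fun x => (b x : ℂ) • (k.psi x φ : Fock (twoCopies d)) := by
  simp only [smul_psi_eq]
  rw [vecCoeff_map_add _ _ u (k.memLp_smul_pairings hb φ) (k.memLp_smul_conjKappa₁ hb),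
    annihilateMap_apply, ContinuousLinearMap.comp_apply, ← k.fieldC_mulLp hb, creationMap_apply,
    Module.End.one_apply, FieldData.field_apply, Submodule.coe_add, annihilation_wedge]
  congr 3
  funext i
  exact (k.vecCoeff_smul_pairings hb φ u i).symm

/-- The operator `∑ᵢ Ψ*(p eᵢ) Ψ((f / p) eᵢ)` is the smeared particle density: on wedge products of
test vectors the summands are the coefficients of `p ψ(·) G'` and `(f / p) ψ(·) G`, and Parseval's
identity turns their sum into the integral. -/
theorem exists_isParticleDensity (f : 𝓢(Space d, ℝ)) :
    ∃ T, k.IsParticleDensity f T ∧ k.fieldData.IsSmearing 1 f T := by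
  obtain ⟨T, hT, hs⟩ := k.fieldData.exists_hasSum_fieldAdj_mul_field (k.fieldData.quot f)
    k.fieldData.weight (k.fieldData.summable_quot f) k.fieldData.summable_weight
  refine ⟨T, ⟨hT, fun m n φ χ => ?_⟩, hs⟩
  have hp := k.memLp_smul_psi (decaying_div_bracket f) φ
  have hq := k.memLp_smul_psi decaying_bracket χ
  have he : ∀ x, ⟪((f x * (bracket x)⁻¹ : ℝ) : ℂ) • (k.psi x φ : Fock (twoCopies d)),
      (bracket x : ℂ) • (k.psi x χ : Fock (twoCopies d))⟫ = (f x : ℂ) * ⟪k.psi x φ, k.psi x χ⟫ := by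
    intro x
    have := (bracket_pos x).ne'
    rw [inner_smul_left, inner_smul_right, Complex.conj_ofReal, ← mul_assoc, ← Complex.ofReal_mul,
      inv_mul_cancel_right₀ this]
    rfl
  constructor
  · exact (integrable_inner_of_memLp hp hq).congr (Filter.Eventually.of_forall he)
  · have h1 := hasSum_inner_vecCoeff (hilbertBasis d) hp hq
    simp only [← k.field_mulLp_wedge (decaying_div_bracket f),
      ← k.field_mulLp_wedge decaying_bracket, he] at h1
    exact (hs _ _).unique h1

theorem IsParticleDensity.unique {f : 𝓢(Space d, ℝ)} {T T' : Module.End ℂ (FermiFockFin d)}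
    (h : k.IsParticleDensity f T) (h' : k.IsParticleDensity f T') : T = T' := by
  refine sub_eq_zero.1 ((h.1.sub h'.1).eq_zero_of_wedge dense_range_toL2 fun m s hs => ?_)
  refine FockFin.eq_zero_of_inner_wedge dense_range_toL2 fun n t ht => ?_
  choose φ hφ using hs
  choose χ hχ using ht
  obtain rfl : (fun i => (φ i).toL2) = s := funext hφ
  obtain rfl : (fun i => (χ i).toL2) = t := funext hχ
  have h1 : ⟪T (wedge fun i => (φ i).toL2), wedge fun i => (χ i).toL2⟫ =
      ⟪T' (wedge fun i => (φ i).toL2), wedge fun i => (χ i).toL2⟫ :=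
    (h.2 m n φ χ).2.trans (h'.2 m n φ χ).2.symm
  rw [← inner_conj_symm, LinearMap.sub_apply, inner_sub_left, h1, sub_self, map_zero]

theorem isParticleDensity_rho (f : 𝓢(Space d, ℝ)) : k.IsParticleDensity f (k.rho f) := by
  obtain ⟨T, hT, -⟩ := k.exists_isParticleDensity f
  exact Classical.epsilon_spec (p := k.IsParticleDensity f) ⟨T, hT⟩

theorem isSmearing_rho (f : 𝓢(Space d, ℝ)) : k.fieldData.IsSmearing 1 f (k.rho f) := by
  obtain ⟨T, hT, hs⟩ := k.exists_isParticleDensity f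
  rwa [(k.isParticleDensity_rho f).unique k hT]

end MomentumDensity

/-! ### The vacuum expectation of the normal products -/

theorem continuous_creation_apply {X Y : Type*} [MeasurableSpace X] {ν : Measure X} [SigmaFinite ν]
    [TopologicalSpace Y] {w : Y → Lp ℂ 2 ν} {G : Y → FockFin ν} (hw : Continuous w)
    (hG : Continuous G) : Continuous fun y => creation (w y) (G y) := by
  refine continuous_iff_continuousAt.2 fun y => ?_
  rw [ContinuousAt, tendsto_iff_norm_sub_tendsto_zero]
  have h : ∀ z, ‖creation (w z) (G z) - creation (w y) (G y)‖ ≤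
      ‖w z - w y‖ * ‖G z‖ + ‖w y‖ * ‖G z - G y‖ := by
    intro z
    have h1 : creation (w z) (G z) - creation (w y) (G y) =
        creation (w z - w y) (G z) + creation (w y) (G z - G y) := by
      have h2 := congrArg (fun T : Module.End ℂ (FockFin ν) => T (G z))
        (creation_add (w z - w y) (w y))
      simp only [sub_add_cancel, LinearMap.add_apply] at h2
      rw [h2, map_sub]
      abel
    rw [h1]
    exact (norm_add_le _ _).trans (add_le_add (norm_creation_le _ _) (norm_creation_le _ _))
  refine squeeze_zero (fun _ => norm_nonneg _) h ?_
  have hc : Continuous fun z => ‖w z - w y‖ * ‖G z‖ + ‖w y‖ * ‖G z - G y‖ :=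
    ((hw.sub continuous_const).norm.mul hG.norm).add
      (continuous_const.mul (hG.sub continuous_const).norm)
  have := hc.tendsto y
  simpa using this

namespace MomentumDensity

variable {d : ℕ} (k : MomentumDensity d)

/-- The vectors without particles of the second kind. On them `ψ(x)` acts as the creation operator
`a₁*(ϰ̄_{1,x})`. -/
def FirstKind (G : FermiFockFin d) : Prop := ∀ w, annihilation (inr w) G = 0

theorem firstKind_vacuum : FirstKind (vacuum : FermiFockFin d) := fun _ => annihilation_wedge _ _

theorem FirstKind.creation {G : FermiFockFin d} (hG : FirstKind G)
    (v : Lp ℂ 2 (volume : Measure (Space d))) : FirstKind (creation (inl v) G) := by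
  intro w
  rw [← Module.End.mul_apply, annihilation_mul_creation, inr_apply, inl_apply, inner_pair,
    inner_zero_left, inner_zero_right, add_zero, zero_smul, zero_sub, LinearMap.neg_apply,
    Module.End.mul_apply, ← inr_apply, hG w, map_zero, neg_zero]

/-- The creation operator `a₁*(ϰ̄_{1,x})`. -/
def create₁ (x : Space d) : Module.End ℂ (FermiFockFin d) := creation (inl (k.conjKappa₁ x))

/-- On vectors without particles of the second kind, the smeared field is the integral of
`a₁*(ϰ̄_{1,x})`. -/
theorem coe_field_mulLp_of_firstKind {b : Space d → ℝ} (hb : Decaying b)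
    {T : Module.End ℂ (FermiFockFin d)} (hT : FinContinuous T) {G : FermiFockFin d} (hG : FirstKind G)
    (u : Lp ℂ 2 (volume : Measure (Space d))) :
    (T (k.fieldData.field (mulLp hb.memLp_top u) G) : Fock (twoCopies d)) =
      vecCoeff u fun x => (b x : ℂ) • (T (k.create₁ x G) : Fock (twoCopies d)) := by
  have h1 := vecCoeff_map (creationMap hT G ∘L inl) u (k.memLp_smul_conjKappa₁ hb)
  have h2 : annihilation (k.fieldJ (mulLp hb.memLp_top u)) G = 0 := hG _
  rw [FieldData.field_apply]
  change (T (annihilation (k.fieldJ (mulLp hb.memLp_top u)) G +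
    creation (k.fieldC (mulLp hb.memLp_top u)) G) : Fock (twoCopies d)) = _
  rw [h2, zero_add, k.fieldC_mulLp hb]
  refine h1.symm.trans ?_
  congr 1
  funext x
  rw [map_smul]
  rfl

theorem memLp_smul_create₁ {b : Space d → ℝ} (hb : Decaying b)
    {T : Module.End ℂ (FermiFockFin d)} (hT : FinContinuous T) (G : FermiFockFin d) :
    MemLp (fun x => (b x : ℂ) • (T (k.create₁ x G) : Fock (twoCopies d))) 2 volume := by
  have h := (creationMap hT G ∘L inl).comp_memLp' (k.memLp_smul_conjKappa₁ hb)
  refine h.ae_eq (Filter.Eventually.of_forall fun x => ?_)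
  rw [Function.comp_apply, map_smul]
  rfl

/-- On vectors without particles of the second kind, the smearing of `ψ*(x) T ψ(x)` is the integral
of `a₁(ϰ̄_{1,x}) T a₁*(ϰ̄_{1,x})`. -/
theorem inner_isSmearing {T R : Module.End ℂ (FermiFockFin d)} {f : 𝓢(Space d, ℝ)}
    (hT : FinContinuous T) (h : k.fieldData.IsSmearing T f R) {G G' : FermiFockFin d}
    (hG : FirstKind G) (hG' : FirstKind G') :
    ⟪R G, G'⟫ = ∫ x, (f x : ℂ) * ⟪T (k.create₁ x G), k.create₁ x G'⟫ := by
  have h1 := hasSum_inner_vecCoeff (hilbertBasis d)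
    (k.memLp_smul_create₁ (decaying_div_bracket f) hT G)
    (k.memLp_smul_create₁ decaying_bracket FinContinuous.one G')
  have he : ∀ x, ⟪((f x * (bracket x)⁻¹ : ℝ) : ℂ) • (T (k.create₁ x G) : Fock (twoCopies d)),
      (bracket x : ℂ) • ((1 : Module.End ℂ (FermiFockFin d)) (k.create₁ x G') :
        Fock (twoCopies d))⟫ = (f x : ℂ) * ⟪T (k.create₁ x G), k.create₁ x G'⟫ := by
    intro x
    have := (bracket_pos x).ne'
    rw [inner_smul_left, inner_smul_right, Complex.conj_ofReal, ← mul_assoc, ← Complex.ofReal_mul,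
      inv_mul_cancel_right₀ this]
    rfl
  simp only [← k.coe_field_mulLp_of_firstKind (decaying_div_bracket f) hT hG,
    ← k.coe_field_mulLp_of_firstKind decaying_bracket FinContinuous.one hG', he] at h1
  exact (h _ _).unique h1

/-- The product `a₁*(ϰ̄_{1,xₙ}) ⋯ a₁*(ϰ̄_{1,x₁})`. -/
def creators : (n : ℕ) → (Fin n → Space d) → Module.End ℂ (FermiFockFin d)
  | 0, _ => 1
  | n + 1, x => creators n (fun i => x i.succ) * k.create₁ (x 0)

theorem continuous_create₁ : Continuous fun p : Space d × FermiFockFin d => k.create₁ p.1 p.2 := by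
  refine continuous_creation_apply (w := fun p : Space d × FermiFockFin d =>
    inl (k.conjKappa₁ p.1)) (G := fun p => p.2) ?_ continuous_snd
  exact inl.continuous.comp (k.continuous_conjKappa₁.comp continuous_fst)

theorem continuous_creators (n : ℕ) :
    Continuous fun p : (Fin n → Space d) × FermiFockFin d => k.creators n p.1 p.2 := by
  induction n with
  | zero => exact continuous_snd
  | succ n ih =>
    have h1 : Continuous fun p : (Fin (n + 1) → Space d) × FermiFockFin d => (p.1 0, p.2) :=
      ((continuous_apply 0).comp continuous_fst).prodMk continuous_snd
    have h2 : Continuous fun p : (Fin (n + 1) → Space d) × FermiFockFin d => fun i : Fin n =>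
        p.1 i.succ := continuous_pi fun i => (continuous_apply i.succ).comp continuous_fst
    exact ih.comp (h2.prodMk (k.continuous_create₁.comp h1))

theorem norm_create₁_le (x : Space d) (G : FermiFockFin d) :
    ‖k.create₁ x G‖ ≤ ‖k.kappa₁‖ * ‖G‖ := by
  refine (norm_creation_le _ _).trans (le_of_eq ?_)
  rw [inl_apply, norm_pair_zero, norm_conjKappa₁]

theorem norm_creators_le (n : ℕ) (x : Fin n → Space d) (G : FermiFockFin d) :
    ‖k.creators n x G‖ ≤ ‖k.kappa₁‖ ^ n * ‖G‖ := by
  induction n generalizing G with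
  | zero => rw [pow_zero, one_mul]; exact le_rfl
  | succ n ih =>
    refine (ih _ _).trans ?_
    rw [pow_succ, mul_assoc]
    exact mul_le_mul_of_nonneg_left (k.norm_create₁_le _ _) (by positivity)

theorem create₁_mul_create₁ (x y : Space d) :
    k.create₁ x * k.create₁ y = (-1 : ℂ) • (k.create₁ y * k.create₁ x) :=
  (creation_mul_creation _ _).trans (neg_one_smul ℂ _).symm

theorem creators_mul_create₁ (n : ℕ) (x : Fin n → Space d) (y : Space d) :
    k.creators n x * k.create₁ y = (-1 : ℂ) ^ n • (k.create₁ y * k.creators n x) := by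
  induction n with
  | zero => rw [pow_zero, one_smul]; rfl
  | succ n ih =>
    rw [creators, mul_assoc, create₁_mul_create₁, mul_smul_comm, ← mul_assoc, ih, smul_mul_assoc,
      smul_smul, ← pow_succ', mul_assoc]

/-- The product of the creation operators applied to the vacuum is `√(n!)` times a wedge product, up to
a sign `c` from the order of the factors. -/
theorem creators_vacuum (n : ℕ) (x : Fin n → Space d) : ∃ c : ℂ, (starRingEnd ℂ) c * c = 1 ∧
    k.creators n x vacuum = (c * (Real.sqrt (n.factorial : ℝ) : ℂ)) •
      wedge fun i => inl (k.conjKappa₁ (x i)) := by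
  induction n with
  | zero =>
    refine ⟨1, by simp, ?_⟩
    have : (fun i => inl (k.conjKappa₁ (x i))) = (Fin.elim0 : Fin 0 → Lp ℂ 2 (twoCopies d)) :=
      funext fun i => i.elim0
    rw [this]
    simp [creators, vacuum]
  | succ n ih =>
    obtain ⟨c, hc, h⟩ := ih fun i => x i.succ
    refine ⟨(-1) ^ n * c, ?_, ?_⟩
    · rw [map_mul, map_pow, map_neg, map_one, mul_mul_mul_comm, hc, ← pow_add, mul_one]
      exact Even.neg_one_pow ⟨n, rfl⟩
    · rw [creators, creators_mul_create₁, LinearMap.smul_apply, Module.End.mul_apply, h, map_smul,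
        create₁, creation_wedge, create, smul_smul, smul_smul]
      congr 1
      · rw [Nat.factorial_succ, Nat.cast_mul, Real.sqrt_mul (by positivity)]
        push_cast
        ring
      · congr 1
        funext i
        refine Fin.cases ?_ (fun i => ?_) i <;> simp

theorem inner_creators_vacuum (n : ℕ) (x : Fin n → Space d) :
    ⟪k.creators n x vacuum, k.creators n x vacuum⟫ =
      (Matrix.of fun i j => k.kappa (x i - x j)).det := by
  obtain ⟨c, hc, h⟩ := k.creators_vacuum n x
  have hn : (n.factorial : ℂ) ≠ 0 := by exact_mod_cast n.factorial_ne_zero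
  have hs : (Real.sqrt (n.factorial : ℝ) : ℂ) * (Real.sqrt (n.factorial : ℝ) : ℂ) =
      (n.factorial : ℂ) := by
    rw [← Complex.ofReal_mul, Real.mul_self_sqrt (by positivity)]
    simp
  rw [h, FockFin.inner_smul_left, FockFin.inner_smul_right, inner_wedge, map_mul,
    Complex.conj_ofReal, ← Matrix.det_transpose]
  have hM : (Matrix.of fun i j => ⟪inl (k.conjKappa₁ (x i)), inl (k.conjKappa₁ (x j))⟫).transpose =
      Matrix.of fun i j => k.kappa (x i - x j) := by
    ext i j
    rw [Matrix.transpose_apply, Matrix.of_apply, Matrix.of_apply, inl_apply, inl_apply, inner_pair,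
      inner_zero_left, add_zero, inner_conjKappa₁]
  rw [hM]
  field_simp
  linear_combination (Matrix.of fun i j => k.kappa (x i - x j)).det * (n.factorial : ℂ) * hc +
    (Matrix.of fun i j => k.kappa (x i - x j)).det * ((starRingEnd ℂ) c * c) * hs

theorem integrable_prod_schwartz (n : ℕ) (f : Fin n → 𝓢(Space d, ℝ)) :
    Integrable fun x : Fin n → Space d => ∏ i, (f i (x i) : ℂ) :=
  Integrable.fintype_prod (f := fun i (y : Space d) => (f i y : ℂ))
    fun i => (f i).integrable.ofReal

theorem integrable_prod_mul_inner (n : ℕ) (f : Fin n → 𝓢(Space d, ℝ)) (G G' : FermiFockFin d) :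
    Integrable fun x : Fin n → Space d =>
      (∏ i, (f i (x i) : ℂ)) * ⟪k.creators n x G, k.creators n x G'⟫ := by
  have hc : ∀ G : FermiFockFin d, Continuous fun x : Fin n → Space d => k.creators n x G :=
    fun G => (k.continuous_creators n).comp (continuous_id.prodMk continuous_const)
  refine (integrable_prod_schwartz n f).mul_bdd (c := (‖k.kappa₁‖ ^ n * ‖G‖) *
    (‖k.kappa₁‖ ^ n * ‖G'‖)) ((hc G).inner (hc G')).aestronglyMeasurable
    (Filter.Eventually.of_forall fun x => ?_)
  exact (norm_inner_le_norm _ _).trans (mul_le_mul (k.norm_creators_le n x G)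
    (k.norm_creators_le n x G') (norm_nonneg _) (by positivity))

/-- The integral over the first variable can be carried out separately. -/
theorem integral_creators_succ (n : ℕ) (f : Fin (n + 1) → 𝓢(Space d, ℝ)) (G G' : FermiFockFin d) :
    ∫ x : Fin (n + 1) → Space d, (∏ i, (f i (x i) : ℂ)) *
      ⟪k.creators (n + 1) x G, k.creators (n + 1) x G'⟫ =
    ∫ y : Space d, (f 0 y : ℂ) * ∫ x : Fin n → Space d, (∏ i, (f i.succ (x i) : ℂ)) *
      ⟪k.creators n x (k.create₁ y G), k.creators n x (k.create₁ y G')⟫ := by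
  let F : Space d → (Fin n → Space d) → ℂ := fun y x => ((f 0 y : ℂ) *
    ∏ i, (f i.succ (x i) : ℂ)) *
      ⟪k.creators n x (k.create₁ y G), k.creators n x (k.create₁ y G')⟫
  have h1 : ∀ x : Fin (n + 1) → Space d, (∏ i, (f i (x i) : ℂ)) *
      ⟪k.creators (n + 1) x G, k.creators (n + 1) x G'⟫ = F (x 0) fun i => x i.succ := fun x => by
    rw [Fin.prod_univ_succ]
    rfl
  have h2 : Integrable (fun p : Space d × (Fin n → Space d) => F p.1 p.2)
      ((volume : Measure (Space d)).prod (Measure.pi fun _ => volume)) := by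
    have h := k.integrable_prod_mul_inner (n + 1) f G G'
    simp only [h1] at h
    exact ((measurePreserving_piFinSuccAbove (fun _ : Fin (n + 1) => (volume : Measure (Space d)))
      0).integrable_comp_emb (MeasurableEquiv.measurableEmbedding _)
      (g := fun p : Space d × (Fin n → Space d) => F p.1 p.2)).1 h
  simp only [h1]
  refine (integral_head_tail (ν := (volume : Measure (Space d))) F).trans ?_
  rw [integral_prod _ h2]
  refine integral_congr_ae (Filter.Eventually.of_forall fun y => ?_)
  simp only [F, mul_assoc]
  exact integral_const_mul _ _

/-- The normal products in the vectors without particles of the second kind, by carrying out the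
smearings one after the other. -/
theorem inner_normalProduct_rho (n : ℕ) (f : Fin n → 𝓢(Space d, ℝ)) {G G' : FermiFockFin d}
    (hG : FirstKind G) (hG' : FirstKind G') : ⟪normalProduct k.rho n f G, G'⟫ =
      ∫ x : Fin n → Space d, (∏ i, (f i (x i) : ℂ)) * ⟪k.creators n x G, k.creators n x G'⟫ := by
  induction n generalizing G G' with
  | zero =>
    rw [volume_pi, Measure.pi_of_empty]
    rw [integral_dirac]
    simp [normalProduct, creators]
  | succ n ih =>
    have hρ : ∀ f, FinContinuous (k.rho f) := fun f => (k.isParticleDensity_rho f).1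
    rw [integral_creators_succ, k.inner_isSmearing (FinContinuous.normalProduct hρ n (f ∘ Fin.succ))
      (FieldData.isSmearing_normalProduct hρ k.isSmearing_rho n f) hG hG']
    refine integral_congr_ae (Filter.Eventually.of_forall fun y => ?_)
    simp only
    rw [ih (f ∘ Fin.succ) (G := k.create₁ y G) (G' := k.create₁ y G') (hG.creation _)
      (hG'.creation _)]
    rfl

theorem integrable_prod_mul_det (n : ℕ) (f : Fin n → 𝓢(Space d, ℝ)) :
    Integrable fun x : Fin n → Space d => (∏ i, (f i (x i) : ℂ)) *
      (Matrix.of fun i j => k.kappa (x i - x j)).det := by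
  simp only [← inner_creators_vacuum]
  exact k.integrable_prod_mul_inner n f vacuum vacuum

theorem inner_normalProduct_rho_vacuum (n : ℕ) (f : Fin n → 𝓢(Space d, ℝ)) :
    ⟪normalProduct k.rho n f vacuum, vacuum⟫ = ∫ x : Fin n → Space d, (∏ i, (f i (x i) : ℂ)) *
      (Matrix.of fun i j => k.kappa (x i - x j)).det := by
  rw [k.inner_normalProduct_rho n f firstKind_vacuum firstKind_vacuum]
  simp only [inner_creators_vacuum]

theorem symTensor_mul (n : ℕ) (f : Fin n → 𝓢(Space d, ℝ)) (x : Fin n → Space d) (D : ℂ) :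
    (symTensor f x : ℂ) * D = (n.factorial : ℂ)⁻¹ *
      ∑ σ : Equiv.Perm (Fin n), (∏ i, ((f ∘ σ) i (x i) : ℂ)) * D := by
  rw [symTensor, ← Finset.sum_mul, ← mul_assoc]
  push_cast
  rfl

end MomentumDensity

end FermiGas

end

theorem proposition3p2 (d : ℕ) (k : FermiGas.MomentumDensity d) :
    (∀ f : SchwartzMap (FermiGas.Space d) ℝ, ∃! T, k.IsParticleDensity f T) ∧
    ∀ (n : ℕ) (f : Fin n → SchwartzMap (FermiGas.Space d) ℝ),
      MeasureTheory.Integrable (fun x : Fin n → FermiGas.Space d =>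
        (FermiGas.symTensor f x : ℂ) * (Matrix.of fun i j => k.kappa (x i - x j)).det) ∧
      inner ℂ (FermiGas.normalProduct k.rho n f FermiGas.vacuum) FermiGas.vacuum =
        ∫ x : Fin n → FermiGas.Space d,
          (FermiGas.symTensor f x : ℂ) * (Matrix.of fun i j => k.kappa (x i - x j)).det := by
  refine ⟨fun f => ⟨k.rho f, k.isParticleDensity_rho f, fun T hT =>
    hT.unique k (k.isParticleDensity_rho f)⟩, fun n f => ?_⟩
  have hi := fun σ : Equiv.Perm (Fin n) => k.integrable_prod_mul_det n (f ∘ σ)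
  simp only [FermiGas.MomentumDensity.symTensor_mul]
  refine ⟨(integrable_finsetSum _ fun σ _ => hi σ).const_mul _, ?_⟩
  rw [integral_const_mul, integral_finsetSum _ fun σ _ => hi σ]
  -- the normal products are symmetric, so that all permutations contribute the same
  have hσ : ∀ σ : Equiv.Perm (Fin n), ∫ x : Fin n → FermiGas.Space d,
      (∏ i, ((f ∘ σ) i (x i) : ℂ)) * (Matrix.of fun i j => k.kappa (x i - x j)).det =
      inner ℂ (FermiGas.normalProduct k.rho n f FermiGas.vacuum) FermiGas.vacuum := fun σ => by
    rw [← FermiGas.normalProduct_comp_perm k.rho n f σ]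
    exact (k.inner_normalProduct_rho_vacuum n (f ∘ σ)).symm
  rw [Finset.sum_congr rfl fun σ _ => hσ σ, Finset.sum_const, Finset.card_univ,
    Fintype.card_perm, Fintype.card_fin, nsmul_eq_mul, inv_mul_cancel_left₀]
  exact_mod_cast n.factorial_ne_zero
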